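/- Let $B=\{z\in\mathbb C:|z|<1\}$ be the open unit disc in $\mathbb R^2\cong\mathbb C$, with Lebesgue measure $dz$ and line element $ds_0$ on $\partial B$. For $0<R<1$ let $$\psi_R(z)=\frac{2Rz}{1+|Rz|^2},\qquad z\in\bar B.$$ For all $0<R_0\le R_1<1$ there is a constant $C=C(R_0,R_1)\ge 0$ with the following property. Let $v\in H^1(B)$ be real-valued (with $v$ on $\partial B$ understood as its trace) and suppose that for some $R\in[R_0,R_1]$ $$\frac12\int_B\psi_R(z)\,e^{2v}\,dz+\int_{\partial B}\psi_R(z)\,e^{v}\,ds_0=0\in\mathbb R^2 .$$ Then $e^{v}$ is integrable on $\partial B$, $e^{2v}$ is integrable on $B$, and $$\frac{1}{6\pi}\int_B|\nabla v|^2\,dz+\frac1{2\pi}\int_{\partial B}v\,ds_0\ \ge\ \max\Big\{\log\Big(\frac1{2\pi}\int_{\partial B}e^{v}\,ds_0\Big),\ \frac12\log\Big(\frac1{\pi}\int_Be^{2v}\,dz\Big)\Big\}-C .$$ -/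

import Mathlib

open MeasureTheory Filter Topology Set
open scoped ContDiff

noncomputable section

namespace DiscSobolev

/-- The open unit disc `B` in the plane, the plane being identified with `ℂ`. -/
def disc : Set ℂ := Metric.ball 0 1

/-- The line element `ds₀` on the unit circle `∂B`, as a measure on the plane: the image of
Lebesgue measure on `(0, 2π]` under `θ ↦ exp (iθ)`. -/
def arcLength : Measure ℂ :=
  (volume.restrict (Ioc (0 : ℝ) (2 * Real.pi))).map (circleMap 0 1)

/-- `g` is a weak gradient of `v` on the disc (a gradient `(∂₁v, ∂₂v)` is the complex number
`∂₁v + i ∂₂v`): `∫_B v ∂ₑη = - ∫_B ⟨g, e⟩ η` for all test functions `η ∈ C_c^∞(B)` and all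
directions `e`. -/
def IsWeakGrad (v : ℂ → ℝ) (g : ℂ → ℂ) : Prop :=
  ∀ η : ℂ → ℝ, ContDiff ℝ ∞ η → HasCompactSupport η → tsupport η ⊆ disc →
    ∀ e : ℂ, ∫ z in disc, v z * fderiv ℝ η z e = -∫ z in disc, inner ℝ (g z) e * η z

/-- The Sobolev space `H¹(B)`: functions in `L²(B)` with a weak gradient in `L²(B)`. -/
def MemH1 (v : ℂ → ℝ) : Prop :=
  MemLp v 2 (volume.restrict disc) ∧
    ∃ g : ℂ → ℂ, MemLp g 2 (volume.restrict disc) ∧ IsWeakGrad v g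

open Classical in
/-- The weak gradient in `L²(B)` of `v ∈ H¹(B)`, which is unique almost everywhere
(and `0` if `v ∉ H¹(B)`). -/
def weakGrad (v : ℂ → ℝ) : ℂ → ℂ :=
  if h : ∃ g : ℂ → ℂ, MemLp g 2 (volume.restrict disc) ∧ IsWeakGrad v g then h.choose else 0

/-- `τ ∈ L²(∂B)` is the trace of `v` on `∂B`: the restrictions to `∂B` of smooth functions `u n`
that converge to `v` in `H¹(B)` converge to `τ` in `L²(∂B)`. -/
def IsTrace (v τ : ℂ → ℝ) : Prop :=
  MemLp τ 2 arcLength ∧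
    ∃ u : ℕ → ℂ → ℝ, (∀ n, ContDiff ℝ ∞ (u n)) ∧
      Tendsto (fun n => eLpNorm (u n - v) 2 (volume.restrict disc)) atTop (𝓝 0) ∧
      Tendsto (fun n => eLpNorm (gradient (u n) - weakGrad v) 2 (volume.restrict disc))
        atTop (𝓝 0) ∧
      Tendsto (fun n => eLpNorm (u n - τ) 2 arcLength) atTop (𝓝 0)

open Classical in
/-- The trace on `∂B` of `v ∈ H¹(B)`, which is unique almost everywhere on `∂B`
(and `0` if `v` has no trace). -/
def trace (v : ℂ → ℝ) : ℂ → ℝ :=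
  if h : ∃ τ : ℂ → ℝ, IsTrace v τ then h.choose else 0

/-- `ψ_R(z) = 2Rz / (1 + |Rz|²)`: the horizontal part of the inverse stereographic projection
of `Rz`. -/
def psi (R : ℝ) (z : ℂ) : ℂ := (2 * R / (1 + ‖(R : ℂ) * z‖ ^ 2)) • z

/-- The centre-of-mass normalization
`½ ∫_B ψ_R e^{2v} dz + ∫_{∂B} ψ_R e^v ds₀ = 0`, an equation between vectors in the plane. -/
def IsCentered (R : ℝ) (v : ℂ → ℝ) : Prop :=
  (1 / 2 : ℝ) • (∫ z in disc, Real.exp (2 * v z) • psi R z) +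
    ∫ z, Real.exp (trace v z) • psi R z ∂arcLength = 0

end DiscSobolev

end

open MeasureTheory Filter Topology Set
open scoped ContDiff

noncomputable section

namespace DiscSobolev

/-! Write E for the Dirichlet energy of a function u smooth up to the boundary, H for the energy of
its harmonic part and m for its mean over the circle. The remaining part of u vanishes on the circle
and carries the energy E - H. That part is cheap: in the half logarithm of the integral of e^{2u} it
costs E - H with a coefficient close to 1/(8π), below 1/(6π). The harmonic part is the problem: the
Lebedev-Milin inequality bounds the logarithm of the boundary mass of e^u by m + H/(4π), up to a
factor close to 1, and 1/(4π) is too large. This cost is reached only by concentration at one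
boundary point, and the centring condition excludes that.

Both estimates come from duality. Gradients of Green functions (`fieldQ`) and of the harmonic
functions -log|1 - conj(ζ) y| (`fieldZ`) are superposed with densities. Pairing them with the
gradient of u gives u minus its Poisson integral and the boundary values of u, and the two families
are orthogonal (`integral_gQ_gZ`). Completing the square therefore bounds linear functionals of u by
E - H or H plus a logarithmic energy of the density. The harmonic energy is defined as the supremum
of the resulting quadratic functional; what is used of it is `LipDisc.harmonicEnergy_add_le`. If the
density is the Gibbs density proportional to the exponential, the variational inequality `gibbs`,
with a logarithmic kernel whose exponential is uniformly integrable, bounds the logarithm of the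
partition function minus the linear functional by minus the same logarithmic energy. Choosing
constants so that the logarithmic energies cancel gives `integral_exp_boundary_le` and
`integral_exp_disc_le_of_kernel`.

The gain of a factor two (`integral_exp_mul_integral_exp_le`) comes from testing with the average of
the Gibbs densities of two separated boundary pieces. The cross terms of the logarithmic energy are
bounded and the diagonal terms are divided by four. Hence the product of the two boundary masses
costs what a single mass costs without the gain, and one of the pieces has small mass.

If the measure ½ e^{2u} dz + e^u ds₀ is nearly balanced, then either half of its disc mass lies in a
smaller concentric disc, where the interior bound needs no boundary piece, or two opposite caps both
carry a fixed share of the total (`mass_cap_ge`). In the second case the cap with light boundary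
piece controls its own disc mass by `integral_exp_disc_le`. It therefore controls the total, because
it carries a fixed share of the disc mass or of the circle mass (`exists_massBound_of_cap`). A trace
inequality transfers a bound of the disc mass to the circle mass. The numerical constants leave just
enough room to end at 1/(6π).

Finally a Sobolev function is approximated by smooth functions obtained by dilation and
mollification. Uniform exponential bounds make the exponential integrals converge, and since the
smooth theorem tolerates a small fraction of the mass as centring error, it applies to the
approximations from some index on. -/

lemma isOpen_disc : IsOpen disc := Metric.isOpen_ball

lemma measurableSet_disc : MeasurableSet disc := isOpen_disc.measurableSet

lemma mem_disc {z : ℂ} : z ∈ disc ↔ ‖z‖ < 1 := by simp [disc]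

/-! ### Polar coordinates and arc length. -/

lemma integrableOn_polarCoord_symm {f : ℂ → ℝ} (hf : Integrable f) :
    IntegrableOn (fun p : ℝ × ℝ => p.1 * f (Complex.polarCoord.symm p)) polarCoord.target := by
  have h1 : Integrable (f ∘ Complex.measurableEquivRealProd.symm) :=
    (Complex.volume_preserving_equiv_real_prod.symm).integrable_comp_emb
      Complex.measurableEquivRealProd.symm.measurableEmbedding |>.2 hf
  have h2 := (integrableOn_image_iff_integrableOn_abs_det_fderiv_smul volume
    (polarCoord.open_target.measurableSet)
    (fun p _ => (hasFDerivAt_polarCoord_symm p).hasFDerivWithinAt)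
    polarCoord.symm.injOn (f ∘ Complex.measurableEquivRealProd.symm)).1 h1.integrableOn
  refine h2.congr_fun (fun p hp => ?_) polarCoord.open_target.measurableSet
  simp only [det_fderivPolarCoordSymm, smul_eq_mul, Function.comp]
  rw [abs_of_pos hp.1, Complex.measurableEquivRealProd_symm_polarCoord_symm_apply]

lemma polarCoord_symm_eq_circleMap (r θ : ℝ) :
    Complex.polarCoord.symm (r, θ) = circleMap 0 r θ := by
  rw [Complex.polarCoord_symm_apply, circleMap, Complex.exp_mul_I]
  push_cast; ring

lemma norm_circleMap_of_pos {r : ℝ} (hr : 0 < r) (θ : ℝ) : ‖circleMap 0 r θ‖ = r := by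
  simp [abs_of_pos hr]

/-- Integrability in polar coordinates on the unit disc. -/
lemma integrableOn_disc_polar {f : ℂ → ℝ} (hf : IntegrableOn f disc) :
    IntegrableOn (fun p : ℝ × ℝ => p.1 * f (circleMap 0 p.1 p.2))
      (Ioo 0 1 ×ˢ Ioo (-Real.pi) Real.pi) := by
  have h := integrableOn_polarCoord_symm ((integrable_indicator_iff measurableSet_disc).2 hf)
  refine (h.mono_set ?_).congr_fun ?_ (measurableSet_Ioo.prod measurableSet_Ioo)
  · rintro ⟨r, θ⟩ ⟨h1, h2⟩
    exact ⟨h1.1, h2⟩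
  · rintro ⟨r, θ⟩ ⟨h1, h2⟩
    simp only
    rw [polarCoord_symm_eq_circleMap, indicator_of_mem]
    rw [mem_disc]
    rw [norm_circleMap_of_pos h1.1]; exact h1.2

lemma integral_disc_polar (f : ℂ → ℝ) :
    ∫ z in disc, f z = ∫ p in Ioo (0 : ℝ) 1 ×ˢ Ioo (-Real.pi) Real.pi,
      p.1 * f (circleMap 0 p.1 p.2) := by
  rw [← integral_indicator measurableSet_disc,
    ← Complex.integral_comp_polarCoord_symm]
  have hsub : Ioo (0 : ℝ) 1 ×ˢ Ioo (-Real.pi) Real.pi ⊆ polarCoord.target := by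
    rintro ⟨r, θ⟩ ⟨h1, h2⟩
    exact ⟨h1.1, h2⟩
  symm
  rw [← integral_indicator (measurableSet_Ioo.prod measurableSet_Ioo),
    ← integral_indicator polarCoord.open_target.measurableSet]
  congr 1
  ext ⟨r, θ⟩
  by_cases ht : (r, θ) ∈ polarCoord.target
  · rw [indicator_of_mem ht, polarCoord_symm_eq_circleMap]
    have hr : 0 < r := ht.1
    by_cases h1 : r < 1
    · have hm : (r, θ) ∈ Ioo (0 : ℝ) 1 ×ˢ Ioo (-Real.pi) Real.pi := ⟨⟨hr, h1⟩, ht.2⟩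
      rw [indicator_of_mem hm, indicator_of_mem]
      · rfl
      · rw [mem_disc]
        rw [norm_circleMap_of_pos hr]; exact h1
    · rw [indicator_of_notMem (fun h => h1 h.1.2), indicator_of_notMem, smul_zero]
      rw [mem_disc]
      rw [norm_circleMap_of_pos hr]; exact h1
  · rw [indicator_of_notMem ht, indicator_of_notMem (fun h => ht (hsub h))]

instance : IsFiniteMeasure arcLength := by
  unfold arcLength; infer_instance

/-- By periodicity the window can be moved to (-π, π), the range of angles of the polar coordinates.
-/
lemma integral_arcLength_eq {f : ℂ → ℝ} (hf : AEStronglyMeasurable f arcLength) :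
    ∫ z, f z ∂arcLength = ∫ θ in (-Real.pi)..Real.pi, f (circleMap 0 1 θ) := by
  rw [arcLength, integral_map (continuous_circleMap 0 1).aemeasurable hf,
    ← intervalIntegral.integral_of_le (by positivity)]
  have hp : Function.Periodic (fun θ => f (circleMap 0 1 θ)) (2 * Real.pi) := fun x => by
    simp only [periodic_circleMap 0 1 x]
  have := hp.intervalIntegral_add_eq 0 (-Real.pi)
  rw [zero_add] at this
  rw [this]; congr 1; ring

lemma ae_arcLength_norm : ∀ᵐ z ∂arcLength, ‖z‖ = 1 := by
  rw [arcLength, ae_map_iff (continuous_circleMap 0 1).aemeasurable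
    (isClosed_eq continuous_norm continuous_const).measurableSet]
  simp

lemma arcLength_restrict_sphere : arcLength.restrict (Metric.sphere (0 : ℂ) 1) = arcLength := by
  refine Measure.restrict_eq_self_of_ae_mem ?_
  filter_upwards [ae_arcLength_norm] with z hz
  simpa using hz

lemma aestronglyMeasurable_arcLength {E : Type*} [NormedAddCommGroup E] {f : ℂ → E}
    (hf : ContinuousOn f (Metric.sphere (0 : ℂ) 1)) : AEStronglyMeasurable f arcLength := by
  rw [← arcLength_restrict_sphere]
  exact hf.aestronglyMeasurable_of_isCompact (isCompact_sphere 0 1) Metric.isClosed_sphere.measurableSet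

lemma integrable_arcLength {E : Type*} [NormedAddCommGroup E] {f : ℂ → E}
    (hf : ContinuousOn f (Metric.sphere (0 : ℂ) 1)) : Integrable f arcLength := by
  rw [← arcLength_restrict_sphere]
  exact hf.integrableOn_compact (isCompact_sphere 0 1)

lemma hasDerivAt_circleMap_radius (θ r : ℝ) :
    HasDerivAt (fun r : ℝ => circleMap 0 r θ) (circleMap 0 1 θ) r := by
  have : (fun r : ℝ => circleMap 0 r θ) = fun r : ℝ => (r : ℂ) * circleMap 0 1 θ := by
    ext r; simp [circleMap]
  rw [this]
  simpa using (Complex.ofRealCLM.hasDerivAt (x := r)).mul_const (circleMap 0 1 θ)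

lemma circleMap_zero_eq_mul (r θ : ℝ) : circleMap 0 r θ = (r : ℂ) * circleMap 0 1 θ := by
  simp [circleMap]

/-- A ray direction in `(-π, π)` is determined by any nonzero point on the ray. -/
lemma finite_bad_angles {S : Set ℂ} (hS : S.Finite) :
    (volume.restrict (Ioo (-Real.pi) Real.pi))
      {θ : ℝ | ¬ ∀ r : ℝ, 0 < r → circleMap 0 r θ ∉ S} = 0 := by
  rw [Measure.restrict_apply']
  · refine (Set.Finite.measure_zero ((hS.image Complex.arg).subset ?_) _)
    rintro θ ⟨h1, h2⟩
    simp only [Set.mem_ofPred_eq, not_forall, not_not] at h1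
    obtain ⟨r, hr, h⟩ := h1
    refine ⟨_, h, ?_⟩
    rw [circleMap, zero_add, Complex.exp_mul_I]
    exact Complex.arg_mul_cos_add_sin_mul_I hr ⟨h2.1, h2.2.le⟩
  · exact measurableSet_Ioo

/-! ### Integration by parts on the disc. -/

/-- In polar coordinates the Jacobian and the weight 1/‖y‖² turn the integrand into the radial
derivative of a. Almost every ray avoids the exceptional set, so the fundamental theorem of calculus
applies on it, and a vanishes at its starting point. -/
lemma integral_radial {a : ℂ → ℝ} {S : Set ℂ} (hS : S.Finite)
    (ha : ∀ y, ‖y‖ ≤ 1 → y ≠ 0 → y ∉ S → DifferentiableAt ℝ a y)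
    (h0 : ContinuousAt a 0) (h00 : a 0 = 0) (hc : ContinuousOn a (Metric.sphere (0 : ℂ) 1))
    (hint : IntegrableOn (fun y => fderiv ℝ a y y / ‖y‖ ^ 2) disc) :
    ∫ y in disc, fderiv ℝ a y y / ‖y‖ ^ 2 = ∫ y, a y ∂arcLength := by
  have hI := integrableOn_disc_polar hint
  rw [integral_disc_polar, integral_arcLength_eq (aestronglyMeasurable_arcLength hc),
    intervalIntegral.integral_of_le (by linarith [Real.pi_pos]),
    integral_Ioc_eq_integral_Ioo]
  rw [Measure.volume_eq_prod, ← Measure.prod_restrict] at *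
  rw [IntegrableOn, ← Measure.prod_restrict] at hI
  rw [integral_prod_symm _ hI]
  refine integral_congr_ae ?_
  filter_upwards [hI.prod_left_ae, (show ∀ᵐ θ ∂(volume.restrict (Ioo (-Real.pi) Real.pi)),
    ∀ r : ℝ, 0 < r → circleMap 0 r θ ∉ S from finite_bad_angles hS)] with θ hθ hθS
  have hd : ∀ r : ℝ, 0 < r → r ≤ 1 → HasDerivAt (fun r : ℝ => a (circleMap 0 r θ))
      (r * (fderiv ℝ a (circleMap 0 r θ) (circleMap 0 r θ) / ‖circleMap 0 r θ‖ ^ 2)) r := by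
    intro r hr hr1
    have hn := norm_circleMap_of_pos hr θ
    have hne : circleMap 0 r θ ≠ 0 := by
      rw [← norm_pos_iff, hn]; exact hr
    have h := (ha _ (hn.trans_le hr1) hne (hθS r hr)).hasFDerivAt.comp_hasDerivAt r
      (hasDerivAt_circleMap_radius θ r)
    refine h.congr_deriv ?_
    rw [hn]
    have : circleMap 0 r θ = r • circleMap 0 1 θ := by rw [circleMap_zero_eq_mul]; simp
    rw [show fderiv ℝ a (circleMap 0 r θ) (circleMap 0 r θ) =
      r * fderiv ℝ a (circleMap 0 r θ) (circleMap 0 1 θ) by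
        conv_lhs => rw [show (fderiv ℝ a (circleMap 0 r θ)) (circleMap 0 r θ) =
          (fderiv ℝ a (circleMap 0 r θ)) (r • circleMap 0 1 θ) by rw [← this]]
        rw [map_smul, smul_eq_mul]]
    field_simp
  have hftc := intervalIntegral.integral_eq_sub_of_hasDerivAt_of_le (zero_le_one' ℝ)
    (f := fun r : ℝ => a (circleMap 0 r θ))
    (f' := fun r => (r * (fderiv ℝ a (circleMap 0 r θ) (circleMap 0 r θ) / ‖circleMap 0 r θ‖ ^ 2)))
    ?_ (fun r hr => hd r hr.1 hr.2.le) ?_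
  · rw [intervalIntegral.integral_of_le zero_le_one, integral_Ioc_eq_integral_Ioo] at hftc
    rw [hftc]
    simp [h00]
  · intro r hr
    rcases hr.1.eq_or_lt with h | h
    · subst h
      have h1 : ContinuousAt (fun r : ℝ => circleMap 0 r θ) 0 :=
        (hasDerivAt_circleMap_radius θ 0).continuousAt
      have h2 : ContinuousAt a ((fun r : ℝ => circleMap 0 r θ) 0) := by simpa using h0
      exact (ContinuousAt.comp (f := fun r : ℝ => circleMap 0 r θ) h2 h1).continuousWithinAt
    · exact (hd r h hr.2).continuousAt.continuousWithinAt
  · rw [intervalIntegrable_iff_integrableOn_Ioo_of_le zero_le_one]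
    exact hθ

/-- On almost every circle about the origin the integrand is a constant multiple of the derivative
of a periodic function of the angle. -/
lemma integral_angular {b : ℂ → ℝ} {S : Set ℂ} (hS : S.Finite)
    (hb : ∀ y, ‖y‖ ≤ 1 → y ≠ 0 → y ∉ S → DifferentiableAt ℝ b y)
    (hint : IntegrableOn (fun y => fderiv ℝ b y (Complex.I * y) / ‖y‖ ^ 2) disc) :
    ∫ y in disc, fderiv ℝ b y (Complex.I * y) / ‖y‖ ^ 2 = 0 := by
  have hI := integrableOn_disc_polar hint
  rw [integral_disc_polar]
  rw [Measure.volume_eq_prod, ← Measure.prod_restrict] at *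
  rw [IntegrableOn, ← Measure.prod_restrict] at hI
  rw [integral_prod _ hI]
  refine integral_eq_zero_of_ae ?_
  have hbad : ∀ᵐ r ∂(volume.restrict (Ioo (0 : ℝ) 1)), r ∉ norm '' S :=
    ae_restrict_of_ae ((hS.image norm).countable.ae_notMem volume)
  filter_upwards [hI.prod_right_ae, hbad, ae_restrict_mem measurableSet_Ioo] with r hr hrS hr01
  have hn := norm_circleMap_of_pos hr01.1
  have hd : ∀ θ : ℝ, HasDerivAt (fun θ : ℝ => b (circleMap 0 r θ))
      (fderiv ℝ b (circleMap 0 r θ) (Complex.I * circleMap 0 r θ)) θ := by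
    intro θ
    have hne : circleMap 0 r θ ≠ 0 := by
      rw [← norm_pos_iff, hn]; exact hr01.1
    have h := (hb _ ((hn θ).trans_le hr01.2.le) hne
      (fun h => hrS ⟨_, h, hn θ⟩)).hasFDerivAt.comp_hasDerivAt θ
      (hasDerivAt_circleMap 0 r θ)
    rw [mul_comm] at h
    exact h
  have hftc := intervalIntegral.integral_eq_sub_of_hasDerivAt (a := -Real.pi) (b := Real.pi)
    (fun θ _ => hd θ) ?_
  · rw [intervalIntegral.integral_of_le (by linarith [Real.pi_pos]),
      integral_Ioc_eq_integral_Ioo] at hftc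
    simp only [hn]
    rw [integral_const_mul, integral_div, hftc]
    have : circleMap 0 r (-Real.pi) = circleMap 0 r Real.pi := by
      have := periodic_circleMap 0 r (-Real.pi)
      rw [← this]; congr 1; ring
    simp [this]
  · rw [intervalIntegrable_iff_integrableOn_Ioo_of_le (by linarith [Real.pi_pos])]
    have h2 : Integrable (fun θ => r * ((fderiv ℝ b (circleMap 0 r θ) (Complex.I * circleMap 0 r θ)) * (r⁻¹ * r⁻¹)))
      (volume.restrict (Ioo (-Real.pi) Real.pi)) := by
      refine hr.congr (ae_of_all _ fun θ => ?_)
      simp only [hn]; field_simp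
    refine (h2.const_mul r).congr (ae_of_all _ fun θ => ?_)
    simp only
    have := hr01.1.ne'
    field_simp

lemma integrableOn_norm_rpow_ball {κ : ℝ} (hκ : κ < 2) {r : ℝ} :
    IntegrableOn (fun y : ℂ => ‖y‖ ^ (-κ)) (Metric.ball 0 r) := by
  rw [integrableOn_fun_norm_addHaar volume (f := fun t : ℝ => t ^ (-κ))]
  rw [Complex.finrank_real_complex]
  rcases le_or_gt r 0 with hr | hr
  · simp [Ioo_eq_empty (not_lt.2 hr)]
  have h := (intervalIntegral.intervalIntegrable_rpow' (a := 0) (b := r) (r := 1 - κ) (by linarith))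
  rw [intervalIntegrable_iff_integrableOn_Ioo_of_le hr.le] at h
  refine h.congr_fun (fun t ht => ?_) measurableSet_Ioo
  have ht0 : 0 < t := ht.1
  simp only [smul_eq_mul, Nat.add_one_sub_one, pow_one]
  rw [sub_eq_add_neg, Real.rpow_add ht0, Real.rpow_one]

lemma integrableOn_norm_sub_rpow {κ : ℝ} (hκ : κ < 2) (x : ℂ) :
    IntegrableOn (fun y : ℂ => ‖y - x‖ ^ (-κ)) disc := by
  have h := (integrableOn_norm_rpow_ball hκ (r := 1 + ‖x‖))
  rw [← integrable_indicator_iff Metric.isOpen_ball.measurableSet] at h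
  have h2 := (h.comp_sub_right x).integrableOn (s := disc)
  refine h2.congr_fun (fun y hy => ?_) measurableSet_disc
  rw [mem_disc] at hy
  simp only
  rw [indicator_of_mem]
  simp only [Metric.mem_ball, dist_zero_right]
  linarith [norm_sub_le y x]

lemma integrableOn_inv_norm_sub (x : ℂ) : IntegrableOn (fun y : ℂ => ‖y - x‖⁻¹) disc := by
  simpa [Real.rpow_neg_one] using integrableOn_norm_sub_rpow (κ := 1) (by norm_num) x

/-- Partial fractions and the triangle inequality: a product of two simple poles at distinct points
is no worse than one simple pole, hence integrable in the plane. At a pole the convention 0⁻¹ = 0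
makes the left side zero. -/
lemma inv_mul_inv_norm_le {p q : ℂ} (hpq : p ≠ q) (y : ℂ) :
    ‖y - p‖⁻¹ * ‖y - q‖⁻¹ ≤ ‖p - q‖⁻¹ * (‖y - p‖⁻¹ + ‖y - q‖⁻¹) := by
  have h0 : 0 < ‖p - q‖ := norm_pos_iff.2 (sub_ne_zero.2 hpq)
  by_cases h1 : y = p
  · subst h1; simp; positivity
  by_cases h2 : y = q
  · subst h2; simp; positivity
  have h1' : 0 < ‖y - p‖ := norm_pos_iff.2 (sub_ne_zero.2 h1)
  have h2' : 0 < ‖y - q‖ := norm_pos_iff.2 (sub_ne_zero.2 h2)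
  have h3 : ‖p - q‖ ≤ ‖y - p‖ + ‖y - q‖ := by
    have := norm_sub_le (y - q) (y - p)
    rw [show y - q - (y - p) = p - q by ring] at this; linarith
  rw [inv_add_inv h1'.ne' h2'.ne', ← mul_inv, inv_mul_eq_div, div_div, inv_eq_one_div,
    div_le_div_iff₀ (by positivity) (by positivity)]
  nlinarith [mul_pos h1' h2']

lemma integrableOn_inv_mul_inv {p q : ℂ} (hpq : p ≠ q) :
    IntegrableOn (fun y : ℂ => ‖y - p‖⁻¹ * ‖y - q‖⁻¹) disc := by
  refine Integrable.mono' (((integrableOn_inv_norm_sub p).add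
    (integrableOn_inv_norm_sub q)).const_mul ‖p - q‖⁻¹) ?_ (ae_of_all _ fun y => ?_)
  · exact (Measurable.mul (by fun_prop) (by fun_prop)).aestronglyMeasurable
  · rw [Real.norm_of_nonneg (by positivity)]
    exact inv_mul_inv_norm_le hpq y

lemma measurable_fderiv_apply (f : ℂ → ℝ) {w : ℂ → ℂ} (hw : Measurable w) :
    Measurable fun y => fderiv ℝ f y (w y) :=
  (isBoundedBilinearMap_apply (𝕜 := ℝ) (E := ℂ) (F := ℝ)).continuous.measurable.comp
    ((measurable_fderiv ℝ f).prodMk hw)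

/-- Integration by parts on the disc against the conjugate of a holomorphic function with a simple
pole. -/
theorem integral_fderiv_conj {g : ℂ → ℂ} {u : ℂ → ℝ} {x x' : ℂ} (hx : ‖x‖ < 1) (hx0 : x ≠ 0)
    (hx' : ‖x'‖ < 1) (hx'0 : x' ≠ 0) (hne : x ≠ x') {C K : ℝ} (hK : 0 ≤ K)
    (hg : ∀ y, ‖y‖ ≤ 1 → y ≠ x → DifferentiableAt ℂ g y)
    (hgb : ∀ y, ‖y‖ ≤ 1 → y ≠ x → ‖g y‖ ≤ C * ‖y - x‖⁻¹)
    (hgb' : ∀ y, ‖y‖ ≤ 1 → y ≠ x → ‖deriv g y‖ ≤ C * (‖y - x‖⁻¹ * ‖y - x‖⁻¹))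
    (hu : ∀ y, ‖y‖ ≤ 1 → y ≠ x' → DifferentiableAt ℝ u y)
    (hub : ∀ y, ‖y‖ ≤ 1 → y ≠ x' → ‖fderiv ℝ u y‖ ≤ K * ‖y - x'‖⁻¹)
    (hul : ∀ y, ‖y‖ ≤ 1 → y ≠ x' → |u y - u x| ≤ K * ‖y - x‖ * ‖y - x'‖⁻¹) :
    IntegrableOn (fun y => fderiv ℝ u y ((starRingEnd ℂ) (g y))) disc ∧
    ∫ y in disc, fderiv ℝ u y ((starRingEnd ℂ) (g y)) =
      ∫ y, (u y - u x) * (y * g y).re ∂arcLength := by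
  -- The vector conj(g) has radial component Re(y g) and angular component -Im(y g), both divided by
  -- ‖y‖². Weighting these by u - u x cancels the pole of g at x. The derivatives falling on g
  -- cancel between a and b by the Cauchy-Riemann equations, so the radial derivative of a minus the
  -- angular derivative of b is exactly the wanted integrand.
  set a : ℂ → ℝ := fun y => (u y - u x) * (y * g y).re with ha
  set b : ℂ → ℝ := fun y => (u y - u x) * (y * g y).im with hb
  set S : Set ℂ := {x, x'} with hS
  have hSf : S.Finite := by simp [hS]
  have hG : ∀ y, ‖y‖ ≤ 1 → y ∉ S →
      HasFDerivAt (fun y => y * g y)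
        ((ContinuousLinearMap.toSpanSingleton ℂ (g y + y * deriv g y)).restrictScalars ℝ) y := by
    intro y hy hyS
    have hyx : y ≠ x := fun h => hyS (by simp [hS, h])
    have h1 := (hasDerivAt_id y).mul (hg y hy hyx).hasDerivAt
    have h2 : HasDerivAt (fun y => y * g y) (g y + y * deriv g y) y := by
      exact h1.congr_deriv (by simp)
    exact h2.hasFDerivAt.restrictScalars ℝ
  have hua : ∀ y, ‖y‖ ≤ 1 → y ∉ S → HasFDerivAt a
      ((u y - u x) • (Complex.reCLM.comp
        ((ContinuousLinearMap.toSpanSingleton ℂ (g y + y * deriv g y)).restrictScalars ℝ))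
        + (y * g y).re • fderiv ℝ u y) y := by
    intro y hy hyS
    have hyx' : y ≠ x' := fun h => hyS (by simp [hS, h])
    exact ((hu y hy hyx').hasFDerivAt.sub_const (u x)).mul
      (Complex.reCLM.hasFDerivAt.comp y (hG y hy hyS))
  have hub2 : ∀ y, ‖y‖ ≤ 1 → y ∉ S → HasFDerivAt b
      ((u y - u x) • (Complex.imCLM.comp
        ((ContinuousLinearMap.toSpanSingleton ℂ (g y + y * deriv g y)).restrictScalars ℝ))
        + (y * g y).im • fderiv ℝ u y) y := by
    intro y hy hyS
    have hyx' : y ≠ x' := fun h => hyS (by simp [hS, h])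
    exact ((hu y hy hyx').hasFDerivAt.sub_const (u x)).mul
      (Complex.imCLM.hasFDerivAt.comp y (hG y hy hyS))
  have hfa : ∀ y, ‖y‖ ≤ 1 → y ∉ S → ∀ w, fderiv ℝ a y w =
      (u y - u x) * (w * (g y + y * deriv g y)).re + (y * g y).re * fderiv ℝ u y w := by
    intro y hy hyS w
    rw [(hua y hy hyS).fderiv]; simp
  have hfb : ∀ y, ‖y‖ ≤ 1 → y ∉ S → ∀ w, fderiv ℝ b y w =
      (u y - u x) * (w * (g y + y * deriv g y)).im + (y * g y).im * fderiv ℝ u y w := by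
    intro y hy hyS w
    rw [(hub2 y hy hyS).fderiv]; simp
  -- One estimate serves a with w = y and b with w = I y: what remains is a product of simple poles
  -- at two distinct points among x, x' and 0.
  have hC : ∀ y, ‖y‖ ≤ 1 → y ∉ S → y ≠ 0 → ∀ c : ℝ, ∀ w : ℂ, ‖w‖ = ‖y‖ → ∀ d : ℝ,
      |c| ≤ ‖w * (g y + y * deriv g y)‖ → |d| ≤ ‖y * g y‖ →
      ‖((u y - u x) * c + d * fderiv ℝ u y w) / ‖y‖ ^ 2‖ ≤
       K * C * (2 * (‖y - x'‖⁻¹ * ‖y - x‖⁻¹) + ‖y - x'‖⁻¹ * ‖y - 0‖⁻¹) := by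
    intro y hy hyS hy0 c w hw d hc hd
    have hyx : y ≠ x := fun h => hyS (by simp [hS, h])
    have hyx' : y ≠ x' := fun h => hyS (by simp [hS, h])
    have h1 := hgb y hy hyx
    have h2 := hgb' y hy hyx
    have h3 := hub y hy hyx'
    have h4 := hul y hy hyx'
    have p1 : 0 < ‖y - x‖ := norm_pos_iff.2 (sub_ne_zero.2 hyx)
    have p2 : 0 < ‖y - x'‖ := norm_pos_iff.2 (sub_ne_zero.2 hyx')
    have p3 : 0 < ‖y‖ := norm_pos_iff.2 hy0
    have hCn : 0 ≤ C := by
      have := (norm_nonneg _).trans h1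
      by_contra hcon
      have : C * ‖y - x‖⁻¹ < 0 := mul_neg_of_neg_of_pos (by linarith) (by positivity)
      linarith
    have e1 : |c| ≤ ‖y‖ * (C * ‖y - x‖⁻¹ + ‖y‖ * (C * (‖y - x‖⁻¹ * ‖y - x‖⁻¹))) := by
      refine hc.trans ?_
      rw [norm_mul, hw]
      refine mul_le_mul_of_nonneg_left ((norm_add_le _ _).trans ?_) p3.le
      rw [norm_mul]
      gcongr
    have e2 : |d| ≤ ‖y‖ * (C * ‖y - x‖⁻¹) := by
      refine hd.trans ?_
      rw [norm_mul]; gcongr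
    have e3 : |fderiv ℝ u y w| ≤ K * ‖y - x'‖⁻¹ * ‖y‖ := by
      refine ((fderiv ℝ u y).le_opNorm w).trans ?_
      rw [hw]; gcongr
    rw [norm_div, norm_pow, norm_norm, div_le_iff₀ (by positivity), Real.norm_eq_abs]
    calc |(u y - u x) * c + d * fderiv ℝ u y w|
        ≤ |u y - u x| * |c| + |d| * |fderiv ℝ u y w| := by
          rw [← abs_mul, ← abs_mul]; exact abs_add_le _ _
      _ ≤ (K * ‖y - x‖ * ‖y - x'‖⁻¹) * (‖y‖ * (C * ‖y - x‖⁻¹ + ‖y‖ * (C * (‖y - x‖⁻¹ * ‖y - x‖⁻¹))))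
          + (‖y‖ * (C * ‖y - x‖⁻¹)) * (K * ‖y - x'‖⁻¹ * ‖y‖) := by
          gcongr
      _ = K * C * (2 * (‖y - x'‖⁻¹ * ‖y - x‖⁻¹) + ‖y - x'‖⁻¹ * ‖y - 0‖⁻¹) * ‖y‖ ^ 2 := by
          rw [sub_zero]
          field_simp
          ring
  have hbound : IntegrableOn (fun y => K * C * (2 * (‖y - x'‖⁻¹ * ‖y - x‖⁻¹) +
      ‖y - x'‖⁻¹ * ‖y - 0‖⁻¹)) disc :=
    (((integrableOn_inv_mul_inv hne.symm).const_mul 2).add (integrableOn_inv_mul_inv hx'0)).const_mul _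
  have hae : ∀ᵐ y ∂(volume.restrict disc), ‖y‖ ≤ 1 ∧ y ∉ S ∧ y ≠ 0 := by
    have h1 : ∀ᵐ y ∂(volume.restrict disc), y ∉ S := ae_restrict_of_ae (hSf.countable.ae_notMem _)
    have h2 : ∀ᵐ y ∂(volume.restrict disc), y ∉ ({0} : Set ℂ) :=
      ae_restrict_of_ae ((countable_singleton _).ae_notMem _)
    filter_upwards [h1, h2, ae_restrict_mem measurableSet_disc] with y hy1 hy2 hy3
    exact ⟨(mem_disc.1 hy3).le, hy1, by simpa using hy2⟩
  have hia : IntegrableOn (fun y => fderiv ℝ a y y / ‖y‖ ^ 2) disc := by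
    refine Integrable.mono' hbound ?_ ?_
    · have : Measurable (fun y => fderiv ℝ a y y) :=
        measurable_fderiv_apply a measurable_id
      exact (this.div (by fun_prop)).aestronglyMeasurable
    · filter_upwards [hae] with y ⟨hy1, hy2, hy3⟩
      rw [hfa y hy1 hy2]
      exact hC y hy1 hy2 hy3 _ y rfl _ (Complex.abs_re_le_norm _) (Complex.abs_re_le_norm _)
  have hib : IntegrableOn (fun y => fderiv ℝ b y (Complex.I * y) / ‖y‖ ^ 2) disc := by
    refine Integrable.mono' hbound ?_ ?_
    · have : Measurable (fun y => fderiv ℝ b y (Complex.I * y)) :=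
        measurable_fderiv_apply b (by fun_prop)
      exact (this.div (by fun_prop)).aestronglyMeasurable
    · filter_upwards [hae] with y ⟨hy1, hy2, hy3⟩
      rw [hfb y hy1 hy2]
      exact hC y hy1 hy2 hy3 _ _ (by simp) _ (Complex.abs_im_le_norm _) (Complex.abs_im_le_norm _)
  have hsph : ∀ y : ℂ, ‖y‖ = 1 → y ∉ S := by
    intro y hy h
    simp only [hS, mem_insert_iff, mem_singleton_iff] at h
    rcases h with h | h <;> subst h <;> linarith
  have h0S : (0 : ℂ) ∉ S := by simp [hS, hx0.symm, hx'0.symm]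
  have e1 := integral_radial hSf (fun y hy _ hyS => (hua y hy hyS).differentiableAt)
    (hua 0 (by simp) h0S).continuousAt (by simp [ha])
    (fun y hy => (hua y (by simpa using hy.le) (hsph y (by simpa using hy))).continuousAt.continuousWithinAt) hia
  have e2 := integral_angular hSf (fun y hy _ hyS => (hub2 y hy hyS).differentiableAt) hib
  have hcong : (fun y => fderiv ℝ a y y / ‖y‖ ^ 2 - fderiv ℝ b y (Complex.I * y) / ‖y‖ ^ 2)
      =ᵐ[volume.restrict disc] fun y => fderiv ℝ u y ((starRingEnd ℂ) (g y)) := by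
    filter_upwards [hae] with y ⟨hy1, hy2, hy3⟩
    rw [hfa y hy1 hy2, hfb y hy1 hy2, ← sub_div]
    have p3 : 0 < ‖y‖ := norm_pos_iff.2 hy3
    rw [div_eq_iff (by positivity)]
    have k1 : (starRingEnd ℂ) (g y) * ((‖y‖ ^ 2 : ℝ) : ℂ) =
        (y * g y).re • y - (y * g y).im • (Complex.I * y) := by
      rw [← Complex.normSq_eq_norm_sq, Complex.normSq_eq_conj_mul_self]
      rw [Complex.real_smul, Complex.real_smul]
      have : ((y * g y).re : ℂ) * y - ((y * g y).im : ℂ) * (Complex.I * y) =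
        (starRingEnd ℂ) (y * g y) * y := by
        have : (starRingEnd ℂ) (y * g y) = ((y * g y).re : ℂ) - ((y * g y).im : ℂ) * Complex.I := by
          apply Complex.ext <;> simp <;> ring
        rw [this]
        ring
      rw [this, map_mul]; ring
    have k2 : fderiv ℝ u y ((starRingEnd ℂ) (g y)) * ‖y‖ ^ 2 =
        fderiv ℝ u y ((y * g y).re • y - (y * g y).im • (Complex.I * y)) := by
      rw [← k1, mul_comm, mul_comm ((starRingEnd ℂ) (g y)), ← Complex.real_smul, map_smul, smul_eq_mul]
    rw [k2, map_sub, map_smul, map_smul]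
    have k3 : (Complex.I * y * (g y + y * deriv g y)).im = (y * (g y + y * deriv g y)).re := by
      rw [mul_assoc, Complex.I_mul_im]
    rw [k3]; simp only [smul_eq_mul]; ring
  refine ⟨(hia.sub hib).congr hcong, ?_⟩
  rw [← integral_congr_ae hcong, integral_sub hia hib, e1, e2, sub_zero]

/-! ### Poisson kernel, Green function and the two generating fields. -/

/-- The Poisson kernel of the unit disc. -/
def pker (x ζ : ℂ) : ℝ := (1 - ‖x‖ ^ 2) / ‖ζ - x‖ ^ 2

/-- The logarithmic derivative of the Blaschke factor with zero `x`. -/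
def gQ (x y : ℂ) : ℂ := 1 / (y - x) + (starRingEnd ℂ) x / (1 - (starRingEnd ℂ) x * y)

/-- The derivative of `-log (1 - ζ̄ y)` in `y`. -/
def gZ (ζ y : ℂ) : ℂ := (starRingEnd ℂ) ζ / (1 - (starRingEnd ℂ) ζ * y)

/-- Green's function of the disc, up to normalization. -/
def ell (x y : ℂ) : ℝ := Real.log ‖1 - (starRingEnd ℂ) x * y‖ - Real.log ‖y - x‖

/-- This identity gives the sign of the Green function, and later shows that a large ratio of the
two distances forces y to be away from the circle on the scale of ‖1 - conj(x) y‖. -/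
lemma norm_one_sub_sq (x y : ℂ) : ‖1 - (starRingEnd ℂ) x * y‖ ^ 2 =
    ‖y - x‖ ^ 2 + (1 - ‖x‖ ^ 2) * (1 - ‖y‖ ^ 2) := by
  simp only [← Complex.normSq_eq_norm_sq, Complex.normSq_apply]
  simp
  ring

lemma norm_sub_le_norm_one_sub {x y : ℂ} (hx : ‖x‖ ≤ 1) (hy : ‖y‖ ≤ 1) :
    ‖y - x‖ ≤ ‖1 - (starRingEnd ℂ) x * y‖ := by
  refine (pow_le_pow_iff_left₀ (norm_nonneg _) (norm_nonneg _) two_ne_zero).1 ?_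
  rw [norm_one_sub_sq]
  have : 0 ≤ (1 - ‖x‖ ^ 2) * (1 - ‖y‖ ^ 2) := by
    apply mul_nonneg <;> nlinarith [norm_nonneg x, norm_nonneg y]
  linarith

lemma one_sub_norm_le {x y : ℂ} (hy : ‖y‖ ≤ 1) :
    1 - ‖x‖ ≤ ‖1 - (starRingEnd ℂ) x * y‖ := by
  have h := norm_sub_norm_le (1 : ℂ) ((starRingEnd ℂ) x * y)
  rw [norm_one, norm_mul, RCLike.norm_conj] at h
  nlinarith [norm_nonneg x, norm_nonneg y]

lemma one_sub_conj_mul_ne {x y : ℂ} (hx : ‖x‖ < 1) (hy : ‖y‖ ≤ 1) :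
    1 - (starRingEnd ℂ) x * y ≠ 0 := by
  rw [← norm_pos_iff]
  linarith [one_sub_norm_le (x := x) hy]

lemma one_sub_conj_mul_re_pos {x y : ℂ} (hx : ‖x‖ < 1) (hy : ‖y‖ ≤ 1) :
    0 < (1 - (starRingEnd ℂ) x * y).re := by
  have h := Complex.re_le_norm ((starRingEnd ℂ) x * y)
  rw [norm_mul, RCLike.norm_conj] at h
  rw [Complex.sub_re, Complex.one_re]
  nlinarith [norm_nonneg x, norm_nonneg y]

lemma norm_gQ_le {x y : ℂ} (hx : ‖x‖ ≤ 1) (hy : ‖y‖ ≤ 1) (hxy : y ≠ x) :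
    ‖gQ x y‖ ≤ 2 * ‖y - x‖⁻¹ := by
  have h1 := norm_sub_le_norm_one_sub hx hy
  have h0 : 0 < ‖y - x‖ := norm_pos_iff.2 (sub_ne_zero.2 hxy)
  unfold gQ
  refine (norm_add_le _ _).trans ?_
  rw [norm_div, norm_div, norm_one, RCLike.norm_conj, one_div]
  have h2 : ‖x‖ / ‖1 - (starRingEnd ℂ) x * y‖ ≤ ‖y - x‖⁻¹ := by
    rw [← one_div]; gcongr
  linarith

lemma hasDerivAt_gZ {ζ y : ℂ} (hζ : ‖ζ‖ < 1) (hy : ‖y‖ ≤ 1) :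
    HasDerivAt (gZ ζ) (((starRingEnd ℂ) ζ) ^ 2 / (1 - (starRingEnd ℂ) ζ * y) ^ 2) y := by
  have hne := one_sub_conj_mul_ne hζ hy
  have h1 : HasDerivAt (fun y => 1 - (starRingEnd ℂ) ζ * y) (-(starRingEnd ℂ) ζ) y := by
    simpa using ((hasDerivAt_id y).const_mul ((starRingEnd ℂ) ζ)).const_sub 1
  have h2 := (hasDerivAt_const y ((starRingEnd ℂ) ζ)).div h1 hne
  refine h2.congr_deriv ?_
  ring

lemma hasDerivAt_gQ {x y : ℂ} (hx : ‖x‖ < 1) (hy : ‖y‖ ≤ 1) (hxy : y ≠ x) :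
    HasDerivAt (gQ x) (-1 / (y - x) ^ 2 +
      ((starRingEnd ℂ) x) ^ 2 / (1 - (starRingEnd ℂ) x * y) ^ 2) y := by
  have h1 : HasDerivAt (fun y => y - x) 1 y := (hasDerivAt_id y).sub_const x
  have h2 := (hasDerivAt_const y (1 : ℂ)).div h1 (sub_ne_zero.2 hxy)
  refine (h2.add (hasDerivAt_gZ hx hy)).congr_deriv ?_
  simp

lemma sphere_aux {x y : ℂ} (hy : ‖y‖ = 1) :
    1 - (starRingEnd ℂ) x * y = y * (starRingEnd ℂ) (y - x) := by
  have : y * (starRingEnd ℂ) y = 1 := by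
    rw [Complex.mul_conj, Complex.normSq_eq_norm_sq, hy]; simp
  rw [map_sub, mul_sub, this]; ring

/-- The boundary flux of the Green function is the Poisson kernel; on the circle y * gQ x y is
already real. -/
lemma re_mul_gQ {x y : ℂ} (hx : ‖x‖ < 1) (hy : ‖y‖ = 1) : (y * gQ x y).re = pker x y := by
  have hne : y - x ≠ 0 := by
    intro h
    rw [sub_eq_zero] at h; subst h; linarith
  have hy0 : y ≠ 0 := by rintro rfl; simp at hy
  have hc : (starRingEnd ℂ) (y - x) ≠ 0 := (map_ne_zero _).2 hne
  have : y * gQ x y = ((pker x y : ℝ) : ℂ) := by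
    unfold gQ pker
    rw [sphere_aux hy]
    push_cast
    rw [← Complex.mul_conj', ← Complex.mul_conj']
    have h1 : y * (starRingEnd ℂ) y = 1 := by
      rw [Complex.mul_conj, Complex.normSq_eq_norm_sq, hy]; simp
    field_simp
    rw [map_sub]
    linear_combination h1
  rw [this, Complex.ofReal_re]

lemma re_mul_gZ {ζ y : ℂ} (hζ : ‖ζ‖ < 1) (hy : ‖y‖ = 1) :
    (y * gZ ζ y).re = (pker ζ y - 1) / 2 := by
  have hne : y - ζ ≠ 0 := by
    intro h
    rw [sub_eq_zero] at h; subst h; linarith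
  have hy0 : y ≠ 0 := by rintro rfl; simp at hy
  have h2 : (y * gZ ζ y) = ((starRingEnd ℂ) ζ * (y - ζ)) / ((‖y - ζ‖ ^ 2 : ℝ) : ℂ) := by
    have hc : (starRingEnd ℂ) (y - ζ) ≠ 0 := (map_ne_zero _).2 hne
    unfold gZ
    rw [sphere_aux hy]
    push_cast
    rw [← Complex.mul_conj']
    field_simp
  rw [h2, Complex.div_ofReal_re, pker]
  have h3 : 0 < ‖y - ζ‖ ^ 2 := by positivity
  rw [div_sub_one h3.ne', div_div, div_eq_div_iff h3.ne' (by positivity)]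
  have h4 : ‖y‖ ^ 2 = 1 := by rw [hy]; norm_num
  simp only [← Complex.normSq_eq_norm_sq, Complex.normSq_apply] at *
  simp at *
  linear_combination (((y.re - ζ.re) * (y.re - ζ.re) + (y.im - ζ.im) * (y.im - ζ.im))) * h4

/-- `u` is differentiable on the closed unit disc with gradient bounded by `L`. -/
def LipDisc (u : ℂ → ℝ) (L : ℝ) : Prop :=
  ∀ y, ‖y‖ ≤ 1 → DifferentiableAt ℝ u y ∧ ‖fderiv ℝ u y‖ ≤ L

lemma LipDisc.nonneg {u : ℂ → ℝ} {L : ℝ} (h : LipDisc u L) : 0 ≤ L :=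
  (norm_nonneg _).trans (h 0 (by simp)).2

lemma LipDisc.abs_sub_le {u : ℂ → ℝ} {L : ℝ} (h : LipDisc u L) {x y : ℂ} (hx : ‖x‖ ≤ 1)
    (hy : ‖y‖ ≤ 1) : |u y - u x| ≤ L * ‖y - x‖ :=
  Convex.norm_image_sub_le_of_norm_fderiv_le (s := Metric.closedBall 0 1) (𝕜 := ℝ)
    (fun z hz => (h z (by simpa using hz)).1) (fun z hz => (h z (by simpa using hz)).2)
    (convex_closedBall 0 1) (by simpa using hx) (by simpa using hy)

lemma LipDisc.continuousOn {u : ℂ → ℝ} {L : ℝ} (h : LipDisc u L) :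
    ContinuousOn u (Metric.closedBall 0 1) :=
  fun z hz => (h z (by simpa using hz)).1.continuousAt.continuousWithinAt

lemma LipDisc.continuousOn_sphere {u : ℂ → ℝ} {L : ℝ} (h : LipDisc u L) :
    ContinuousOn u (Metric.sphere 0 1) := h.continuousOn.mono Metric.sphere_subset_closedBall

lemma _root_.ContDiff.exists_lipDisc {u : ℂ → ℝ} (hu : ContDiff ℝ ∞ u) : ∃ L, LipDisc u L := by
  have hc : ContinuousOn (fderiv ℝ u) (Metric.closedBall 0 1) :=
    (hu.continuous_fderiv (by simp)).continuousOn
  obtain ⟨L, hL⟩ := (isCompact_closedBall (0 : ℂ) 1).exists_bound_of_continuousOn hc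
  exact ⟨L, fun y hy => ⟨hu.differentiable (by simp) y, hL y (by simpa using hy)⟩⟩

/-- The disc has diameter 2. This converts plain bounds into the singular form required by
`integral_fderiv_conj`. -/
lemma inv_norm_sub_ge {x y : ℂ} (hx : ‖x‖ < 1) (hy : ‖y‖ ≤ 1) (hxy : y ≠ x) :
    1 ≤ 2 * ‖y - x‖⁻¹ := by
  have h0 : 0 < ‖y - x‖ := norm_pos_iff.2 (sub_ne_zero.2 hxy)
  rw [← div_eq_mul_inv, le_div_iff₀ h0]
  linarith [norm_sub_le y x]

lemma integral_fderiv_gQ {u : ℂ → ℝ} {x x' : ℂ} (hx : ‖x‖ < 1) (hx0 : x ≠ 0)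
    (hx' : ‖x'‖ < 1) (hx'0 : x' ≠ 0) (hne : x ≠ x') {K : ℝ} (hK : 0 ≤ K)
    (hu : ∀ y, ‖y‖ ≤ 1 → y ≠ x' → DifferentiableAt ℝ u y)
    (hub : ∀ y, ‖y‖ ≤ 1 → y ≠ x' → ‖fderiv ℝ u y‖ ≤ K * ‖y - x'‖⁻¹)
    (hul : ∀ y, ‖y‖ ≤ 1 → y ≠ x' → |u y - u x| ≤ K * ‖y - x‖ * ‖y - x'‖⁻¹) :
    IntegrableOn (fun y => fderiv ℝ u y ((starRingEnd ℂ) (gQ x y))) disc ∧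
    ∫ y in disc, fderiv ℝ u y ((starRingEnd ℂ) (gQ x y)) =
      ∫ y, (u y - u x) * pker x y ∂arcLength := by
  have h := integral_fderiv_conj (g := gQ x) hx hx0 hx' hx'0 hne (C := 2) hK
    (fun y hy hxy => (hasDerivAt_gQ hx hy hxy).differentiableAt)
    (fun y hy hxy => norm_gQ_le hx.le hy hxy) ?_ hu hub hul
  · refine ⟨h.1, h.2.trans (integral_congr_ae ?_)⟩
    filter_upwards [ae_arcLength_norm] with y hy
    rw [re_mul_gQ hx hy]
  · intro y hy hxy
    rw [(hasDerivAt_gQ hx hy hxy).deriv]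
    have h1 := norm_sub_le_norm_one_sub hx.le hy
    have h0 : 0 < ‖y - x‖ := norm_pos_iff.2 (sub_ne_zero.2 hxy)
    refine (norm_add_le _ _).trans ?_
    rw [norm_div, norm_div, norm_neg, norm_one, norm_pow, norm_pow, norm_pow, RCLike.norm_conj,
      ← mul_inv, ← sq]
    have h2 : ‖x‖ ^ 2 / ‖1 - (starRingEnd ℂ) x * y‖ ^ 2 ≤ (‖y - x‖ ^ 2)⁻¹ := by
      rw [← one_div]
      have : ‖x‖ ^ 2 ≤ 1 := by nlinarith [norm_nonneg x]
      gcongr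
    rw [one_div]
    linarith

/-- There is no second singularity here; the point -x is a dummy, distinct from x because x ≠ 0. -/
lemma LipDisc.integral_gQ {u : ℂ → ℝ} {L : ℝ} (h : LipDisc u L) {x : ℂ} (hx : ‖x‖ < 1)
    (hx0 : x ≠ 0) :
    IntegrableOn (fun y => fderiv ℝ u y ((starRingEnd ℂ) (gQ x y))) disc ∧
    ∫ y in disc, fderiv ℝ u y ((starRingEnd ℂ) (gQ x y)) =
      ∫ y, (u y - u x) * pker x y ∂arcLength := by
  have hx' : ‖-x‖ < 1 := by simpa using hx
  refine integral_fderiv_gQ (x' := -x) (K := L * 2) hx hx0 hx' (by simpa using hx0)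
    ?_ (by have := h.nonneg; positivity) (fun y hy _ => (h y hy).1) (fun y hy hxy => ?_)
    (fun y hy hxy => ?_)
  · intro h'
    rw [self_eq_neg] at h'; exact hx0 h'
  · have := inv_norm_sub_ge hx' hy hxy
    refine (h y hy).2.trans ?_
    nlinarith [h.nonneg]
  · have h1 := inv_norm_sub_ge hx' hy hxy
    refine (h.abs_sub_le hx.le hy).trans ?_
    have h2 : 0 ≤ L * ‖y - x‖ := mul_nonneg h.nonneg (norm_nonneg _)
    nlinarith

lemma integral_arcLength_eq_circleAverage {f : ℂ → ℝ}
    (hf : ContinuousOn f (Metric.sphere (0 : ℂ) 1)) :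
    ∫ z, f z ∂arcLength = 2 * Real.pi * Real.circleAverage f 0 1 := by
  rw [arcLength, integral_map (continuous_circleMap 0 1).aemeasurable
    (aestronglyMeasurable_arcLength hf), ← intervalIntegral.integral_of_le (by positivity),
    Real.circleAverage_def, smul_eq_mul, ← mul_assoc, mul_inv_cancel₀ (by positivity), one_mul]

lemma continuousOn_pker {x : ℂ} (hx : ‖x‖ < 1) :
    ContinuousOn (pker x) (Metric.sphere (0 : ℂ) 1) := by
  unfold pker
  refine ContinuousOn.div (by fun_prop) (by fun_prop) fun y hy => ?_
  have : y - x ≠ 0 := by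
    intro h
    rw [sub_eq_zero] at h; subst h; simp at hy; linarith
  positivity

/-- Poisson's formula for real parts of holomorphic functions. -/
lemma integral_pker_mul_re {f : ℂ → ℂ} (hf : DiffContOnCl ℂ f disc) {x : ℂ} (hx : ‖x‖ < 1) :
    ∫ y, (f y).re * pker x y ∂arcLength = 2 * Real.pi * (f x).re := by
  have h := hf.circleAverage_poissonKernel_smul' (w := x) (by simpa using hx)
  have hcl : ContinuousOn f (Metric.sphere 0 1) := by
    refine hf.continuousOn.mono ?_
    rw [disc, closure_ball _ one_ne_zero]
    exact Metric.sphere_subset_closedBall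
  have hcont : ContinuousOn (fun y => pker x y • f y) (Metric.sphere 0 1) :=
    (continuousOn_pker hx).smul hcl
  have h2 := Complex.reCLM.circleAverage_comp_comm (c := 0) (R := 1) (f := fun y => pker x y • f y)
    (hcont.circleIntegrable (by norm_num))
  have h3 : Real.circleAverage (fun y => pker x y • f y) 0 1 = f x := by
    rw [← h]
    refine Real.circleAverage_congr_sphere fun y hy => ?_
    have hy1 : ‖y‖ = 1 := by simpa using hy
    simp only [pker, sub_zero, hy1, one_pow]
  rw [h3] at h2
  rw [integral_arcLength_eq_circleAverage]
  · congr 1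
    rw [← Complex.reCLM_apply, ← h2]
    congr 1
    ext y; simp [mul_comm]
  · exact (Complex.continuous_re.comp_continuousOn hcl).mul (continuousOn_pker hx)

lemma integral_pker {x : ℂ} (hx : ‖x‖ < 1) : ∫ y, pker x y ∂arcLength = 2 * Real.pi := by
  simpa using integral_pker_mul_re (f := fun _ => 1) diffContOnCl_const hx

lemma integral_one_arcLength : arcLength.real univ = 2 * Real.pi := by
  rw [Measure.real, arcLength, Measure.map_apply (continuous_circleMap 0 1).measurable
    MeasurableSet.univ]
  simp [Real.pi_pos.le]

lemma LipDisc.integral_gZ {u : ℂ → ℝ} {L : ℝ} (h : LipDisc u L) {ζ : ℂ} (hζ : ‖ζ‖ < 1) :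
    IntegrableOn (fun y => fderiv ℝ u y ((starRingEnd ℂ) (gZ ζ y))) disc ∧
    ∫ y in disc, fderiv ℝ u y ((starRingEnd ℂ) (gZ ζ y)) =
      (∫ y, u y * pker ζ y ∂arcLength - ∫ y, u y ∂arcLength) / 2 := by
  -- The field `gZ` has no pole in the closed disc, so x = 1/2 and -x are dummy points. The constant
  -- u x drops out because the flux (pker ζ y - 1)/2 has integral zero.
  set x : ℂ := 1 / 2
  have hx : ‖x‖ < 1 := by simp [x]; norm_num
  have hx0 : x ≠ 0 := by simp [x]
  have hx' : ‖-x‖ < 1 := by simpa using hx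
  have hζ1 : 0 < 1 - ‖ζ‖ := by linarith
  have hb : ∀ y : ℂ, ‖y‖ ≤ 1 → ‖gZ ζ y‖ ≤ (1 - ‖ζ‖)⁻¹ := fun y hy => by
    rw [gZ, norm_div, RCLike.norm_conj, ← one_div]
    have := one_sub_norm_le (x := ζ) hy
    gcongr
  have hb' : ∀ y : ℂ, ‖y‖ ≤ 1 → ‖deriv (gZ ζ) y‖ ≤ (1 - ‖ζ‖)⁻¹ ^ 2 := fun y hy => by
    rw [(hasDerivAt_gZ hζ hy).deriv, ← div_pow, norm_pow]
    exact pow_le_pow_left₀ (norm_nonneg _) (hb y hy) 2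
  have hi : 1 ≤ (1 - ‖ζ‖)⁻¹ := by
    rw [one_le_inv₀ hζ1]; linarith [norm_nonneg ζ]
  set D := (1 - ‖ζ‖)⁻¹
  have hc := integral_fderiv_conj (u := u) (g := gZ ζ) (x := x) (x' := -x) hx hx0 hx'
    (by simpa using hx0) (C := D ^ 2 * 4) (K := L * 2)
    ?_ (by have := h.nonneg; positivity)
    (fun y hy _ => (hasDerivAt_gZ hζ hy).differentiableAt) (fun y hy hxy => ?_)
    (fun y hy hxy => ?_)
    (fun y hy _ => (h y hy).1) (fun y hy hxy => ?_)
    (fun y hy hxy => ?_)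
  · refine ⟨hc.1, hc.2.trans ?_⟩
    have hcp := continuousOn_pker hζ
    have i1 : Integrable (fun y => u y * pker ζ y) arcLength := integrable_arcLength (h.continuousOn_sphere.mul hcp)
    have i2 := integrable_arcLength h.continuousOn_sphere
    have i3 := integrable_arcLength hcp
    have : ∫ y, (u y - u x) * (y * gZ ζ y).re ∂arcLength =
      ∫ y, ((u y * pker ζ y - u y) - (u x * pker ζ y - u x)) / 2 ∂arcLength := by
      refine integral_congr_ae ?_
      filter_upwards [ae_arcLength_norm] with y hy
      rw [re_mul_gZ hζ hy]; ring
    have i4 : Integrable (fun y => u y * pker ζ y - u y) arcLength := i1.sub i2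
    have i5 : Integrable (fun y => u x * pker ζ y - u x) arcLength :=
      (i3.const_mul _).sub (integrable_const _)
    rw [this, integral_div, integral_sub i4 i5, integral_sub i1 i2, integral_sub (i3.const_mul _) (integrable_const _),
      integral_const_mul, integral_pker hζ, integral_const, integral_one_arcLength, smul_eq_mul]
    ring
  · intro h'
    rw [self_eq_neg] at h'; exact hx0 h'
  · have := inv_norm_sub_ge hx hy hxy
    refine (hb y hy).trans ?_
    nlinarith
  · have := inv_norm_sub_ge hx hy hxy
    refine (hb' y hy).trans ?_
    have h3 : 1 ≤ 4 * (‖y - x‖⁻¹ * ‖y - x‖⁻¹) := by nlinarith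
    nlinarith [sq_nonneg D]
  · have := inv_norm_sub_ge hx' hy hxy
    refine (h y hy).2.trans ?_
    nlinarith [h.nonneg]
  · have h1 := inv_norm_sub_ge hx' hy hxy
    refine (h.abs_sub_le hx.le hy).trans ?_
    have h2 : 0 ≤ L * ‖y - x‖ := mul_nonneg h.nonneg (norm_nonneg _)
    nlinarith

/-! ### Logarithmic potentials and inner products of their gradients. -/

/-- Multiplying f by the constant conj(f y) moves its value at y to the positive axis, where the
principal branch of the logarithm is differentiable; the modulus changes only by a constant factor.
-/
lemma hasFDerivAt_log_norm {f : ℂ → ℂ} {f' y : ℂ} (hf : HasDerivAt f f' y) (h0 : f y ≠ 0) :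
    HasFDerivAt (fun y => Real.log ‖f y‖) (Complex.reCLM.comp
      ((ContinuousLinearMap.toSpanSingleton ℂ (f' / f y)).restrictScalars ℝ)) y := by
  set c := (starRingEnd ℂ) (f y)
  have hc : c ≠ 0 := (map_ne_zero _).2 h0
  have h1 : HasDerivAt (fun y => c * f y) (c * f') y := hf.const_mul c
  have hsl : c * f y ∈ Complex.slitPlane := by
    left
    rw [← Complex.normSq_eq_conj_mul_self, Complex.ofReal_re]
    exact Complex.normSq_pos.2 h0
  have h2 := h1.clog hsl
  have h3 := (Complex.reCLM.hasFDerivAt.comp y (h2.hasFDerivAt.restrictScalars ℝ)).sub_const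
    (Real.log ‖c‖)
  rw [mul_div_mul_left _ _ hc] at h3
  refine h3.congr_of_eventuallyEq ?_
  filter_upwards [hf.continuousAt.eventually_ne h0] with z hz
  simp only [Function.comp, Complex.reCLM_apply, Complex.log_re, norm_mul]
  rw [Real.log_mul (norm_ne_zero_iff.2 hc) (norm_ne_zero_iff.2 hz)]
  ring

lemma hasFDerivAt_log_norm_one_sub {ζ y : ℂ} (hζ : ‖ζ‖ < 1) (hy : ‖y‖ ≤ 1) :
    HasFDerivAt (fun y => -Real.log ‖1 - (starRingEnd ℂ) ζ * y‖) (Complex.reCLM.comp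
      ((ContinuousLinearMap.toSpanSingleton ℂ (gZ ζ y)).restrictScalars ℝ)) y := by
  have h1 : HasDerivAt (fun y => 1 - (starRingEnd ℂ) ζ * y) (-(starRingEnd ℂ) ζ) y := by
    simpa using ((hasDerivAt_id y).const_mul ((starRingEnd ℂ) ζ)).const_sub 1
  refine (hasFDerivAt_log_norm h1 (one_sub_conj_mul_ne hζ hy)).neg.congr_fderiv ?_
  ext
  simp [gZ, neg_div]

lemma hasFDerivAt_ell {x y : ℂ} (hx : ‖x‖ < 1) (hy : ‖y‖ ≤ 1) (hxy : y ≠ x) :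
    HasFDerivAt (ell x) (-(Complex.reCLM.comp
      ((ContinuousLinearMap.toSpanSingleton ℂ (gQ x y)).restrictScalars ℝ))) y := by
  have h1 : HasDerivAt (fun y => y - x) 1 y := (hasDerivAt_id y).sub_const x
  have h2 := (hasFDerivAt_log_norm_one_sub hx hy).neg.sub
    (hasFDerivAt_log_norm h1 (sub_ne_zero.2 hxy))
  have h3 : (-(fun y => -Real.log ‖1 - (starRingEnd ℂ) x * y‖) - fun y => Real.log ‖y - x‖) =
    ell x := by
    ext y; simp [ell]
  rw [h3] at h2
  refine h2.congr_fderiv ?_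
  ext
  simp [gZ, gQ]; ring

lemma ell_eq_zero_of_norm_eq_one {x y : ℂ} (hy : ‖y‖ = 1) : ell x y = 0 := by
  rw [ell, sphere_aux hy, norm_mul, hy, one_mul, RCLike.norm_conj, sub_self]

lemma ell_nonneg {x y : ℂ} (hx : ‖x‖ ≤ 1) (hy : ‖y‖ ≤ 1) (hxy : y ≠ x) : 0 ≤ ell x y := by
  unfold ell
  have := Real.log_le_log (norm_pos_iff.2 (sub_ne_zero.2 hxy)) (norm_sub_le_norm_one_sub hx hy)
  linarith

lemma abs_log_sub_log_le {s t : ℝ} (hs : 0 < s) (ht : 0 < t) :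
    |Real.log s - Real.log t| ≤ |s - t| * (s⁻¹ + t⁻¹) := by
  have key : ∀ {a b : ℝ}, 0 < a → 0 < b → Real.log a - Real.log b ≤ |a - b| * b⁻¹ := by
    intro a b ha hb
    rw [← Real.log_div ha.ne' hb.ne']
    refine (Real.log_le_sub_one_of_pos (by positivity)).trans ?_
    rw [div_sub_one hb.ne', div_eq_mul_inv]
    exact mul_le_mul_of_nonneg_right (le_abs_self _) (by positivity)
  have h1 := key hs ht
  have h2 := key ht hs
  rw [abs_sub_comm t s] at h2
  have h3 : 0 ≤ |s - t| * s⁻¹ := by positivity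
  have h4 : 0 ≤ |s - t| * t⁻¹ := by positivity
  rw [abs_le]
  constructor <;> nlinarith

/-- The `L²` inner products of the gradients of two Green functions. -/
lemma integral_gQ_gQ {x x' : ℂ} (hx : ‖x‖ < 1) (hx0 : x ≠ 0)
    (hx' : ‖x'‖ < 1) (hx'0 : x' ≠ 0) (hne : x ≠ x') :
    ∫ y in disc, ((starRingEnd ℂ) (gQ x y) * gQ x' y).re = 2 * Real.pi * ell x' x := by
  have hf : ∀ y, ‖y‖ ≤ 1 → y ≠ x' → ∀ w, fderiv ℝ (ell x') y w = -(w * gQ x' y).re := by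
    intro y hy hyx w
    rw [(hasFDerivAt_ell hx' hy hyx).fderiv]; simp
  have hd : 0 < 1 - ‖x'‖ := by linarith
  have he : 0 < ‖x - x'‖ := norm_pos_iff.2 (sub_ne_zero.2 hne)
  have h := integral_fderiv_gQ (u := ell x') hx hx0 hx' hx'0 hne
    -- The 2 bounds the gradient of the Green function. The other terms bound its difference
    -- quotients, the regular ones being multiplied by 2 ‖y - x'‖⁻¹ ≥ 1.
    (K := 2 + 4 * (1 - ‖x'‖)⁻¹ + (1 + 2 * ‖x - x'‖⁻¹)) (by positivity)
    (fun y hy hyx => (hasFDerivAt_ell hx' hy hyx).differentiableAt)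
    (fun y hy hyx => ?_) (fun y hy hyx => ?_)
  · have h2 := h.2
    have e1 : ∫ y, (ell x' y - ell x' x) * pker x y ∂arcLength =
        ∫ y, (-ell x' x) * pker x y ∂arcLength := by
      refine integral_congr_ae ?_
      filter_upwards [ae_arcLength_norm] with y hy
      rw [ell_eq_zero_of_norm_eq_one hy, zero_sub]
    have e2 : ∫ y in disc, fderiv ℝ (ell x') y ((starRingEnd ℂ) (gQ x y)) =
        ∫ y in disc, -((starRingEnd ℂ) (gQ x y) * gQ x' y).re := by
      refine integral_congr_ae ?_
      filter_upwards [ae_restrict_mem measurableSet_disc,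
        ae_restrict_of_ae ((countable_singleton x').ae_notMem volume)] with y hy hyx
      exact hf y (mem_disc.1 hy).le (by simpa using hyx) _
    rw [e1, e2, integral_neg, integral_const_mul, integral_pker hx] at h2
    linarith
  · have hp : 0 < ‖y - x'‖ := norm_pos_iff.2 (sub_ne_zero.2 hyx)
    refine ContinuousLinearMap.opNorm_le_bound _ (by positivity) fun w => ?_
    rw [hf y hy hyx w, norm_neg, mul_comm]
    refine (Complex.abs_re_le_norm _).trans ?_
    rw [norm_mul]
    refine mul_le_mul_of_nonneg_right ((norm_gQ_le hx'.le hy hyx).trans ?_) (norm_nonneg w)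
    refine mul_le_mul_of_nonneg_right ?_ (by positivity)
    have : 0 < (1 - ‖x'‖)⁻¹ := by positivity
    have : 0 < ‖x - x'‖⁻¹ := by positivity
    linarith
  · have hp : 0 < ‖y - x'‖ := norm_pos_iff.2 (sub_ne_zero.2 hyx)
    have hy1 := one_sub_norm_le (x := x') hy
    have hx1 := one_sub_norm_le (x := x') hx.le
    have a1 := abs_log_sub_log_le (hd.trans_le hy1) (hd.trans_le hx1)
    have a2 := abs_log_sub_log_le hp he
    have b1 : |‖1 - (starRingEnd ℂ) x' * y‖ - ‖1 - (starRingEnd ℂ) x' * x‖| ≤ ‖y - x‖ := by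
      refine (abs_norm_sub_norm_le _ _).trans ?_
      rw [show 1 - (starRingEnd ℂ) x' * y - (1 - (starRingEnd ℂ) x' * x) =
        (starRingEnd ℂ) x' * (x - y) by ring, norm_mul, RCLike.norm_conj, norm_sub_rev x y]
      nlinarith [norm_nonneg (y - x), norm_nonneg x']
    have b2 : |‖y - x'‖ - ‖x - x'‖| ≤ ‖y - x‖ := by
      refine (abs_norm_sub_norm_le _ _).trans ?_
      rw [show y - x' - (x - x') = y - x by ring]
    have c1 : ‖1 - (starRingEnd ℂ) x' * y‖⁻¹ + ‖1 - (starRingEnd ℂ) x' * x‖⁻¹ ≤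
        2 * (1 - ‖x'‖)⁻¹ := by
      have := inv_anti₀ hd hy1
      have := inv_anti₀ hd hx1
      linarith
    have d1 := inv_norm_sub_ge hx' hy hyx
    set P := ‖y - x'‖⁻¹
    set D := (1 - ‖x'‖)⁻¹
    set N := ‖x - x'‖⁻¹
    have hD : 0 < D := by positivity
    have hN : 0 < N := by positivity
    have hP : 0 < P := by positivity
    have hn := norm_nonneg (y - x)
    have f1 : |Real.log ‖1 - (starRingEnd ℂ) x' * y‖ - Real.log ‖1 - (starRingEnd ℂ) x' * x‖| ≤
        ‖y - x‖ * (2 * D) := a1.trans (mul_le_mul b1 c1 (by positivity) hn)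
    have f2 : |Real.log ‖y - x'‖ - Real.log ‖x - x'‖| ≤ ‖y - x‖ * (P + N) :=
      a2.trans (mul_le_mul_of_nonneg_right b2 (by positivity))
    calc |ell x' y - ell x' x| = |(Real.log ‖1 - (starRingEnd ℂ) x' * y‖ -
          Real.log ‖1 - (starRingEnd ℂ) x' * x‖) - (Real.log ‖y - x'‖ - Real.log ‖x - x'‖)| := by
          unfold ell; congr 1; ring
      _ ≤ ‖y - x‖ * (2 * D) + ‖y - x‖ * (P + N) := (norm_sub_le (_ : ℝ) _).trans (add_le_add f1 f2)
      _ = ‖y - x‖ * (2 * D + P + N) := by ring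
      _ ≤ ‖y - x‖ * ((2 + 4 * D + (1 + 2 * N)) * P) := by
          refine mul_le_mul_of_nonneg_left ?_ hn
          nlinarith
      _ = _ := by ring

lemma lipDisc_log_norm_one_sub {ζ : ℂ} (hζ : ‖ζ‖ < 1) :
    LipDisc (fun y => -Real.log ‖1 - (starRingEnd ℂ) ζ * y‖) (1 - ‖ζ‖)⁻¹ := by
  intro y hy
  have h := hasFDerivAt_log_norm_one_sub hζ hy
  have hd : 0 < 1 - ‖ζ‖ := by linarith
  refine ⟨h.differentiableAt, ?_⟩
  rw [h.fderiv]
  refine ContinuousLinearMap.opNorm_le_bound _ (by positivity) fun w => ?_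
  have h1 : ‖gZ ζ y‖ ≤ (1 - ‖ζ‖)⁻¹ := by
    rw [gZ, norm_div, RCLike.norm_conj, ← one_div]
    have := one_sub_norm_le (x := ζ) hy
    gcongr
  simp only [ContinuousLinearMap.comp_apply, ContinuousLinearMap.coe_restrictScalars',
    ContinuousLinearMap.toSpanSingleton_apply, Complex.reCLM_apply, smul_eq_mul]
  refine (Complex.abs_re_le_norm _).trans ?_
  rw [norm_mul, mul_comm]
  exact mul_le_mul_of_nonneg_right h1 (norm_nonneg _)

lemma integral_pker_mul_log {ζ x : ℂ} (hζ : ‖ζ‖ < 1) (hx : ‖x‖ < 1) :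
    ∫ y, -Real.log ‖1 - (starRingEnd ℂ) ζ * y‖ * pker x y ∂arcLength =
      2 * Real.pi * -Real.log ‖1 - (starRingEnd ℂ) ζ * x‖ := by
  have hd : DiffContOnCl ℂ (fun y => -Complex.log (1 - (starRingEnd ℂ) ζ * y)) disc := by
    have : DifferentiableOn ℂ (fun y => -Complex.log (1 - (starRingEnd ℂ) ζ * y))
        (Metric.closedBall 0 1) := by
      intro y hy
      have hs : 1 - (starRingEnd ℂ) ζ * y ∈ Complex.slitPlane :=
        Or.inl (one_sub_conj_mul_re_pos hζ (by simpa using hy))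
      have : DifferentiableAt ℂ (fun y => 1 - (starRingEnd ℂ) ζ * y) y := by fun_prop
      exact (this.clog hs).neg.differentiableWithinAt
    exact this.diffContOnCl_ball (subset_refl _)
  simpa [Complex.log_re] using integral_pker_mul_re hd hx

lemma fderiv_log_norm_one_sub {ζ y : ℂ} (hζ : ‖ζ‖ < 1) (hy : ‖y‖ ≤ 1) (w : ℂ) :
    fderiv ℝ (fun y => -Real.log ‖1 - (starRingEnd ℂ) ζ * y‖) y w = (w * gZ ζ y).re := by
  rw [(hasFDerivAt_log_norm_one_sub hζ hy).fderiv]; simp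

lemma integral_gZ_gZ {ζ ζ' : ℂ} (hζ : ‖ζ‖ < 1) (hζ' : ‖ζ'‖ < 1) :
    ∫ y in disc, ((starRingEnd ℂ) (gZ ζ y) * gZ ζ' y).re =
      Real.pi * -Real.log ‖1 - (starRingEnd ℂ) ζ' * ζ‖ := by
  have h := ((lipDisc_log_norm_one_sub hζ').integral_gZ hζ).2
  rw [integral_pker_mul_log hζ' hζ] at h
  -- The kernel at the centre is 1 on the circle, so this is the mean value property: the mean over
  -- the circle is the value -log 1 = 0.
  have h0 := integral_pker_mul_log hζ' (x := 0) (by simp)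
  have h1 : ∫ y, -Real.log ‖1 - (starRingEnd ℂ) ζ' * y‖ ∂arcLength = 0 := by
    rw [← integral_congr_ae (f := fun y => -Real.log ‖1 - (starRingEnd ℂ) ζ' * y‖ * pker 0 y), h0]
    · simp
    · filter_upwards [ae_arcLength_norm] with y hy
      simp [pker, hy]
  rw [h1] at h
  rw [← setIntegral_congr_fun measurableSet_disc
    (fun y hy => fderiv_log_norm_one_sub hζ' (mem_disc.1 hy).le _), h]
  ring

/-- The potential of `gZ` is harmonic, so it equals its Poisson integral at x; this is the
orthogonality of harmonic functions to functions vanishing on the circle. -/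
lemma integral_gQ_gZ {ζ x : ℂ} (hζ : ‖ζ‖ < 1) (hx : ‖x‖ < 1) (hx0 : x ≠ 0) :
    ∫ y in disc, ((starRingEnd ℂ) (gQ x y) * gZ ζ y).re = 0 := by
  have hL := lipDisc_log_norm_one_sub hζ
  have h := (hL.integral_gQ hx hx0).2
  rw [← setIntegral_congr_fun measurableSet_disc
    (fun y hy => fderiv_log_norm_one_sub hζ (mem_disc.1 hy).le _), h]
  simp_rw [sub_mul]
  have hcp := continuousOn_pker hx
  have i1 : Integrable (fun y => -Real.log ‖1 - (starRingEnd ℂ) ζ * y‖ * pker x y) arcLength :=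
    integrable_arcLength (hL.continuousOn_sphere.mul hcp)
  rw [integral_sub i1 ((integrable_arcLength hcp).const_mul _), integral_pker_mul_log hζ hx, integral_const_mul,
    integral_pker hx]
  ring

/-! ### Superpositions of fields and duality with the gradient. -/

/-- A measurable family of vector fields on the disc whose superposition with respect to `P` is
bounded. -/
structure IsField (P : Measure ℂ) (F : ℂ → ℂ → ℂ) (K : ℝ) : Prop where
  meas : StronglyMeasurable (Function.uncurry F)
  bound : ∀ y ∈ disc, Integrable (fun x => F x y) P ∧ ∫ x, ‖F x y‖ ∂P ≤ K
  int : ∀ᵐ x ∂P, IntegrableOn (F x) disc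

/-- The superposition of a family of vector fields. -/
def superpose (P : Measure ℂ) (F : ℂ → ℂ → ℂ) (y : ℂ) : ℂ := ∫ x, F x y ∂P

section Field

instance : IsFiniteMeasure (volume.restrict disc) := ⟨by
  rw [Measure.restrict_apply_univ]; exact measure_ball_lt_top⟩

variable {P P' : Measure ℂ} {F F' : ℂ → ℂ → ℂ} {K K' : ℝ}

lemma norm_superpose_le (hF : IsField P F K) {y : ℂ} (hy : y ∈ disc) : ‖superpose P F y‖ ≤ K :=
  (norm_integral_le_integral_norm _).trans (hF.bound y hy).2

variable [IsFiniteMeasure P] [IsFiniteMeasure P']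

lemma stronglyMeasurable_superpose (hF : IsField P F K) : StronglyMeasurable (superpose P F) :=
  StronglyMeasurable.integral_prod_left (f := F) hF.meas

lemma memLp_superpose (hF : IsField P F K) (p : ENNReal) :
    MemLp (superpose P F) p (volume.restrict disc) :=
  MemLp.of_bound (stronglyMeasurable_superpose hF).aestronglyMeasurable K
    ((ae_restrict_mem measurableSet_disc).mono fun _ hy => norm_superpose_le hF hy)

/-- Fubini: the uniform bound on the integral of ‖F x y‖ over x makes the double integral absolutely
convergent for every integrable V. -/
lemma integral_inner_superpose (hF : IsField P F K) {V : ℂ → ℂ} (hV : IntegrableOn V disc) :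
    ∫ y in disc, inner ℝ (V y) (superpose P F y) =
      ∫ x, (∫ y in disc, inner ℝ (V y) (F x y)) ∂P := by
  have hm : AEStronglyMeasurable (fun p : ℂ × ℂ => inner ℝ (V p.1) (F p.2 p.1))
      ((volume.restrict disc).prod P) := by
    refine AEStronglyMeasurable.inner (𝕜 := ℝ) hV.1.comp_fst ?_
    exact (hF.meas.comp_measurable measurable_swap).aestronglyMeasurable
  have hi : Integrable (fun p : ℂ × ℂ => inner ℝ (V p.1) (F p.2 p.1))
      ((volume.restrict disc).prod P) := by
    rw [integrable_prod_iff hm]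
    constructor
    · filter_upwards [ae_restrict_mem measurableSet_disc] with y hy
      exact (hF.bound y hy).1.const_inner (V y)
    · refine Integrable.mono' (hV.norm.mul_const K) hm.norm.integral_prod_right' ?_
      filter_upwards [ae_restrict_mem measurableSet_disc] with y hy
      rw [Real.norm_of_nonneg (integral_nonneg fun _ => norm_nonneg _)]
      calc ∫ x, ‖inner ℝ (V y) (F x y)‖ ∂P ≤ ∫ x, ‖V y‖ * ‖F x y‖ ∂P := by
            refine integral_mono ((hF.bound y hy).1.const_inner (V y)).norm
              ((hF.bound y hy).1.norm.const_mul _) fun x => ?_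
            exact norm_inner_le_norm _ _
        _ = ‖V y‖ * ∫ x, ‖F x y‖ ∂P := integral_const_mul _ _
        _ ≤ ‖V y‖ * K := by
            gcongr
            exact (hF.bound y hy).2
  have := integral_integral_swap (f := fun y x => inner ℝ (V y) (F x y)) hi
  rw [← this]
  refine setIntegral_congr_fun measurableSet_disc fun y hy => ?_
  exact (integral_inner (hF.bound y hy).1 (V y)).symm

lemma integral_inner_superpose_superpose (hF : IsField P F K) (hF' : IsField P' F' K') :
    ∫ y in disc, inner ℝ (superpose P' F' y) (superpose P F y) =
      ∫ x, ∫ x', (∫ y in disc, inner ℝ (F x y) (F' x' y)) ∂P' ∂P := by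
  rw [integral_inner_superpose hF ((memLp_superpose hF' 1).integrable le_rfl)]
  refine integral_congr_ae ?_
  filter_upwards [hF.int] with x hx
  simp_rw [real_inner_comm (F x _)]
  rw [integral_inner_superpose hF' hx]

end Field

/-- The field generating `u - P u` at the points of the disc, weighted by a density. -/
def fieldQ (ρ : ℂ → ℝ) (x y : ℂ) : ℂ := ρ x • (starRingEnd ℂ) (gQ x y)

/-- The field generating the boundary values of `u`, weighted by a density on the circle. -/
def fieldZ (α : ℂ → ℝ) (r : ℝ) (x y : ℂ) : ℂ := α x • (starRingEnd ℂ) (gZ (r * x) y)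

lemma setIntegral_norm_sub_rpow_le {κ : ℝ} (hκ : κ < 2) {y : ℂ} (hy : ‖y‖ ≤ 1) :
    ∫ x in disc, ‖y - x‖ ^ (-κ) ≤ ∫ x in Metric.ball (0 : ℂ) 2, ‖x‖ ^ (-κ) := by
  have h := integrableOn_norm_rpow_ball hκ (r := 2)
  rw [← integrable_indicator_iff Metric.isOpen_ball.measurableSet] at h
  rw [← integral_indicator (f := fun x : ℂ => ‖x‖ ^ (-κ)) Metric.isOpen_ball.measurableSet,
    ← integral_sub_left_eq_self ((Metric.ball (0 : ℂ) 2).indicator fun x => ‖x‖ ^ (-κ)) volume y,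
    ← integral_indicator measurableSet_disc]
  refine integral_mono_of_nonneg (ae_of_all _ fun x => ?_) (h.comp_sub_left y) (ae_of_all _ fun x => ?_)
  · exact indicator_nonneg (fun _ _ => by positivity) _
  · simp only
    by_cases hx : x ∈ disc
    · rw [indicator_of_mem hx, indicator_of_mem]
      rw [Metric.mem_ball, dist_zero_right]
      rw [mem_disc] at hx
      linarith [norm_sub_le y x]
    · rw [indicator_of_notMem hx]
      exact indicator_nonneg (fun _ _ => by positivity) _

lemma measurable_gQ : Measurable (Function.uncurry gQ) := by
  unfold gQ Function.uncurry; fun_prop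

lemma measurable_gZ : Measurable (Function.uncurry gZ) := by
  unfold gZ Function.uncurry; fun_prop

/-- The integral of 2/‖y - x‖ over x in the disc is bounded uniformly in y, by translation to a ball
of radius 2. -/
lemma isField_fieldQ {ρ : ℂ → ℝ} (hρ : Measurable ρ) {K : ℝ} (hK : ∀ x, |ρ x| ≤ K) :
    ∃ K', IsField (volume.restrict disc) (fieldQ ρ) K' := by
  have hK0 : 0 ≤ K := (abs_nonneg _).trans (hK 0)
  have hm : Measurable (Function.uncurry (fieldQ ρ)) := by
    have := measurable_gQ
    unfold fieldQ
    exact (hρ.comp measurable_fst).smul (Complex.continuous_conj.measurable.comp this)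
  have hb : ∀ x y : ℂ, ‖x‖ ≤ 1 → ‖y‖ ≤ 1 → y ≠ x → ‖fieldQ ρ x y‖ ≤ K * (2 * ‖y - x‖⁻¹) := by
    intro x y hx hy hxy
    rw [fieldQ, norm_smul, RCLike.norm_conj]
    exact mul_le_mul (hK x) (norm_gQ_le hx hy hxy) (norm_nonneg _) hK0
  have hint : ∀ y : ℂ, IntegrableOn (fun x : ℂ => K * (2 * ‖y - x‖⁻¹)) disc := fun y => by
    have := ((integrableOn_inv_norm_sub y).const_mul 2).const_mul K
    simpa only [IntegrableOn, norm_sub_rev] using this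
  refine ⟨K * (2 * ∫ x in Metric.ball (0 : ℂ) 2, ‖x‖ ^ (-1 : ℝ)), hm.stronglyMeasurable,
    fun y hy => ?_, ?_⟩
  · have hae : ∀ᵐ x ∂(volume.restrict disc), ‖fieldQ ρ x y‖ ≤ K * (2 * ‖y - x‖⁻¹) := by
      filter_upwards [ae_restrict_mem measurableSet_disc,
        ae_restrict_of_ae ((countable_singleton y).ae_notMem volume)] with x hx hxy
      exact hb x y (mem_disc.1 hx).le (mem_disc.1 hy).le fun h => hxy (by simp [h])
    have hi : Integrable (fun x => fieldQ ρ x y) (volume.restrict disc) :=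
      Integrable.mono' (hint y) (hm.comp (by fun_prop : Measurable fun x : ℂ => (x, y))).aestronglyMeasurable hae
    refine ⟨hi, (integral_mono_ae hi.norm (hint y) hae).trans ?_⟩
    rw [integral_const_mul, integral_const_mul]
    have := setIntegral_norm_sub_rpow_le (κ := 1) (by norm_num) (mem_disc.1 hy).le
    simp only [Real.rpow_neg_one] at this ⊢
    gcongr
  · filter_upwards [ae_restrict_mem measurableSet_disc] with x hx
    refine Integrable.mono' (((integrableOn_inv_norm_sub x).const_mul 2).const_mul K)
      (hm.comp (by fun_prop : Measurable fun y : ℂ => (x, y))).aestronglyMeasurable ?_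
    filter_upwards [ae_restrict_mem measurableSet_disc,
      ae_restrict_of_ae ((countable_singleton x).ae_notMem volume)] with y hy hxy
    exact hb x y (mem_disc.1 hx).le (mem_disc.1 hy).le hxy

/-- The sources are moved from the circle to radius r < 1, which keeps the fields bounded; r tends
to 1 only in `LipDisc.integral_boundary_le`. -/
lemma isField_fieldZ {α : ℂ → ℝ} (hα : Measurable α) {K : ℝ} (hK : ∀ x, |α x| ≤ K) {r : ℝ}
    (hr0 : 0 ≤ r) (hr : r < 1) :
    ∃ K', IsField arcLength (fieldZ α r) K' := by
  have hK0 : 0 ≤ K := (abs_nonneg _).trans (hK 0)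
  have hm : Measurable (Function.uncurry (fieldZ α r)) := by
    have := measurable_gZ
    unfold fieldZ
    refine (hα.comp measurable_fst).smul (Complex.continuous_conj.measurable.comp ?_)
    exact this.comp (by fun_prop : Measurable fun p : ℂ × ℂ => ((r : ℂ) * p.1, p.2))
  have hb : ∀ x y : ℂ, ‖x‖ = 1 → ‖y‖ ≤ 1 → ‖fieldZ α r x y‖ ≤ K * (1 - r)⁻¹ := by
    intro x y hx hy
    have h1 : ‖(r : ℂ) * x‖ = r := by simp [hx, abs_of_nonneg hr0]
    rw [fieldZ, norm_smul, RCLike.norm_conj]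
    refine mul_le_mul (hK x) ?_ (norm_nonneg _) hK0
    rw [gZ, norm_div, RCLike.norm_conj, ← one_div, h1]
    have h2 := one_sub_norm_le (x := (r : ℂ) * x) hy
    rw [h1] at h2
    have : 0 < 1 - r := by linarith
    gcongr
  refine ⟨K * (1 - r)⁻¹ * arcLength.real univ, hm.stronglyMeasurable, fun y hy => ?_, ?_⟩
  · have hae : ∀ᵐ x ∂arcLength, ‖fieldZ α r x y‖ ≤ K * (1 - r)⁻¹ := by
      filter_upwards [ae_arcLength_norm] with x hx
      exact hb x y hx (mem_disc.1 hy).le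
    have hi : Integrable (fun x => fieldZ α r x y) arcLength :=
      Integrable.mono' (integrable_const _)
        (hm.comp (by fun_prop : Measurable fun x : ℂ => (x, y))).aestronglyMeasurable hae
    refine ⟨hi, (integral_mono_ae hi.norm (integrable_const _) hae).trans ?_⟩
    rw [integral_const, smul_eq_mul, mul_comm]
  · filter_upwards [ae_arcLength_norm] with x hx
    refine Integrable.mono' (integrable_const (K * (1 - r)⁻¹))
      (hm.comp (by fun_prop : Measurable fun y : ℂ => (x, y))).aestronglyMeasurable ?_
    filter_upwards [ae_restrict_mem measurableSet_disc] with y hy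
    exact hb x y hx (mem_disc.1 hy).le

/-- The Dirichlet energy. -/
def energy (u : ℂ → ℝ) : ℝ := ∫ y in disc, ‖gradient u y‖ ^ 2

/-- The Poisson integral of the boundary values. -/
def poisson (u : ℂ → ℝ) (x : ℂ) : ℝ := (2 * Real.pi)⁻¹ * ∫ y, u y * pker x y ∂arcLength

/-- The mean over the circle. -/
def cmean (u : ℂ → ℝ) : ℝ := (2 * Real.pi)⁻¹ * ∫ y, u y ∂arcLength

lemma norm_gradient (u : ℂ → ℝ) (y : ℂ) : ‖gradient u y‖ = ‖fderiv ℝ u y‖ := by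
  rw [gradient]; exact LinearIsometryEquiv.norm_map _ _

lemma LipDisc.memLp_gradient {u : ℂ → ℝ} {L : ℝ} (h : LipDisc u L) (p : ENNReal) :
    MemLp (gradient u) p (volume.restrict disc) := by
  refine MemLp.of_bound ?_ L ((ae_restrict_mem measurableSet_disc).mono fun y hy => ?_)
  · have : Measurable (gradient u) :=
      (LinearIsometryEquiv.continuous _).measurable.comp (measurable_fderiv ℝ u)
    exact this.aestronglyMeasurable
  · rw [norm_gradient]; exact (h y (mem_disc.1 hy).le).2

section Duality

variable {u : ℂ → ℝ} {L : ℝ} (h : LipDisc u L)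
include h

lemma LipDisc.integral_inner_fieldQ {ρ : ℂ → ℝ} (hρ : Measurable ρ) {K : ℝ} (hK : ∀ x, |ρ x| ≤ K) :
    ∫ y in disc, inner ℝ (gradient u y) (superpose (volume.restrict disc) (fieldQ ρ) y) =
      2 * Real.pi * ∫ x in disc, ρ x * (poisson u x - u x) := by
  obtain ⟨K', hF⟩ := isField_fieldQ hρ hK
  rw [integral_inner_superpose hF ((h.memLp_gradient 1).integrable le_rfl), ← integral_const_mul]
  refine integral_congr_ae ?_
  filter_upwards [ae_restrict_mem measurableSet_disc,
    ae_restrict_of_ae ((countable_singleton 0).ae_notMem volume)] with x hx hx0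
  have hx1 := mem_disc.1 hx
  have h1 := (h.integral_gQ hx1 hx0).2
  have h2 : ∀ y, inner ℝ (gradient u y) (fieldQ ρ x y) =
      ρ x * fderiv ℝ u y ((starRingEnd ℂ) (gQ x y)) := fun y => by
    rw [fieldQ, inner_smul_right, inner_gradient_left]
  simp_rw [h2]
  rw [integral_const_mul, h1]
  simp_rw [sub_mul]
  have hcp := continuousOn_pker hx1
  have i1 : Integrable (fun y => u y * pker x y) arcLength :=
    integrable_arcLength (h.continuousOn_sphere.mul hcp)
  rw [integral_sub i1 ((integrable_arcLength hcp).const_mul _), integral_const_mul,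
    integral_pker hx1, poisson]
  have := Real.pi_pos.ne'
  field_simp

lemma LipDisc.integral_inner_fieldZ {α : ℂ → ℝ} (hα : Measurable α) {K : ℝ} (hK : ∀ x, |α x| ≤ K)
    {r : ℝ} (hr0 : 0 ≤ r) (hr : r < 1) :
    ∫ y in disc, inner ℝ (gradient u y) (superpose arcLength (fieldZ α r) y) =
      Real.pi * ∫ x, α x * (poisson u (r * x) - cmean u) ∂arcLength := by
  obtain ⟨K', hF⟩ := isField_fieldZ hα hK hr0 hr
  rw [integral_inner_superpose hF ((h.memLp_gradient 1).integrable le_rfl), ← integral_const_mul]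
  refine integral_congr_ae ?_
  filter_upwards [ae_arcLength_norm] with x hx
  have hx1 : ‖(r : ℂ) * x‖ < 1 := by simp [hx, abs_of_nonneg hr0, hr]
  have h1 := (h.integral_gZ hx1).2
  have h2 : ∀ y, inner ℝ (gradient u y) (fieldZ α r x y) =
      α x * fderiv ℝ u y ((starRingEnd ℂ) (gZ (r * x) y)) := fun y => by
    rw [fieldZ, inner_smul_right, inner_gradient_left]
  simp_rw [h2]
  rw [integral_const_mul, h1, poisson, cmean]
  have := Real.pi_pos.ne'
  field_simp

end Duality

lemma integral_superpose_fieldQ {ρ : ℂ → ℝ} (hρ : Measurable ρ) {K : ℝ} (hK : ∀ x, |ρ x| ≤ K) :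
    ∫ y in disc, ‖superpose (volume.restrict disc) (fieldQ ρ) y‖ ^ 2 =
      2 * Real.pi * ∫ x in disc, ∫ x' in disc, ρ x * ρ x' * ell x x' := by
  obtain ⟨K', hF⟩ := isField_fieldQ hρ hK
  simp_rw [← real_inner_self_eq_norm_sq]
  rw [integral_inner_superpose_superpose hF hF, ← integral_const_mul]
  refine integral_congr_ae ?_
  filter_upwards [ae_restrict_mem measurableSet_disc,
    ae_restrict_of_ae ((countable_singleton 0).ae_notMem volume)] with x hx hx0
  rw [← integral_const_mul]
  refine integral_congr_ae ?_
  filter_upwards [ae_restrict_mem measurableSet_disc,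
    ae_restrict_of_ae ((countable_singleton 0).ae_notMem volume),
    ae_restrict_of_ae ((countable_singleton x).ae_notMem volume)] with x' hx' hx0' hne
  have h2 : ∀ y, inner ℝ (fieldQ ρ x y) (fieldQ ρ x' y) =
      ρ x * ρ x' * ((starRingEnd ℂ) (gQ x' y) * gQ x y).re := fun y => by
    rw [fieldQ, fieldQ, inner_smul_right, real_inner_smul_left, Complex.inner, Complex.conj_conj]
    ring
  simp_rw [h2]
  rw [integral_const_mul, integral_gQ_gQ (mem_disc.1 hx') hx0' (mem_disc.1 hx) hx0 hne]
  ring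

lemma integral_superpose_fieldZ {α : ℂ → ℝ} (hα : Measurable α) {K : ℝ} (hK : ∀ x, |α x| ≤ K)
    {r : ℝ} (hr0 : 0 ≤ r) (hr : r < 1) :
    ∫ y in disc, ‖superpose arcLength (fieldZ α r) y‖ ^ 2 =
      Real.pi * ∫ x, ∫ x', α x * α x' * -Real.log ‖1 - (starRingEnd ℂ) (r * x) * (r * x')‖
        ∂arcLength ∂arcLength := by
  obtain ⟨K', hF⟩ := isField_fieldZ hα hK hr0 hr
  simp_rw [← real_inner_self_eq_norm_sq]
  rw [integral_inner_superpose_superpose hF hF, ← integral_const_mul]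
  refine integral_congr_ae ?_
  filter_upwards [ae_arcLength_norm] with x hx
  rw [← integral_const_mul]
  refine integral_congr_ae ?_
  filter_upwards [ae_arcLength_norm] with x' hx'
  have hx1 : ‖(r : ℂ) * x‖ < 1 := by simp [hx, abs_of_nonneg hr0, hr]
  have hx1' : ‖(r : ℂ) * x'‖ < 1 := by simp [hx', abs_of_nonneg hr0, hr]
  have h2 : ∀ y, inner ℝ (fieldZ α r x y) (fieldZ α r x' y) =
      α x * α x' * ((starRingEnd ℂ) (gZ (r * x') y) * gZ (r * x) y).re := fun y => by
    rw [fieldZ, fieldZ, inner_smul_right, real_inner_smul_left, Complex.inner, Complex.conj_conj]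
    ring
  simp_rw [h2]
  rw [integral_const_mul, integral_gZ_gZ hx1' hx1]
  ring

lemma integral_superpose_fieldZ_fieldQ {α : ℂ → ℝ} (hα : Measurable α) {K : ℝ}
    (hK : ∀ x, |α x| ≤ K) {r : ℝ} (hr0 : 0 ≤ r) (hr : r < 1) {ρ : ℂ → ℝ} (hρ : Measurable ρ)
    {K' : ℝ} (hK' : ∀ x, |ρ x| ≤ K') :
    ∫ y in disc, inner ℝ (superpose (volume.restrict disc) (fieldQ ρ) y)
      (superpose arcLength (fieldZ α r) y) = 0 := by
  obtain ⟨K1, hF⟩ := isField_fieldZ hα hK hr0 hr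
  obtain ⟨K2, hF'⟩ := isField_fieldQ hρ hK'
  rw [integral_inner_superpose_superpose hF hF']
  refine integral_eq_zero_of_ae ?_
  filter_upwards [ae_arcLength_norm] with x hx
  refine integral_eq_zero_of_ae ?_
  filter_upwards [ae_restrict_mem measurableSet_disc,
    ae_restrict_of_ae ((countable_singleton 0).ae_notMem volume)] with x' hx' hx0'
  have hx1 : ‖(r : ℂ) * x‖ < 1 := by simp [hx, abs_of_nonneg hr0, hr]
  have h2 : ∀ y, inner ℝ (fieldZ α r x y) (fieldQ ρ x' y) =
      α x * ρ x' * ((starRingEnd ℂ) (gQ x' y) * gZ (r * x) y).re := fun y => by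
    rw [fieldZ, fieldQ, inner_smul_right, real_inner_smul_left, Complex.inner, Complex.conj_conj]
    ring
  simp_rw [h2]
  rw [integral_const_mul, integral_gQ_gZ hx1 (mem_disc.1 hx') hx0', mul_zero]
  rfl

/-! ### Riesz and logarithmic potentials on the circle. -/

/-- Every window of length 2π represents the same measure on the additive circle. This allows the
window to be centred at the singularity of a potential. -/
lemma arcLength_eq_map (a : ℝ) : arcLength =
    (volume.restrict (Ioc a (a + 2 * Real.pi))).map (circleMap 0 1) := by
  have : Fact (0 < 2 * Real.pi) := ⟨by positivity⟩
  have h1 : circleMap 0 1 = (fun z : Circle => (z : ℂ)) ∘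
      (AddCircle.toCircle (T := 2 * Real.pi)) ∘ (QuotientAddGroup.mk : ℝ → AddCircle (2 * Real.pi)) := by
    ext θ
    have := AddCircle.toCircle_apply_mk (T := 2 * Real.pi) θ
    simp only [Function.comp]
    rw [show (QuotientAddGroup.mk θ : AddCircle (2 * Real.pi)) = (θ : AddCircle (2 * Real.pi)) from rfl, this]
    have h2 : 2 * Real.pi / (2 * Real.pi) * θ = θ := by
      rw [div_self (by positivity), one_mul]
    rw [h2, Circle.coe_exp, circleMap]; simp
  have hm : Measurable ((fun z : Circle => (z : ℂ)) ∘ (AddCircle.toCircle (T := 2 * Real.pi))) :=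
    ((by fun_prop : Continuous fun z : Circle => (z : ℂ)).comp AddCircle.continuous_toCircle).measurable
  have key : ∀ b : ℝ, (volume.restrict (Ioc b (b + 2 * Real.pi))).map (circleMap 0 1) =
      (volume : Measure (AddCircle (2 * Real.pi))).map
        ((fun z : Circle => (z : ℂ)) ∘ (AddCircle.toCircle (T := 2 * Real.pi))) := by
    intro b
    have hp := AddCircle.measurePreserving_mk (2 * Real.pi) b
    rw [← hp.map_eq, Measure.map_map hm hp.measurable, h1]
    rfl
  rw [key a, arcLength, ← key 0, zero_add]

lemma integrableOn_abs_rpow {γ : ℝ} (hγ : γ < 1) {r : ℝ} :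
    IntegrableOn (fun t : ℝ => |t| ^ (-γ)) (Metric.ball 0 r) := by
  have := integrableOn_fun_norm_addHaar (volume : Measure ℝ) (f := fun t : ℝ => t ^ (-γ)) (r := r)
  simp only [Real.norm_eq_abs] at this
  rw [this]
  rcases le_or_gt r 0 with hr | hr
  · simp [Ioo_eq_empty (not_lt.2 hr)]
  have h := (intervalIntegral.intervalIntegrable_rpow' (a := 0) (b := r) (r := -γ) (by linarith))
  rw [intervalIntegrable_iff_integrableOn_Ioo_of_le hr.le] at h
  simpa using h

/-- The chord is 2 |sin((θ - φ)/2)|, and Jordan's inequality compares it with the arc. -/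
lemma norm_circleMap_sub_ge {θ φ : ℝ} (h : |θ - φ| ≤ Real.pi) :
    2 / Real.pi * |θ - φ| ≤ ‖circleMap 0 1 θ - circleMap 0 1 φ‖ := by
  have h1 : ‖circleMap 0 1 θ - circleMap 0 1 φ‖ = ‖2 * Real.sin ((θ - φ) / 2)‖ := by
    rw [← Complex.norm_exp_I_mul_ofReal_sub_one]
    have : circleMap 0 1 θ - circleMap 0 1 φ =
        circleMap 0 1 φ * (Complex.exp (Complex.I * ((θ - φ : ℝ) : ℂ)) - 1) := by
      simp only [circleMap, zero_add, Complex.ofReal_one, one_mul]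
      rw [mul_sub, ← Complex.exp_add, mul_one]
      congr 2
      push_cast; ring
    rw [this, norm_mul]; simp
  rw [h1, Real.norm_eq_abs, abs_mul, abs_two]
  have := Real.mul_abs_le_abs_sin (x := (θ - φ) / 2) (by rw [abs_div, abs_two]; linarith)
  rw [abs_div, abs_two] at this
  linarith

/-- A uniform bound for the Riesz potentials of the circle. -/
def circleRiesz (γ : ℝ) : ℝ :=
  (2 / Real.pi) ^ (-γ) * ∫ t in Metric.ball (0 : ℝ) 4, |t| ^ (-γ)

lemma integral_circle_rpow_le {γ : ℝ} (h0 : 0 ≤ γ) (hγ : γ < 1) {x : ℂ} (hx : ‖x‖ = 1) :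
    Integrable (fun y => ‖x - y‖ ^ (-γ)) arcLength ∧
      ∫ y, ‖x - y‖ ^ (-γ) ∂arcLength ≤ circleRiesz γ := by
  obtain ⟨φ, rfl⟩ : ∃ φ : ℝ, circleMap 0 1 φ = x := by
    refine ⟨x.arg, ?_⟩
    have := Complex.norm_mul_exp_arg_mul_I x
    rw [hx] at this
    simpa [circleMap] using this
  have hm : Measurable fun y : ℂ => ‖circleMap 0 1 φ - y‖ ^ (-γ) := by fun_prop
  have hb : ∀ θ ∈ Ioc (φ - Real.pi) (φ - Real.pi + 2 * Real.pi), θ ≠ φ →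
      ‖circleMap 0 1 φ - circleMap 0 1 θ‖ ^ (-γ) ≤ (2 / Real.pi) ^ (-γ) * |θ - φ| ^ (-γ) := by
    intro θ hθ hne
    have hp : 0 < |θ - φ| := abs_pos.2 (sub_ne_zero.2 hne)
    have hpi := Real.pi_pos
    rw [← Real.mul_rpow (by positivity) hp.le, norm_sub_rev]
    refine Real.rpow_le_rpow_of_nonpos (by positivity) (norm_circleMap_sub_ge ?_) (by linarith)
    rw [abs_le]; constructor <;> linarith [hθ.1, hθ.2]
  have hi := (integrableOn_abs_rpow hγ (r := 4)).integrable_indicator Metric.isOpen_ball.measurableSet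
  have hi2 := (hi.comp_sub_right φ).const_mul ((2 / Real.pi) ^ (-γ))
  have hae : ∀ᵐ θ ∂(volume.restrict (Ioc (φ - Real.pi) (φ - Real.pi + 2 * Real.pi))),
      ‖circleMap 0 1 φ - circleMap 0 1 θ‖ ^ (-γ) ≤ (2 / Real.pi) ^ (-γ) *
        (Metric.ball (0 : ℝ) 4).indicator (fun t => |t| ^ (-γ)) (θ - φ) := by
    filter_upwards [ae_restrict_mem measurableSet_Ioc,
      ae_restrict_of_ae ((countable_singleton φ).ae_notMem volume)] with θ hθ hne
    rw [indicator_of_mem]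
    · exact hb θ hθ (by simpa using hne)
    · rw [Metric.mem_ball, dist_zero_right, Real.norm_eq_abs, abs_lt]
      constructor <;> linarith [hθ.1, hθ.2, Real.pi_lt_four]
  have hint : Integrable (fun θ => ‖circleMap 0 1 φ - circleMap 0 1 θ‖ ^ (-γ))
      (volume.restrict (Ioc (φ - Real.pi) (φ - Real.pi + 2 * Real.pi))) := by
    refine Integrable.mono' hi2.integrableOn
      (hm.comp (continuous_circleMap 0 1).measurable).aestronglyMeasurable ?_
    filter_upwards [hae] with θ hθ
    rwa [Real.norm_of_nonneg (by positivity)]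
  rw [arcLength_eq_map (φ - Real.pi)]
  constructor
  · rw [integrable_map_measure hm.aestronglyMeasurable (continuous_circleMap 0 1).aemeasurable]
    exact hint
  · rw [integral_map (continuous_circleMap 0 1).aemeasurable hm.aestronglyMeasurable]
    refine (integral_mono_ae hint hi2.integrableOn hae).trans ?_
    refine (setIntegral_le_integral hi2 (ae_of_all _ fun θ => ?_)).trans ?_
    · exact mul_nonneg (by positivity) (indicator_nonneg (fun _ _ => by positivity) _)
    · rw [integral_const_mul, integral_sub_right_eq_self
        ((Metric.ball (0 : ℝ) 4).indicator (fun t => |t| ^ (-γ))) φ,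
        integral_indicator Metric.isOpen_ball.measurableSet, circleRiesz]

lemma integrable_prod_circle_rpow {γ : ℝ} (h0 : 0 ≤ γ) (hγ : γ < 1) :
    Integrable (fun p : ℂ × ℂ => ‖p.1 - p.2‖ ^ (-γ)) (arcLength.prod arcLength) := by
  have hm : AEStronglyMeasurable (fun p : ℂ × ℂ => ‖p.1 - p.2‖ ^ (-γ))
    (arcLength.prod arcLength) := (by fun_prop : Measurable _).aestronglyMeasurable
  rw [integrable_prod_iff hm]
  constructor
  · filter_upwards [ae_arcLength_norm] with x hx
    exact (integral_circle_rpow_le h0 hγ hx).1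
  · refine Integrable.mono' (integrable_const (circleRiesz γ)) hm.norm.integral_prod_right' ?_
    filter_upwards [ae_arcLength_norm] with x hx
    rw [Real.norm_of_nonneg (integral_nonneg fun _ => norm_nonneg _)]
    refine (integral_congr_ae (ae_of_all _ fun y => ?_)).trans_le (integral_circle_rpow_le h0 hγ hx).2
    exact Real.norm_of_nonneg (by positivity)

/-- A logarithmic singularity is weaker than any negative power; the value at t = 0 is covered by
log 0 = 0. -/
lemma abs_log_le_rpow {t κ : ℝ} (ht : 0 ≤ t) (ht2 : t ≤ 2) (hκ : 0 < κ) :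
    |Real.log t| ≤ κ⁻¹ * t ^ (-κ) + 1 := by
  rcases ht.eq_or_lt with rfl | hp
  · simp; positivity
  rw [abs_le]
  have h1 : Real.log t⁻¹ ≤ t⁻¹ ^ κ / κ := Real.log_le_rpow_div (by positivity) hκ
  rw [Real.log_inv, Real.inv_rpow hp.le, ← Real.rpow_neg hp.le] at h1
  have h2 : 0 ≤ κ⁻¹ * t ^ (-κ) := by positivity
  have h3 : Real.log t ≤ t - 1 := Real.log_le_sub_one_of_pos hp
  constructor
  · rw [div_eq_inv_mul] at h1; linarith
  · linarith

lemma integrable_log_circle {x : ℂ} (hx : ‖x‖ = 1) :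
    Integrable (fun y => Real.log ‖x - y‖) arcLength := by
  refine Integrable.mono' (((integral_circle_rpow_le (γ := 1 / 2) (by norm_num) (by norm_num)
    hx).1.const_mul (1 / 2)⁻¹).add (integrable_const 1)) (by fun_prop : Measurable _).aestronglyMeasurable ?_
  filter_upwards [ae_arcLength_norm] with y hy
  refine abs_log_le_rpow (norm_nonneg _) ?_ (by norm_num)
  linarith [norm_sub_le x y]

lemma integrable_prod_log_circle :
    Integrable (fun p : ℂ × ℂ => Real.log ‖p.1 - p.2‖) (arcLength.prod arcLength) := by
  refine Integrable.mono' (((integrable_prod_circle_rpow (γ := 1 / 2) (by norm_num) (by norm_num)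
    ).const_mul (1 / 2)⁻¹).add (integrable_const 1)) (by fun_prop : Measurable _).aestronglyMeasurable ?_
  have h1 : ∀ᵐ p ∂(arcLength.prod arcLength), ‖p.1‖ = 1 := 
    Measure.quasiMeasurePreserving_fst.ae ae_arcLength_norm
  have h2 : ∀ᵐ p ∂(arcLength.prod arcLength), ‖p.2‖ = 1 := 
    Measure.quasiMeasurePreserving_snd.ae ae_arcLength_norm
  filter_upwards [h1, h2] with p hx hy
  refine abs_log_le_rpow (norm_nonneg _) ?_ (by norm_num)
  linarith [norm_sub_le p.1 p.2]

instance : NullSingletonClass arcLength := ⟨fun z => by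
  rw [arcLength, Measure.map_apply (continuous_circleMap 0 1).measurable (measurableSet_singleton z)]
  exact ((countable_singleton z).preimage_circleMap 0 one_ne_zero).measure_zero _⟩

/-! ### Splitting of the energy and the duality bounds. -/

lemma integrable_inner_of_memLp {μ : Measure ℂ} {V W : ℂ → ℂ} (hV : MemLp V 2 μ)
    (hW : MemLp W 2 μ) : Integrable (fun y => inner ℝ (V y) (W y)) μ := by
  refine Integrable.mono' (hV.norm.integrable_mul hW.norm) (hV.1.inner hW.1)
    (ae_of_all _ fun y => ?_)
  exact norm_inner_le_norm _ _

lemma integrable_norm_sq_of_memLp {μ : Measure ℂ} {V : ℂ → ℂ} (hV : MemLp V 2 μ) :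
    Integrable (fun y => ‖V y‖ ^ 2) μ := (memLp_two_iff_integrable_sq_norm hV.1).1 hV

/-- This is the integral of ‖V - Z - Q‖², grouped so that each of Z and Q contributes its own
quadratic functional once the last inner product vanishes. -/
lemma integral_norm_sub_sub_sq_nonneg {μ : Measure ℂ} {V Z Q : ℂ → ℂ} (hV : MemLp V 2 μ)
    (hZ : MemLp Z 2 μ) (hQ : MemLp Q 2 μ) :
    0 ≤ ∫ y, ‖V y‖ ^ 2 ∂μ - (2 * ∫ y, inner ℝ (V y) (Z y) ∂μ - ∫ y, ‖Z y‖ ^ 2 ∂μ) -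
      (2 * ∫ y, inner ℝ (V y) (Q y) ∂μ - ∫ y, ‖Q y‖ ^ 2 ∂μ) +
      2 * ∫ y, inner ℝ (Q y) (Z y) ∂μ := by
  have i1 := integrable_norm_sq_of_memLp hV
  have i2 := integrable_norm_sq_of_memLp hZ
  have i3 := integrable_norm_sq_of_memLp hQ
  have j1 := (integrable_inner_of_memLp hV hZ).const_mul 2
  have j2 := (integrable_inner_of_memLp hV hQ).const_mul 2
  have j3 := (integrable_inner_of_memLp hQ hZ).const_mul 2
  have k1 : Integrable (fun y => 2 * inner ℝ (V y) (Z y) - ‖Z y‖ ^ 2) μ := j1.sub i2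
  have k2 : Integrable (fun y => 2 * inner ℝ (V y) (Q y) - ‖Q y‖ ^ 2) μ := j2.sub i3
  have k3 : Integrable (fun y => ‖V y‖ ^ 2 - (2 * inner ℝ (V y) (Z y) - ‖Z y‖ ^ 2)) μ := i1.sub k1
  have k4 : Integrable (fun y => ‖V y‖ ^ 2 - (2 * inner ℝ (V y) (Z y) - ‖Z y‖ ^ 2) -
    (2 * inner ℝ (V y) (Q y) - ‖Q y‖ ^ 2)) μ := k3.sub k2
  rw [← integral_const_mul, ← integral_const_mul, ← integral_const_mul, ← integral_sub j1 i2,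
    ← integral_sub j2 i3, ← integral_sub i1 k1, ← integral_sub k3 k2, ← integral_add k4 j3]
  refine integral_nonneg fun y => ?_
  have : ‖V y‖ ^ 2 - (2 * inner ℝ (V y) (Z y) - ‖Z y‖ ^ 2) -
      (2 * inner ℝ (V y) (Q y) - ‖Q y‖ ^ 2) + 2 * inner ℝ (Q y) (Z y) =
      ‖V y - Z y - Q y‖ ^ 2 := by
    rw [norm_sub_sq_real (V y - Z y), norm_sub_sq_real (V y), inner_sub_left,
      real_inner_comm (Q y) (Z y)]
    ring
  rw [this]
  positivity

/-- The values of the quadratic functional whose supremum is the energy of the harmonic part. -/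
def harmonicValues (u : ℂ → ℝ) : Set ℝ :=
  {s | ∃ (α : ℂ → ℝ) (K r : ℝ), Measurable α ∧ (∀ x, |α x| ≤ K) ∧ 0 ≤ r ∧ r < 1 ∧
    s = 2 * (∫ y in disc, inner ℝ (gradient u y) (superpose arcLength (fieldZ α r) y)) -
      ∫ y in disc, ‖superpose arcLength (fieldZ α r) y‖ ^ 2}

/-- The energy of the harmonic part of `u`. -/
def harmonicEnergy (u : ℂ → ℝ) : ℝ := sSup (harmonicValues u)

lemma zero_mem_harmonicValues (u : ℂ → ℝ) : 0 ∈ harmonicValues u := by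
  refine ⟨fun _ => 0, 0, 0, measurable_const, by simp, le_rfl, one_pos, ?_⟩
  have : superpose arcLength (fieldZ (fun _ => 0) 0) = fun _ => 0 := by
    ext y; simp [superpose, fieldZ]
  simp [this]

/-- The quadratic functional on the span of the fields `Z` and `Q`. -/
lemma LipDisc.add_le_energy {u : ℂ → ℝ} {L : ℝ} (h : LipDisc u L) {s : ℝ}
    (hs : s ∈ harmonicValues u) {ρ : ℂ → ℝ} (hρ : Measurable ρ) {K : ℝ} (hK : ∀ x, |ρ x| ≤ K) :
    s + (2 * (2 * Real.pi * ∫ x in disc, ρ x * (poisson u x - u x)) -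
      2 * Real.pi * ∫ x in disc, ∫ x' in disc, ρ x * ρ x' * ell x x') ≤ energy u := by
  obtain ⟨α, K', r, hα, hK', hr0, hr, rfl⟩ := hs
  obtain ⟨K1, hF⟩ := isField_fieldZ hα hK' hr0 hr
  obtain ⟨K2, hF'⟩ := isField_fieldQ hρ hK
  have := integral_norm_sub_sub_sq_nonneg (h.memLp_gradient 2) (memLp_superpose hF 2)
    (memLp_superpose hF' 2)
  rw [integral_superpose_fieldZ_fieldQ hα hK' hr0 hr hρ hK, h.integral_inner_fieldQ hρ hK,
    integral_superpose_fieldQ hρ hK] at this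
  unfold energy
  linarith

lemma LipDisc.bddAbove_harmonicValues {u : ℂ → ℝ} {L : ℝ} (h : LipDisc u L) :
    BddAbove (harmonicValues u) := by
  refine ⟨energy u, fun s hs => ?_⟩
  simpa using h.add_le_energy hs (ρ := fun _ => 0) measurable_const (K := 0) (by simp)

lemma LipDisc.harmonicEnergy_nonneg {u : ℂ → ℝ} {L : ℝ} (h : LipDisc u L) :
    0 ≤ harmonicEnergy u := le_csSup h.bddAbove_harmonicValues (zero_mem_harmonicValues u)

/-- Orthogonality lets the boundary density and the interior density vary independently, so the
supremum over the boundary density is taken with ρ fixed. -/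
lemma LipDisc.harmonicEnergy_add_le {u : ℂ → ℝ} {L : ℝ} (h : LipDisc u L) {ρ : ℂ → ℝ}
    (hρ : Measurable ρ) {K : ℝ} (hK : ∀ x, |ρ x| ≤ K) :
    harmonicEnergy u + (2 * (2 * Real.pi * ∫ x in disc, ρ x * (poisson u x - u x)) -
      2 * Real.pi * ∫ x in disc, ∫ x' in disc, ρ x * ρ x' * ell x x') ≤ energy u := by
  have : harmonicEnergy u ≤ energy u - (2 * (2 * Real.pi * ∫ x in disc, ρ x * (poisson u x - u x)) -
      2 * Real.pi * ∫ x in disc, ∫ x' in disc, ρ x * ρ x' * ell x x') :=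
    csSup_le ⟨_, zero_mem_harmonicValues u⟩ fun s hs => by linarith [h.add_le_energy hs hρ hK]
  linarith

lemma LipDisc.harmonicEnergy_le {u : ℂ → ℝ} {L : ℝ} (h : LipDisc u L) :
    harmonicEnergy u ≤ energy u := by
  simpa using h.harmonicEnergy_add_le (ρ := fun _ => 0) measurable_const (K := 0) (by simp)

/-- Duality bound for the non-harmonic part of `u`. -/
theorem LipDisc.integral_sub_poisson_le {u : ℂ → ℝ} {L : ℝ} (h : LipDisc u L) {ρ : ℂ → ℝ}
    (hρ : Measurable ρ) {K : ℝ} (hK : ∀ x, |ρ x| ≤ K) {c : ℝ} (hc : 0 < c) :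
    ∫ x in disc, ρ x * (u x - poisson u x) ≤ c * (energy u - harmonicEnergy u) +
      (8 * Real.pi * c)⁻¹ * ∫ x in disc, ∫ x' in disc, ρ x * ρ x' * ell x x' := by
  -- The density is scaled by -t: the sign turns Pu - u into u - Pu, and the size makes the linear
  -- term have coefficient c⁻¹.
  set t : ℝ := (4 * Real.pi * c)⁻¹ with ht
  have hpi := Real.pi_pos
  have ht0 : 0 < t := by positivity
  have h1 := h.harmonicEnergy_add_le (ρ := fun x => -t * ρ x) (hρ.const_mul _) (K := t * K)
    (fun x => by rw [abs_mul, abs_neg, abs_of_pos ht0]; gcongr; exact hK x)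
  have e1 : ∫ x in disc, -t * ρ x * (poisson u x - u x) = t * ∫ x in disc, ρ x * (u x - poisson u x) := by
    rw [← integral_const_mul]; congr 1; ext x; ring
  have e2 : ∫ x in disc, ∫ x' in disc, (-t * ρ x) * (-t * ρ x') * ell x x' =
      t ^ 2 * ∫ x in disc, ∫ x' in disc, ρ x * ρ x' * ell x x' := by
    simp_rw [← integral_const_mul]; congr 1; ext x; congr 1; ext x'; ring
  rw [e1, e2] at h1
  set A := ∫ x in disc, ρ x * (u x - poisson u x)
  set B := ∫ x in disc, ∫ x' in disc, ρ x * ρ x' * ell x x'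
  have e3 : 2 * (2 * Real.pi * (t * A)) = c⁻¹ * A := by rw [ht]; field_simp; ring
  have e4 : 2 * Real.pi * (t ^ 2 * B) = c⁻¹ * ((8 * Real.pi * c)⁻¹ * B) := by
    rw [ht]; field_simp; ring
  rw [e3, e4] at h1
  have h2 : c⁻¹ * (A - (8 * Real.pi * c)⁻¹ * B) ≤ energy u - harmonicEnergy u := by linarith
  rw [inv_mul_le_iff₀ hc] at h2
  linarith

/-- Poisson's formula for a linear function shows that ‖y - x‖² has Poisson mean δ² = 2 - 2r at the
point r x. The bound ‖y - x‖ ≤ δ + δ⁻¹ ‖y - x‖² then gives mean distance at most 2δ, which tends to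
0 as r tends to 1. -/
lemma LipDisc.abs_poisson_sub_le {u : ℂ → ℝ} {L : ℝ} (h : LipDisc u L) {r : ℝ} (hr0 : 0 ≤ r)
    (hr : r < 1) {x : ℂ} (hx : ‖x‖ = 1) :
    |poisson u (r * x) - u x| ≤ L * (2 * Real.sqrt (2 - 2 * r)) := by
  set δ := Real.sqrt (2 - 2 * r) with hδ
  have hδ2 : δ ^ 2 = 2 - 2 * r := Real.sq_sqrt (by linarith)
  have hδ0 : 0 < δ := Real.sqrt_pos.2 (by linarith)
  have hx1 : ‖(r : ℂ) * x‖ < 1 := by simp [hx, abs_of_nonneg hr0, hr]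
  have hcp := continuousOn_pker hx1
  have hpi := Real.pi_pos
  have i1 : Integrable (fun y => u y * pker (r * x) y) arcLength :=
    integrable_arcLength (h.continuousOn_sphere.mul hcp)
  have i2 := integrable_arcLength hcp
  have i3 : Integrable (fun y => ((starRingEnd ℂ) x * y).re * pker (r * x) y) arcLength :=
    integrable_arcLength (ContinuousOn.mul (by fun_prop) hcp)
  have e0 := integral_pker hx1
  have e1 : ∫ y, ((starRingEnd ℂ) x * y).re * pker (r * x) y ∂arcLength = 2 * Real.pi * r := by
    rw [integral_pker_mul_re (f := fun y => (starRingEnd ℂ) x * y)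
      (Differentiable.diffContOnCl (by fun_prop)) hx1]
    congr 1
    rw [mul_left_comm, Complex.conj_mul', hx]; simp
  have e2 : poisson u (r * x) - u x =
      (2 * Real.pi)⁻¹ * ∫ y, (u y - u x) * pker (r * x) y ∂arcLength := by
    simp_rw [sub_mul]
    rw [integral_sub i1 (i2.const_mul _), integral_const_mul, e0, poisson]
    field_simp
  rw [e2, abs_mul, abs_of_pos (by positivity), inv_mul_le_iff₀ (by positivity)]
  have hpn : ∀ y : ℂ, 0 ≤ pker (r * x) y := fun y =>
    div_nonneg (by nlinarith [norm_nonneg ((r : ℂ) * x)]) (by positivity)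
  refine (abs_integral_le_integral_abs).trans ?_
  have e3 : ∫ y, |(u y - u x) * pker (r * x) y| ∂arcLength ≤
      ∫ y, L * (δ * pker (r * x) y + δ⁻¹ * (2 * pker (r * x) y -
        2 * (((starRingEnd ℂ) x * y).re * pker (r * x) y))) ∂arcLength := by
    refine integral_mono_ae ?_ ?_ ?_
    · exact ((i1.sub (i2.const_mul (u x))).congr (ae_of_all _ fun y => by simp; ring)).abs
    · exact ((i2.const_mul δ).add (((i2.const_mul 2).sub (i3.const_mul 2)).const_mul δ⁻¹)).const_mul L
    · filter_upwards [ae_arcLength_norm] with y hy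
      rw [abs_mul, abs_of_nonneg (hpn y)]
      have k1 := h.abs_sub_le hx.le hy.le
      have k2 : ‖y - x‖ ^ 2 = 2 - 2 * ((starRingEnd ℂ) x * y).re := by
        rw [norm_sub_sq_real, hx, hy, Complex.inner]
        have : (x * (starRingEnd ℂ) y).re = ((starRingEnd ℂ) x * y).re := by simp
        rw [this]; ring
      have k3 : ‖y - x‖ ≤ δ + δ⁻¹ * ‖y - x‖ ^ 2 := by
        have : δ⁻¹ * ‖y - x‖ ^ 2 = ‖y - x‖ ^ 2 / δ := by ring
        rw [this, ← sub_le_iff_le_add', le_div_iff₀ hδ0]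
        nlinarith [sq_nonneg (‖y - x‖ - δ), norm_nonneg (y - x)]
      calc |u y - u x| * pker (r * x) y ≤ (L * (δ + δ⁻¹ * ‖y - x‖ ^ 2)) * pker (r * x) y := by
            refine mul_le_mul_of_nonneg_right (k1.trans ?_) (hpn y)
            exact mul_le_mul_of_nonneg_left k3 h.nonneg
        _ = _ := by rw [k2]; ring
  refine e3.trans (le_of_eq ?_)
  have i4 : Integrable (fun y => 2 * pker (r * x) y -
      2 * (((starRingEnd ℂ) x * y).re * pker (r * x) y)) arcLength :=
    (i2.const_mul 2).sub (i3.const_mul 2)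
  rw [integral_const_mul, integral_add (i2.const_mul _) (i4.const_mul _),
    integral_const_mul, integral_const_mul, integral_sub (i2.const_mul 2) (i3.const_mul 2),
    integral_const_mul, integral_const_mul, e0, e1]
  have : 2 * (2 * Real.pi) - 2 * (2 * Real.pi * r) = 2 * Real.pi * δ ^ 2 := by rw [hδ2]; ring
  rw [this]
  field_simp
  ring

/-- The logarithmic energy of a density on the circle. -/
def logEnergy (α : ℂ → ℝ) : ℝ :=
  ∫ x, ∫ y, α x * α y * (Real.log 2 - Real.log ‖x - y‖) ∂arcLength ∂arcLength

lemma integrable_prod_logEnergy {α β : ℂ → ℝ} (hα : Measurable α) {K : ℝ} (hK : ∀ x, |α x| ≤ K)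
    (hβ : Measurable β) {K' : ℝ} (hK' : ∀ x, |β x| ≤ K') :
    Integrable (fun p : ℂ × ℂ => α p.1 * β p.2 * (Real.log 2 - Real.log ‖p.1 - p.2‖))
      (arcLength.prod arcLength) := by
  refine ((integrable_const (Real.log 2)).sub integrable_prod_log_circle).bdd_mul (c := K * K') ?_
    (ae_of_all _ fun p => ?_)
  · exact ((hα.comp measurable_fst).mul (hβ.comp measurable_snd)).aestronglyMeasurable
  · rw [norm_mul]
    exact mul_le_mul (hK _) (hK' _) (norm_nonneg _) ((abs_nonneg _).trans (hK 0))

/-- On the circle ‖x - x'‖ ≤ 2 ‖1 - r² conj(x) x'‖ uniformly in r. Adding log 2 to the kernel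
therefore dominates every smoothed kernel, and for a probability density it costs only a constant.
-/
lemma log_kernel_le_logEnergy {α : ℂ → ℝ} (hα : Measurable α) {K : ℝ} (hK : ∀ x, |α x| ≤ K)
    (hα0 : ∀ x, 0 ≤ α x) {r : ℝ} (hr0 : 0 ≤ r) (hr : r < 1) :
    ∫ x, ∫ x', α x * α x' * -Real.log ‖1 - (starRingEnd ℂ) (r * x) * (r * x')‖
        ∂arcLength ∂arcLength ≤ logEnergy α := by
  have hr2 : r ^ 2 < 1 := by nlinarith
  have i2 := integrable_prod_logEnergy hα hK hα hK
  have hlow : ∀ x x' : ℂ, ‖x‖ = 1 → ‖x'‖ = 1 →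
      1 - r ^ 2 ≤ ‖1 - (starRingEnd ℂ) (r * x) * (r * x')‖ ∧
      ‖1 - (starRingEnd ℂ) (r * x) * (r * x')‖ ≤ 2 ∧
      ‖x - x'‖ ≤ 2 * ‖1 - (starRingEnd ℂ) (r * x) * (r * x')‖ := by
    intro x x' hx hx'
    have e : (starRingEnd ℂ) (r * x) * (r * x') = ((r ^ 2 : ℝ) : ℂ) * ((starRingEnd ℂ) x * x') := by
      rw [map_mul, Complex.conj_ofReal]; push_cast; ring
    have n1 : ‖(starRingEnd ℂ) x * x'‖ = 1 := by rw [norm_mul, RCLike.norm_conj, hx, hx', one_mul]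
    have n2 : ‖((r ^ 2 : ℝ) : ℂ) * ((starRingEnd ℂ) x * x')‖ = r ^ 2 := by
      rw [norm_mul, n1, mul_one, Complex.norm_real, Real.norm_of_nonneg (by positivity)]
    have l1 : 1 - r ^ 2 ≤ ‖1 - ((r ^ 2 : ℝ) : ℂ) * ((starRingEnd ℂ) x * x')‖ := by
      have := norm_sub_norm_le (1 : ℂ) (((r ^ 2 : ℝ) : ℂ) * ((starRingEnd ℂ) x * x'))
      rwa [n2, norm_one] at this
    rw [e]
    refine ⟨l1, ?_, ?_⟩
    · have := norm_sub_le (1 : ℂ) (((r ^ 2 : ℝ) : ℂ) * ((starRingEnd ℂ) x * x'))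
      rw [n2, norm_one] at this
      linarith
    · have e2 : ‖x - x'‖ = ‖1 - (starRingEnd ℂ) x * x'‖ := by
        have : 1 - (starRingEnd ℂ) x * x' = (starRingEnd ℂ) x * (x - x') := by
          rw [mul_sub, Complex.conj_mul', hx]; simp
        rw [this, norm_mul, RCLike.norm_conj, hx, one_mul]
      have e3 : 1 - (starRingEnd ℂ) x * x' = (1 - ((r ^ 2 : ℝ) : ℂ) * ((starRingEnd ℂ) x * x')) -
          ((1 - r ^ 2 : ℝ) : ℂ) * ((starRingEnd ℂ) x * x') := by push_cast; ring
      rw [e2, e3]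
      refine (norm_sub_le _ _).trans ?_
      rw [norm_mul ((1 - r ^ 2 : ℝ) : ℂ), n1, mul_one, Complex.norm_real,
        Real.norm_of_nonneg (by linarith : (0 : ℝ) ≤ 1 - r ^ 2)]
      linarith
  have h1 : ∀ᵐ p ∂(arcLength.prod arcLength), ‖p.1‖ = 1 :=
    Measure.quasiMeasurePreserving_fst.ae ae_arcLength_norm
  have h2 : ∀ᵐ p ∂(arcLength.prod arcLength), ‖p.2‖ = 1 :=
    Measure.quasiMeasurePreserving_snd.ae ae_arcLength_norm
  have i1 : Integrable (fun p : ℂ × ℂ => α p.1 * α p.2 *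
      -Real.log ‖1 - (starRingEnd ℂ) (r * p.1) * (r * p.2)‖) (arcLength.prod arcLength) := by
    have hm2 : Measurable fun p : ℂ × ℂ => -Real.log ‖1 - (starRingEnd ℂ) (r * p.1) * (r * p.2)‖ := by
      fun_prop
    refine Integrable.mono' (integrable_const (K * K * ((1 - r ^ 2)⁻¹ + 1)))
      (((hα.comp measurable_fst).mul (hα.comp measurable_snd)).mul hm2).aestronglyMeasurable ?_
    filter_upwards [h1, h2] with p hp1 hp2
    obtain ⟨l1, l2, -⟩ := hlow p.1 p.2 hp1 hp2
    have hK0 : 0 ≤ K := (abs_nonneg _).trans (hK 0)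
    rw [norm_mul, norm_mul, norm_neg]
    refine mul_le_mul (mul_le_mul (hK _) (hK _) (norm_nonneg _) hK0) ?_ (norm_nonneg _) (by positivity)
    have := abs_log_le_rpow (κ := 1) (norm_nonneg _) l2 one_pos
    rw [Real.rpow_neg_one, inv_one, one_mul] at this
    refine this.trans ?_
    have := inv_anti₀ (by linarith) l1
    linarith
  unfold logEnergy
  refine integral_mono_ae i1.integral_prod_left i2.integral_prod_left ?_
  filter_upwards [i1.prod_right_ae, i2.prod_right_ae, ae_arcLength_norm] with x hx1 hx2 hx
  refine integral_mono_ae hx1 hx2 ?_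
  filter_upwards [ae_arcLength_norm, (countable_singleton x).ae_notMem arcLength] with x' hx' hne
  refine mul_le_mul_of_nonneg_left ?_ (mul_nonneg (hα0 _) (hα0 _))
  obtain ⟨l1, -, l3⟩ := hlow x x' hx hx'
  have hp : 0 < ‖x - x'‖ := norm_pos_iff.2 (sub_ne_zero.2 fun h => hne (by simp [h]))
  have := Real.log_le_log hp l3
  rw [Real.log_mul two_ne_zero (by linarith)] at this
  linarith

/-- Duality bound for the boundary values of `u`. -/
theorem LipDisc.integral_boundary_le {u : ℂ → ℝ} {L : ℝ} (h : LipDisc u L) {α : ℂ → ℝ}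
    (hα : Measurable α) {K : ℝ} (hK : ∀ x, |α x| ≤ K) (hα0 : ∀ x, 0 ≤ α x)
    (hα1 : ∫ x, α x ∂arcLength = 1) {c : ℝ} (hc : 0 < c) :
    ∫ x, α x * u x ∂arcLength ≤ cmean u + c * harmonicEnergy u +
      (4 * Real.pi * c)⁻¹ * logEnergy α := by
  have hpi := Real.pi_pos
  have hαi : Integrable α arcLength := Integrable.of_bound hα.aestronglyMeasurable K (ae_of_all _ hK)
  have iu : Integrable (fun x => α x * u x) arcLength :=
    (integrable_arcLength h.continuousOn_sphere).bdd_mul hα.aestronglyMeasurable (ae_of_all _ hK)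
  have key : ∀ r : ℝ, 0 ≤ r → r < 1 → ∫ x, α x * u x ∂arcLength ≤ cmean u + c * harmonicEnergy u +
      (4 * Real.pi * c)⁻¹ * logEnergy α + L * (2 * Real.sqrt (2 - 2 * r)) := by
    intro r hr0 hr
    -- With this scaling of the density the linear term has coefficient c⁻¹.
    set t : ℝ := (2 * Real.pi * c)⁻¹ with ht
    have ht0 : 0 < t := by positivity
    have hKt : ∀ x, |t * α x| ≤ t * K := fun x => by
      rw [abs_mul, abs_of_pos ht0]; gcongr; exact hK x
    have h1 : 2 * (∫ y in disc, inner ℝ (gradient u y)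
        (superpose arcLength (fieldZ (fun x => t * α x) r) y)) -
      ∫ y in disc, ‖superpose arcLength (fieldZ (fun x => t * α x) r) y‖ ^ 2 ≤ harmonicEnergy u :=
      le_csSup h.bddAbove_harmonicValues ⟨_, t * K, r, hα.const_mul t, hKt, hr0, hr, rfl⟩
    rw [h.integral_inner_fieldZ (hα.const_mul t) hKt hr0 hr,
      integral_superpose_fieldZ (hα.const_mul t) hKt hr0 hr] at h1
    have e1 : ∫ x, t * α x * (poisson u (r * x) - cmean u) ∂arcLength =
        t * ∫ x, α x * (poisson u (r * x) - cmean u) ∂arcLength := by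
      rw [← integral_const_mul]; congr 1; ext x; ring
    have e2 : ∫ x, ∫ x', (t * α x) * (t * α x') *
          -Real.log ‖1 - (starRingEnd ℂ) (r * x) * (r * x')‖ ∂arcLength ∂arcLength =
        t ^ 2 * ∫ x, ∫ x', α x * α x' *
          -Real.log ‖1 - (starRingEnd ℂ) (r * x) * (r * x')‖ ∂arcLength ∂arcLength := by
      simp_rw [← integral_const_mul]; congr 1; ext x; congr 1; ext x'; ring
    rw [e1, e2] at h1
    have h2 := log_kernel_le_logEnergy hα hK hα0 hr0 hr
    set A := ∫ x, α x * (poisson u (r * x) - cmean u) ∂arcLength with hA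
    set B := ∫ x, ∫ x', α x * α x' *
          -Real.log ‖1 - (starRingEnd ℂ) (r * x) * (r * x')‖ ∂arcLength ∂arcLength
    have e3 : 2 * (Real.pi * (t * A)) = c⁻¹ * A := by rw [ht]; field_simp
    have e4 : Real.pi * (t ^ 2 * B) = c⁻¹ * ((4 * Real.pi * c)⁻¹ * B) := by
      rw [ht]; field_simp; ring
    rw [e3, e4] at h1
    have h3 : c⁻¹ * (A - (4 * Real.pi * c)⁻¹ * B) ≤ harmonicEnergy u := by linarith
    rw [inv_mul_le_iff₀ hc] at h3
    have h4 : (4 * Real.pi * c)⁻¹ * B ≤ (4 * Real.pi * c)⁻¹ * logEnergy α :=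
      mul_le_mul_of_nonneg_left h2 (by positivity)
    -- Return from the values at radius r to the boundary values; as α is a probability density the
    -- error enters as a single constant.
    have h5 : ∫ x, α x * (u x - cmean u - L * (2 * Real.sqrt (2 - 2 * r))) ∂arcLength ≤ A := by
      have hm : AEStronglyMeasurable (fun x => poisson u (r * x)) arcLength := by
        have h1 : AEStronglyMeasurable (fun p : ℂ × ℂ => u p.2 * pker (r * p.1) p.2)
            (arcLength.prod arcLength) := by
          refine (aestronglyMeasurable_arcLength h.continuousOn_sphere).comp_snd.mul ?_
          unfold pker
          exact (by fun_prop : Measurable _).aestronglyMeasurable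
        exact h1.integral_prod_right'.const_mul _
      have hi : Integrable (fun x => α x * (poisson u (r * x) - cmean u)) arcLength := by
        obtain ⟨B, hB⟩ := (isCompact_sphere (0 : ℂ) 1).exists_bound_of_continuousOn
          h.continuousOn_sphere
        refine Integrable.bdd_mul (c := K) ?_ hα.aestronglyMeasurable (ae_of_all _ hK)
        refine (Integrable.of_bound hm (L * (2 * Real.sqrt (2 - 2 * r)) + B) ?_).sub
          (integrable_const _)
        filter_upwards [ae_arcLength_norm] with x hx
        have k1 := h.abs_poisson_sub_le hr0 hr hx
        have k2 := hB x (by simpa using hx)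
        calc ‖poisson u (r * x)‖ = |(poisson u (r * x) - u x) + u x| := by
              rw [Real.norm_eq_abs]; congr 1; ring
          _ ≤ _ := (abs_add_le _ _).trans (add_le_add k1 k2)
      refine integral_mono_ae ?_ hi ?_
      · refine (iu.sub (hαi.const_mul (cmean u + L * (2 * Real.sqrt (2 - 2 * r))))).congr
          (ae_of_all _ fun x => ?_)
        simp; ring
      · filter_upwards [ae_arcLength_norm] with x hx
        have := (abs_le.1 (h.abs_poisson_sub_le hr0 hr hx)).1
        exact mul_le_mul_of_nonneg_left (by linarith) (hα0 x)
    have h6 : ∫ x, α x * (u x - cmean u - L * (2 * Real.sqrt (2 - 2 * r))) ∂arcLength =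
        ∫ x, α x * u x ∂arcLength - (cmean u + L * (2 * Real.sqrt (2 - 2 * r))) := by
      have : ∀ x, α x * (u x - cmean u - L * (2 * Real.sqrt (2 - 2 * r))) =
        α x * u x - (cmean u + L * (2 * Real.sqrt (2 - 2 * r))) * α x := fun x => by ring
      simp_rw [this]
      rw [integral_sub iu (hαi.const_mul _), integral_const_mul, hα1, mul_one]
    linarith
  have hlim : Tendsto (fun r : ℝ => cmean u + c * harmonicEnergy u +
      (4 * Real.pi * c)⁻¹ * logEnergy α + L * (2 * Real.sqrt (2 - 2 * r))) (𝓝[<] 1)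
      (𝓝 (cmean u + c * harmonicEnergy u + (4 * Real.pi * c)⁻¹ * logEnergy α)) := by
    have : Continuous (fun r : ℝ => cmean u + c * harmonicEnergy u +
      (4 * Real.pi * c)⁻¹ * logEnergy α + L * (2 * Real.sqrt (2 - 2 * r))) := by fun_prop
    have h2 := (this.tendsto 1).mono_left (nhdsWithin_le_nhds (s := Iio 1))
    simpa using h2
  refine ge_of_tendsto hlim ?_
  filter_upwards [Ioo_mem_nhdsLT (zero_lt_one' ℝ)] with r hr
  exact key r hr.1.le hr.2

/-! ### Gibbs densities and exponential inequalities on the circle. -/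

/-- The Gibbs variational inequality. -/
lemma gibbs {ν : Measure ℂ} {α f k W : ℂ → ℝ} {l R : ℝ} (hR : 0 < R)
    (hα0 : ∀ y, 0 ≤ α y) (hαi : Integrable α ν) (hα1 : ∫ y, α y ∂ν = 1)
    (h : ∀ᵐ y ∂ν, α y = 0 ∨ α y = Real.exp (f y - l))
    (hf : Integrable (fun y => α y * f y) ν) (hk : Integrable (fun y => α y * k y) ν)
    (hW : Integrable W ν) (hW0 : ∀ y, 0 ≤ W y)
    (hkW : ∀ᵐ y ∂ν, α y ≠ 0 → Real.exp (k y) ≤ W y) (hWR : ∫ y, W y ∂ν ≤ R) :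
    l ≤ ∫ y, α y * f y ∂ν - ∫ y, α y * k y ∂ν + Real.log R := by
  have key : ∫ y, (α y * k y - α y * f y + (l - Real.log R) * α y) ∂ν ≤
      ∫ y, (R⁻¹ * W y - α y) ∂ν := by
    refine integral_mono_ae ((hk.sub hf).add (hαi.const_mul _)) ((hW.const_mul _).sub hαi) ?_
    filter_upwards [h, hkW] with y hy hyW
    rcases eq_or_ne (α y) 0 with h0 | h0
    · simp only [h0, zero_mul, mul_zero, sub_zero, add_zero]
      have := hW0 y
      positivity
    · have h1 := hy.resolve_left h0
      have h2 := hyW h0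
      -- Jensen's inequality for the logarithm in pointwise form: weighted with α = e^{f-l}, the
      -- exponential becomes e^k / R, whose integral over the set α ≠ 0 is at most 1.
      have h3 := Real.add_one_le_exp (k y - f y + l - Real.log R)
      have h4 : α y * Real.exp (k y - f y + l - Real.log R) = R⁻¹ * Real.exp (k y) := by
        rw [h1, ← Real.exp_add]
        rw [show f y - l + (k y - f y + l - Real.log R) = -Real.log R + k y by ring, Real.exp_add,
          Real.exp_neg, Real.exp_log hR]
      have h5 := mul_le_mul_of_nonneg_left h3 (hα0 y)
      rw [h4] at h5
      have h6 : R⁻¹ * Real.exp (k y) ≤ R⁻¹ * W y := by gcongr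
      nlinarith
  have i1 : Integrable (fun y => α y * k y - α y * f y) ν := hk.sub hf
  rw [integral_add i1 (hαi.const_mul _), integral_sub hk hf, integral_const_mul, hα1,
    integral_sub (hW.const_mul _) hαi, integral_const_mul, hα1] at key
  have : R⁻¹ * ∫ y, W y ∂ν ≤ 1 := by
    rw [inv_mul_le_iff₀ hR]; linarith
  linarith

/-- The constant in the logarithmic Hardy-Littlewood-Sobolev inequality on the circle. -/
def circleConst (γ : ℝ) : ℝ := 2 ^ γ * circleRiesz γ + 1

lemma circleRiesz_nonneg (γ : ℝ) : 0 ≤ circleRiesz γ :=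
  mul_nonneg (Real.rpow_nonneg (by have := Real.pi_pos; positivity) _) (integral_nonneg fun _ => by positivity)

lemma circleConst_pos (γ : ℝ) : 0 < circleConst γ := by
  have := circleRiesz_nonneg γ
  unfold circleConst
  positivity

/-- For each fixed x the Gibbs inequality is applied with the potential γ (log 2 - log‖x - y‖),
whose exponential is a Riesz kernel of order γ < 1 with integral bounded uniformly in x. Averaging
over x with density α produces the logarithmic energy. -/
lemma le_sub_logEnergy {γ : ℝ} (h0 : 0 < γ) (hγ : γ < 1) {α f : ℂ → ℝ} {l K : ℝ}
    (hα : Measurable α) (hK : ∀ x, |α x| ≤ K) (hα0 : ∀ y, 0 ≤ α y)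
    (hα1 : ∫ y, α y ∂arcLength = 1)
    (h : ∀ᵐ y ∂arcLength, α y = 0 ∨ α y = Real.exp (f y - l))
    (hf : Integrable (fun y => α y * f y) arcLength) :
    l ≤ ∫ y, α y * f y ∂arcLength - γ * logEnergy α + Real.log (circleConst γ) := by
  have hαi : Integrable α arcLength := Integrable.of_bound hα.aestronglyMeasurable K (ae_of_all _ hK)
  have key : ∀ᵐ x ∂arcLength, l ≤ ∫ y, α y * f y ∂arcLength -
      ∫ y, α y * (γ * (Real.log 2 - Real.log ‖x - y‖)) ∂arcLength + Real.log (circleConst γ) := by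
    filter_upwards [ae_arcLength_norm] with x hx
    have hr := integral_circle_rpow_le h0.le hγ hx
    refine gibbs (W := fun y => 2 ^ γ * ‖x - y‖ ^ (-γ)) (circleConst_pos γ) hα0 hαi hα1 h hf ?_
      (hr.1.const_mul _) (fun y => by positivity) ?_ ?_
    · refine Integrable.bdd_mul (c := K) ?_ hα.aestronglyMeasurable (ae_of_all _ hK)
      exact ((integrable_const _).sub (integrable_log_circle hx)).const_mul γ
    · filter_upwards [(countable_singleton x).ae_notMem arcLength] with y hy _
      have hp : 0 < ‖x - y‖ := norm_pos_iff.2 (sub_ne_zero.2 fun h => hy (by simp [h]))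
      rw [mul_sub, sub_eq_add_neg, Real.exp_add, Real.rpow_def_of_pos two_pos,
        Real.rpow_def_of_pos hp, mul_comm γ, mul_neg, mul_comm γ]
    · rw [integral_const_mul, circleConst]
      have : (2 : ℝ) ^ γ * ∫ y, ‖x - y‖ ^ (-γ) ∂arcLength ≤ 2 ^ γ * circleRiesz γ := by
        gcongr; exact hr.2
      linarith
  have ip := integrable_prod_logEnergy hα hK hα hK
  have h1 : ∫ x, α x * l ∂arcLength ≤ ∫ x, ((∫ y, α y * f y ∂arcLength) * α x -
      γ * (∫ y, α x * α y * (Real.log 2 - Real.log ‖x - y‖) ∂arcLength) +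
      Real.log (circleConst γ) * α x) ∂arcLength := by
    refine integral_mono_ae (hαi.mul_const l)
      (((hαi.const_mul _).sub (ip.integral_prod_left.const_mul γ)).add (hαi.const_mul _)) ?_
    filter_upwards [key] with x hx
    refine (mul_le_mul_of_nonneg_left hx (hα0 x)).trans (le_of_eq ?_)
    have e : ∫ y, α x * α y * (Real.log 2 - Real.log ‖x - y‖) ∂arcLength =
        α x * ∫ y, α y * (Real.log 2 - Real.log ‖x - y‖) ∂arcLength := by
      rw [← integral_const_mul]; congr 1; ext y; ring
    have e2 : ∫ y, α y * (γ * (Real.log 2 - Real.log ‖x - y‖)) ∂arcLength =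
        γ * ∫ y, α y * (Real.log 2 - Real.log ‖x - y‖) ∂arcLength := by
      rw [← integral_const_mul]; congr 1; ext y; ring
    rw [e, e2]; ring
  have i1 : Integrable (fun x => (∫ y, α y * f y ∂arcLength) * α x -
      γ * (∫ y, α x * α y * (Real.log 2 - Real.log ‖x - y‖) ∂arcLength)) arcLength :=
    (hαi.const_mul _).sub (ip.integral_prod_left.const_mul γ)
  rw [integral_mul_const, hα1, one_mul, integral_add i1 (hαi.const_mul _),
    integral_sub (hαi.const_mul _) (ip.integral_prod_left.const_mul γ), integral_const_mul,
    integral_const_mul, integral_const_mul, hα1, mul_one, mul_one] at h1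
  exact h1

/-- The Gibbs density `e^f / ∫_S e^f` on the part of the circle in `S`. -/
def gibbsDensity (f : ℂ → ℝ) (S : Set ℂ) (y : ℂ) : ℝ :=
  (S ∩ Metric.sphere 0 1).indicator
    (fun y => Real.exp (f y - Real.log (∫ z in S, Real.exp (f z) ∂arcLength))) y

section GibbsDensity

variable {f : ℂ → ℝ} (hf : Continuous f) {S : Set ℂ} (hS : MeasurableSet S)
include hf hS

lemma measurable_gibbsDensity : Measurable (gibbsDensity f S) :=
  (by fun_prop : Measurable fun y => Real.exp (f y - Real.log (∫ z in S, Real.exp (f z) ∂arcLength))).indicator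
    (hS.inter Metric.isClosed_sphere.measurableSet)

omit hS in
lemma gibbsDensity_bound : ∃ K, ∀ y, |gibbsDensity f S y| ≤ K := by
  have : Continuous fun y => Real.exp (f y - Real.log (∫ z in S, Real.exp (f z) ∂arcLength)) := by
    fun_prop
  obtain ⟨K, hK⟩ := (isCompact_sphere (0 : ℂ) 1).exists_bound_of_continuousOn this.continuousOn
  refine ⟨max K 0, fun y => ?_⟩
  unfold gibbsDensity
  by_cases hy : y ∈ S ∩ Metric.sphere 0 1
  · rw [indicator_of_mem hy]
    exact (hK y hy.2).trans (le_max_left _ _)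
  · rw [indicator_of_notMem hy]; simp

omit hf hS in
lemma gibbsDensity_nonneg (y : ℂ) : 0 ≤ gibbsDensity f S y :=
  indicator_nonneg (fun _ _ => (Real.exp_pos _).le) _

omit hf in
lemma integral_gibbsDensity (hZ : 0 < ∫ z in S, Real.exp (f z) ∂arcLength) :
    ∫ y, gibbsDensity f S y ∂arcLength = 1 := by
  have h1 : ∫ y, gibbsDensity f S y ∂arcLength =
      ∫ y, S.indicator (fun y => (∫ z in S, Real.exp (f z) ∂arcLength)⁻¹ * Real.exp (f y)) y ∂arcLength := by
    refine integral_congr_ae ?_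
    filter_upwards [ae_arcLength_norm] with y hy
    have hy' : y ∈ Metric.sphere (0 : ℂ) 1 := by simpa using hy
    unfold gibbsDensity
    by_cases hyS : y ∈ S
    · have hm : y ∈ S ∩ Metric.sphere 0 1 := ⟨hyS, hy'⟩
      rw [indicator_of_mem hm, indicator_of_mem hyS, Real.exp_sub, Real.exp_log hZ]
      ring
    · rw [indicator_of_notMem (fun h => hyS h.1), indicator_of_notMem hyS]
  rw [h1, integral_indicator hS, integral_const_mul, inv_mul_cancel₀ hZ.ne']

omit hf hS in
lemma gibbsDensity_eq (y : ℂ) : gibbsDensity f S y = 0 ∨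
    gibbsDensity f S y = Real.exp (f y - Real.log (∫ z in S, Real.exp (f z) ∂arcLength)) := by
  unfold gibbsDensity
  by_cases hy : y ∈ S ∩ Metric.sphere 0 1
  · right; rw [indicator_of_mem hy]
  · left; rw [indicator_of_notMem hy]

lemma integrable_gibbsDensity_mul {g : ℂ → ℝ} (hg : Integrable g arcLength) :
    Integrable (fun y => gibbsDensity f S y * g y) arcLength := by
  obtain ⟨K, hK⟩ := gibbsDensity_bound hf (S := S)
  exact hg.bdd_mul (measurable_gibbsDensity hf hS).aestronglyMeasurable (ae_of_all _ hK)

lemma log_le_sub_logEnergy {γ : ℝ} (h0 : 0 < γ) (hγ : γ < 1)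
    (hZ : 0 < ∫ z in S, Real.exp (f z) ∂arcLength) :
    Real.log (∫ z in S, Real.exp (f z) ∂arcLength) ≤
      ∫ y, gibbsDensity f S y * f y ∂arcLength - γ * logEnergy (gibbsDensity f S) +
        Real.log (circleConst γ) := by
  obtain ⟨K, hK⟩ := gibbsDensity_bound hf (S := S)
  exact le_sub_logEnergy h0 hγ (measurable_gibbsDensity hf hS) hK gibbsDensity_nonneg
    (integral_gibbsDensity hS hZ) (ae_of_all _ gibbsDensity_eq)
    (integrable_gibbsDensity_mul hf hS (integrable_arcLength hf.continuousOn))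

end GibbsDensity

lemma integral_exp_arcLength_pos {f : ℂ → ℝ} (hf : Continuous f) :
    0 < ∫ z, Real.exp (f z) ∂arcLength := by
  have : arcLength ≠ 0 := fun h => by
    have := integral_one_arcLength
    rw [h] at this
    simp [Real.pi_ne_zero] at this
  have : NeZero arcLength := ⟨this⟩
  exact integral_exp_pos (integrable_arcLength (by fun_prop))

/-- The almost sharp Lebedev-Milin inequality. -/
theorem integral_exp_boundary_le {γ : ℝ} (h0 : 0 < γ) (hγ : γ < 1) {u : ℂ → ℝ}
    (hu : ContDiff ℝ ∞ u) {p : ℝ} (hp : 0 < p) :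
    ∫ z, Real.exp (p * u z) ∂arcLength ≤ Real.exp (p * cmean u +
      p ^ 2 / (4 * Real.pi * γ) * harmonicEnergy u + Real.log (circleConst γ)) := by
  obtain ⟨L, hL⟩ := hu.exists_lipDisc
  have hc : Continuous fun z => p * u z := by have := hu.continuous; fun_prop
  have hpi := Real.pi_pos
  have hZ := integral_exp_arcLength_pos hc
  rw [← Real.log_le_iff_le_exp hZ]
  have hZ' : 0 < ∫ z in univ, Real.exp (p * u z) ∂arcLength := by simpa using hZ
  have h1 := log_le_sub_logEnergy hc MeasurableSet.univ h0 hγ hZ'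
  obtain ⟨K, hK⟩ := gibbsDensity_bound hc (S := univ)
  -- With c = p/(4πγ), p times the duality bound contains exactly γ times the logarithmic energy,
  -- which cancels against `log_le_sub_logEnergy`.
  have h2 := hL.integral_boundary_le (measurable_gibbsDensity hc MeasurableSet.univ) hK
    gibbsDensity_nonneg (integral_gibbsDensity MeasurableSet.univ hZ')
    (c := p / (4 * Real.pi * γ)) (by positivity)
  rw [Measure.restrict_univ] at h1
  set α := gibbsDensity (fun z => p * u z) univ
  have e1 : ∫ y, α y * (p * u y) ∂arcLength = p * ∫ y, α y * u y ∂arcLength := by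
    rw [← integral_const_mul]; congr 1; ext y; ring
  rw [e1] at h1
  have e2 : p * ((4 * Real.pi * (p / (4 * Real.pi * γ)))⁻¹ * logEnergy α) = γ * logEnergy α := by
    field_simp
  have e3 : p * (p / (4 * Real.pi * γ) * harmonicEnergy u) =
    p ^ 2 / (4 * Real.pi * γ) * harmonicEnergy u := by ring
  nlinarith [mul_le_mul_of_nonneg_left h2 hp.le]

/-- The improved inequality for two separated pieces of the circle. -/
theorem integral_exp_mul_integral_exp_le {γ : ℝ} (h0 : 0 < γ) (hγ : γ < 1) {s : ℝ} (hs : 0 < s)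
    {u : ℂ → ℝ} (hu : ContDiff ℝ ∞ u) {S₁ S₂ : Set ℂ} (hS₁ : MeasurableSet S₁)
    (hS₂ : MeasurableSet S₂) (hsep : ∀ x ∈ S₁, ∀ y ∈ S₂, s ≤ ‖x - y‖) :
    (∫ z in S₁, Real.exp (u z) ∂arcLength) * (∫ z in S₂, Real.exp (u z) ∂arcLength) ≤
      Real.exp (2 * cmean u + 1 / (4 * Real.pi * γ) * harmonicEnergy u +
        2 * (γ * Real.log (2 / s) + Real.log (circleConst γ))) := by
  obtain ⟨L, hL⟩ := hu.exists_lipDisc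
  have hc := hu.continuous
  have hpi := Real.pi_pos
  have hn : ∀ S : Set ℂ, 0 ≤ ∫ z in S, Real.exp (u z) ∂arcLength := fun S =>
    integral_nonneg fun _ => (Real.exp_pos _).le
  rcases (hn S₁).eq_or_lt with hZ₁ | hZ₁
  · rw [← hZ₁, zero_mul]; positivity
  rcases (hn S₂).eq_or_lt with hZ₂ | hZ₂
  · rw [← hZ₂, mul_zero]; positivity
  rw [← Real.log_le_iff_le_exp (mul_pos hZ₁ hZ₂), Real.log_mul hZ₁.ne' hZ₂.ne']
  have h1 := log_le_sub_logEnergy hc hS₁ h0 hγ hZ₁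
  have h2 := log_le_sub_logEnergy hc hS₂ h0 hγ hZ₂
  obtain ⟨K₁, hK₁⟩ := gibbsDensity_bound hc (S := S₁)
  obtain ⟨K₂, hK₂⟩ := gibbsDensity_bound hc (S := S₂)
  have m1 := measurable_gibbsDensity hc hS₁
  have m2 := measurable_gibbsDensity hc hS₂
  have t1 := integral_gibbsDensity hS₁ hZ₁
  have t2 := integral_gibbsDensity hS₂ hZ₂
  have n1 := gibbsDensity_nonneg (f := u) (S := S₁)
  have n2 := gibbsDensity_nonneg (f := u) (S := S₂)
  have iu := integrable_arcLength hc.continuousOn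
  have j1 := integrable_gibbsDensity_mul hc hS₁ iu
  have j2 := integrable_gibbsDensity_mul hc hS₂ iu
  set α := gibbsDensity u S₁ with hα
  set β := gibbsDensity u S₂ with hβ
  have i1 : Integrable α arcLength := Integrable.of_bound m1.aestronglyMeasurable K₁ (ae_of_all _ hK₁)
  have i2 : Integrable β arcLength := Integrable.of_bound m2.aestronglyMeasurable K₂ (ae_of_all _ hK₂)
  -- The logarithmic energy of the average is a quarter of the two self-energies plus bounded cross
  -- terms. Twice this estimate cancels both self-energies already with c = 1/(8πγ), half of what
  -- one density alone requires.
  have h3 := hL.integral_boundary_le (α := fun y => (1 / 2) * (α y + β y)) ((m1.add m2).const_mul _)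
    (K := (1 / 2) * (K₁ + K₂)) (fun x => by
      rw [abs_mul, abs_of_pos (by norm_num : (0 : ℝ) < 1 / 2)]
      gcongr
      exact (abs_add_le _ _).trans (add_le_add (hK₁ x) (hK₂ x)))
    (fun x => mul_nonneg (by norm_num) (add_nonneg (n1 x) (n2 x)))
    (by rw [integral_const_mul, integral_add i1 i2, t1, t2]; norm_num)
    (c := 1 / (8 * Real.pi * γ)) (by positivity)
  have e1 : ∫ x, 1 / 2 * (α x + β x) * u x ∂arcLength =
      1 / 2 * (∫ y, α y * u y ∂arcLength + ∫ y, β y * u y ∂arcLength) := by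
    rw [← integral_add j1 j2, ← integral_const_mul]; congr 1; ext y; ring
  have p11 := integrable_prod_logEnergy m1 hK₁ m1 hK₁
  have p12 := integrable_prod_logEnergy m1 hK₁ m2 hK₂
  have p21 := integrable_prod_logEnergy m2 hK₂ m1 hK₁
  have p22 := integrable_prod_logEnergy m2 hK₂ m2 hK₂
  -- On separated supports the logarithmic kernel is at most log(2/s), and both densities have mass
  -- 1.
  have cross : ∀ {S S' : Set ℂ} {M M' : ℝ}, MeasurableSet S → MeasurableSet S' →
      (∀ x ∈ S, ∀ y ∈ S', s ≤ ‖x - y‖) →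
      (∀ y, |gibbsDensity u S y| ≤ M) → (∀ y, |gibbsDensity u S' y| ≤ M') →
      0 < ∫ z in S, Real.exp (u z) ∂arcLength → 0 < ∫ z in S', Real.exp (u z) ∂arcLength →
      ∫ p, gibbsDensity u S p.1 * gibbsDensity u S' p.2 * (Real.log 2 - Real.log ‖p.1 - p.2‖)
        ∂(arcLength.prod arcLength) ≤ Real.log (2 / s) := by
    intro S S' M M' hS hS' hsep hM hM' hZ hZ'
    have i1 : Integrable (gibbsDensity u S) arcLength :=
      Integrable.of_bound (measurable_gibbsDensity hc hS).aestronglyMeasurable M (ae_of_all _ hM)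
    have i2 : Integrable (gibbsDensity u S') arcLength :=
      Integrable.of_bound (measurable_gibbsDensity hc hS').aestronglyMeasurable M' (ae_of_all _ hM')
    have ip := integrable_prod_logEnergy (measurable_gibbsDensity hc hS) hM
      (measurable_gibbsDensity hc hS') hM'
    have : ∫ p, gibbsDensity u S p.1 * gibbsDensity u S' p.2 * Real.log (2 / s)
        ∂(arcLength.prod arcLength) = Real.log (2 / s) := by
      rw [integral_mul_const, integral_prod_mul, integral_gibbsDensity hS hZ,
        integral_gibbsDensity hS' hZ', one_mul, one_mul]
    rw [← this]
    refine integral_mono ip ((i1.mul_prod i2).mul_const _) fun p => ?_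
    simp only
    by_cases hp1 : p.1 ∈ S
    · by_cases hp2 : p.2 ∈ S'
      · refine mul_le_mul_of_nonneg_left ?_
          (mul_nonneg (gibbsDensity_nonneg _) (gibbsDensity_nonneg _))
        rw [Real.log_div two_ne_zero hs.ne']
        have := Real.log_le_log hs (hsep _ hp1 _ hp2)
        linarith
      · have : gibbsDensity u S' p.2 = 0 := indicator_of_notMem (fun h => hp2 h.1) _
        simp [this]
    · have : gibbsDensity u S p.1 = 0 := indicator_of_notMem (fun h => hp1 h.1) _
      simp [this]
  have c12 := cross hS₁ hS₂ hsep hK₁ hK₂ hZ₁ hZ₂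
  have c21 := cross hS₂ hS₁ (fun x hx y hy => by rw [norm_sub_rev]; exact hsep y hy x hx) hK₂ hK₁ hZ₂ hZ₁
  have e2 : logEnergy (fun y => 1 / 2 * (α y + β y)) = 1 / 4 * (logEnergy α + logEnergy β +
      (∫ p, α p.1 * β p.2 * (Real.log 2 - Real.log ‖p.1 - p.2‖) ∂(arcLength.prod arcLength) +
       ∫ p, β p.1 * α p.2 * (Real.log 2 - Real.log ‖p.1 - p.2‖) ∂(arcLength.prod arcLength))) := by
    have q1 : logEnergy α = ∫ p, α p.1 * α p.2 * (Real.log 2 - Real.log ‖p.1 - p.2‖)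
        ∂(arcLength.prod arcLength) := (integral_prod _ p11).symm
    have q2 : logEnergy β = ∫ p, β p.1 * β p.2 * (Real.log 2 - Real.log ‖p.1 - p.2‖)
        ∂(arcLength.prod arcLength) := (integral_prod _ p22).symm
    have p0 : Integrable (fun p : ℂ × ℂ => (1 / 2 * (α p.1 + β p.1)) * (1 / 2 * (α p.2 + β p.2)) *
        (Real.log 2 - Real.log ‖p.1 - p.2‖)) (arcLength.prod arcLength) := by
      refine (((p11.add p22).add (p12.add p21)).const_mul (1 / 4)).congr (ae_of_all _ fun p => ?_)
      simp; ring
    have q3 : logEnergy (fun y => 1 / 2 * (α y + β y)) =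
        ∫ p, (1 / 2 * (α p.1 + β p.1)) * (1 / 2 * (α p.2 + β p.2)) *
        (Real.log 2 - Real.log ‖p.1 - p.2‖) ∂(arcLength.prod arcLength) := (integral_prod _ p0).symm
    have p33 : Integrable (fun p : ℂ × ℂ => α p.1 * α p.2 * (Real.log 2 - Real.log ‖p.1 - p.2‖) +
      β p.1 * β p.2 * (Real.log 2 - Real.log ‖p.1 - p.2‖)) (arcLength.prod arcLength) := p11.add p22
    have p34 : Integrable (fun p : ℂ × ℂ => α p.1 * β p.2 * (Real.log 2 - Real.log ‖p.1 - p.2‖) +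
      β p.1 * α p.2 * (Real.log 2 - Real.log ‖p.1 - p.2‖)) (arcLength.prod arcLength) := p12.add p21
    rw [q1, q2, q3, ← integral_add p11 p22, ← integral_add p12 p21, ← integral_add p33 p34,
      ← integral_const_mul]
    congr 1; ext p; ring
  rw [e1, e2] at h3
  have e3 : (4 * Real.pi * (1 / (8 * Real.pi * γ)))⁻¹ = 2 * γ := by field_simp; norm_num
  have e4 : 1 / (4 * Real.pi * γ) * harmonicEnergy u =
    2 * (1 / (8 * Real.pi * γ) * harmonicEnergy u) := by field_simp; ring
  rw [e3] at h3
  rw [e4]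
  nlinarith [mul_le_mul_of_nonneg_left (add_le_add c12 c21) h0.le]

/-! ### Poisson integrals and the exponential inequality in the interior. -/

lemma pker_nonneg {x : ℂ} (hx : ‖x‖ < 1) (y : ℂ) : 0 ≤ pker x y :=
  div_nonneg (by nlinarith [norm_nonneg x]) (by positivity)

lemma integrable_mul_pker {f : ℂ → ℝ} (hf : Integrable f arcLength) {x : ℂ} (hx : ‖x‖ < 1) :
    Integrable (fun y => f y * pker x y) arcLength := by
  obtain ⟨K, hK⟩ := (isCompact_sphere (0 : ℂ) 1).exists_bound_of_continuousOn (continuousOn_pker hx)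
  refine hf.mul_bdd (c := K) (aestronglyMeasurable_arcLength (continuousOn_pker hx)) ?_
  filter_upwards [ae_arcLength_norm] with y hy
  exact hK y (by simpa using hy)

/-- The Poisson kernel is nonnegative and its average over the circle is 1. With a supporting line
of a convex function at the Poisson average of f this becomes Jensen's inequality. -/
lemma affine_poisson_le {f g : ℂ → ℝ} (hf : Integrable f arcLength) (hg : Integrable g arcLength)
    {a b : ℝ} (h : ∀ᵐ z ∂arcLength, a * f z + b ≤ g z) {x : ℂ} (hx : ‖x‖ < 1) :
    a * poisson f x + b ≤ poisson g x := by
  have hpi := Real.pi_pos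
  have i1 := integrable_mul_pker hf hx
  have i2 := integrable_arcLength (continuousOn_pker hx)
  have h1 : ∫ y, (a * (f y * pker x y) + b * pker x y) ∂arcLength ≤ ∫ y, g y * pker x y ∂arcLength := by
    refine integral_mono_ae ((i1.const_mul a).add (i2.const_mul b)) (integrable_mul_pker hg hx) ?_
    filter_upwards [h] with y hy
    have := mul_le_mul_of_nonneg_right hy (pker_nonneg hx y)
    linarith
  rw [integral_add (i1.const_mul a) (i2.const_mul b), integral_const_mul, integral_const_mul,
    integral_pker hx] at h1
  unfold poisson
  have : a * ((2 * Real.pi)⁻¹ * ∫ y, f y * pker x y ∂arcLength) + b =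
    (2 * Real.pi)⁻¹ * (a * (∫ y, f y * pker x y ∂arcLength) + b * (2 * Real.pi)) := by
    field_simp
  rw [this]
  gcongr

lemma abs_poisson_le {f : ℂ → ℝ} (hf : Integrable f arcLength) {K : ℝ}
    (hK : ∀ᵐ z ∂arcLength, |f z| ≤ K) {x : ℂ} (hx : ‖x‖ < 1) : |poisson f x| ≤ K := by
  have h0 := integrable_zero ℂ ℝ arcLength
  have e0 : poisson 0 x = 0 := by simp [poisson]
  rw [abs_le]
  constructor
  · have := affine_poisson_le (f := 0) (a := 0) (b := -K) h0 hf (by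
      filter_upwards [hK] with z hz
      linarith [(abs_le.1 hz).1]) hx
    simpa using this
  · have h2 := affine_poisson_le (g := fun _ => K) (a := 1) (b := 0) hf (integrable_const K) (by
      filter_upwards [hK] with z hz
      linarith [(abs_le.1 hz).2]) hx
    have h3 : poisson (fun _ => K) x = K := by
      have := Real.pi_pos.ne'
      rw [poisson, integral_const_mul, integral_pker hx]; field_simp
    linarith

lemma aestronglyMeasurable_poisson {f : ℂ → ℝ} (hf : AEStronglyMeasurable f arcLength) (μ : Measure ℂ)
    [SFinite μ] : AEStronglyMeasurable (poisson f) μ := by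
  have h1 : AEStronglyMeasurable (fun p : ℂ × ℂ => f p.2 * pker p.1 p.2) (μ.prod arcLength) := by
    refine hf.comp_snd.mul ?_
    unfold pker
    exact (by fun_prop : Measurable _).aestronglyMeasurable
  exact h1.integral_prod_right'.const_mul _

lemma ell_le {x y : ℂ} (hx : ‖x‖ < 1) (hy : ‖y‖ ≤ 1) (hxy : y ≠ x) : ell x y ≤ 2 * ‖y - x‖⁻¹ := by
  have h0 : 0 < ‖y - x‖ := norm_pos_iff.2 (sub_ne_zero.2 hxy)
  have h1 : 0 < ‖1 - (starRingEnd ℂ) x * y‖ := norm_pos_iff.2 (one_sub_conj_mul_ne hx hy)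
  have h2 : ‖1 - (starRingEnd ℂ) x * y‖ ≤ 2 := by
    refine (norm_sub_le _ _).trans ?_
    rw [norm_mul, RCLike.norm_conj, norm_one]
    nlinarith [norm_nonneg x, norm_nonneg y]
  rw [ell, ← Real.log_div h1.ne' h0.ne']
  refine (Real.log_le_sub_one_of_pos (by positivity)).trans ?_
  rw [div_eq_mul_inv]
  have : ‖1 - (starRingEnd ℂ) x * y‖ * ‖y - x‖⁻¹ ≤ 2 * ‖y - x‖⁻¹ := by gcongr
  linarith

lemma measurable_ell : Measurable (Function.uncurry ell) := by
  unfold ell Function.uncurry; fun_prop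

lemma integrableOn_ell {x : ℂ} (hx : ‖x‖ < 1) : IntegrableOn (ell x) disc := by
  refine Integrable.mono' ((integrableOn_inv_norm_sub x).const_mul 2)
    (measurable_ell.comp (by fun_prop : Measurable fun y : ℂ => (x, y))).aestronglyMeasurable ?_
  filter_upwards [ae_restrict_mem measurableSet_disc,
    ae_restrict_of_ae ((countable_singleton x).ae_notMem volume)] with y hy hxy
  have hy := (mem_disc.1 hy).le
  rw [Real.norm_of_nonneg (ell_nonneg hx.le hy hxy)]
  exact ell_le hx hy hxy

lemma integrable_prod_ell : Integrable (fun p : ℂ × ℂ => ell p.1 p.2)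
    ((volume.restrict disc).prod (volume.restrict disc)) := by
  have hm : AEStronglyMeasurable (fun p : ℂ × ℂ => ell p.1 p.2)
    ((volume.restrict disc).prod (volume.restrict disc)) := measurable_ell.aestronglyMeasurable
  rw [integrable_prod_iff hm]
  refine ⟨(ae_restrict_mem measurableSet_disc).mono fun x hx => integrableOn_ell (mem_disc.1 hx),
    Integrable.of_bound (C := 2 * ∫ x in Metric.ball (0 : ℂ) 2, ‖x‖ ^ (-1 : ℝ))
      hm.norm.integral_prod_right' ?_⟩
  filter_upwards [ae_restrict_mem measurableSet_disc] with x hx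
  have hx1 := mem_disc.1 hx
  rw [Real.norm_of_nonneg (integral_nonneg fun _ => norm_nonneg _)]
  have h1 := setIntegral_norm_sub_rpow_le (κ := 1) (by norm_num) hx1.le
  have h2 : ∫ y in disc, ‖ell x y‖ ≤ ∫ y in disc, 2 * ‖y - x‖⁻¹ := by
    refine integral_mono_ae (integrableOn_ell hx1).norm
      ((integrableOn_inv_norm_sub x).const_mul 2) ?_
    filter_upwards [ae_restrict_mem measurableSet_disc,
      ae_restrict_of_ae ((countable_singleton x).ae_notMem volume)] with y hy hxy
    have hy := (mem_disc.1 hy).le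
    rw [Real.norm_of_nonneg (ell_nonneg hx1.le hy hxy)]
    exact ell_le hx1 hy hxy
  rw [integral_const_mul] at h2
  simp only [Real.rpow_neg_one, norm_sub_rev x] at h1 ⊢
  linarith [mul_le_mul_of_nonneg_left h1 zero_le_two]

/-- A bound of the exponential integral over a part of the disc, from the duality bound for the
non-harmonic part. -/
theorem integral_exp_disc_le_of_kernel {u : ℂ → ℝ} (hu : ContDiff ℝ ∞ u) {Ω : Set ℂ}
    (hΩ : MeasurableSet Ω) (hsub : Ω ⊆ disc) {κ : ℝ} (hκ : 0 < κ) {R : ℝ} (hR : 0 < R)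
    {W : ℂ → ℂ → ℝ} (hW : ∀ x ∈ disc, IntegrableOn (W x) disc) (hW0 : ∀ x y, 0 ≤ W x y)
    (hkW : ∀ x ∈ disc, ∀ y ∈ Ω, y ≠ x → Real.exp (κ * ell x y + 2 * poisson u y) ≤ W x y)
    (hWR : ∀ x ∈ disc, ∫ y in disc, W x y ≤ R) :
    ∫ z in Ω, Real.exp (2 * u z) ≤
      Real.exp ((2 * Real.pi * κ)⁻¹ * (energy u - harmonicEnergy u)) * R := by
  obtain ⟨L, hL⟩ := hu.exists_lipDisc
  have hc : Continuous u := hu.continuous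
  have hpi := Real.pi_pos
  set D := ∫ z in Ω, Real.exp (2 * u z) with hD
  have hD0 : 0 ≤ D := integral_nonneg fun _ => (Real.exp_pos _).le
  rcases hD0.eq_or_lt with h0 | h0
  · rw [← h0]; positivity
  set ν := volume.restrict disc with hν
  set α : ℂ → ℝ := Ω.indicator (fun y => Real.exp (2 * u y - Real.log D)) with hα
  have hαm : Measurable α := (by fun_prop : Measurable fun y =>
    Real.exp (2 * u y - Real.log D)).indicator hΩ
  have hα0 : ∀ y, 0 ≤ α y := fun y => indicator_nonneg (fun _ _ => (Real.exp_pos _).le) _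
  obtain ⟨K, hK⟩ : ∃ K, ∀ y, |α y| ≤ K := by
    have : Continuous fun y => Real.exp (2 * u y - Real.log D) := by fun_prop
    obtain ⟨K, hK⟩ := (isCompact_closedBall (0 : ℂ) 1).exists_bound_of_continuousOn this.continuousOn
    refine ⟨max K 0, fun y => ?_⟩
    by_cases hy : y ∈ Ω
    · rw [hα, indicator_of_mem hy]
      exact (hK y (by simpa using (mem_disc.1 (hsub hy)).le)).trans (le_max_left _ _)
    · rw [hα, indicator_of_notMem hy]; simp
  have hαi : Integrable α ν := Integrable.of_bound hαm.aestronglyMeasurable K (ae_of_all _ hK)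
  have hα1 : ∫ y, α y ∂ν = 1 := by
    rw [hα, integral_indicator hΩ, hν, Measure.restrict_restrict hΩ, inter_eq_left.2 hsub]
    have : ∀ y, Real.exp (2 * u y - Real.log D) = D⁻¹ * Real.exp (2 * u y) := fun y => by
      rw [Real.exp_sub, Real.exp_log h0]; ring
    simp_rw [this]
    rw [integral_const_mul, ← hD, inv_mul_cancel₀ h0.ne']
  have hui : Integrable u ν := by
    obtain ⟨B, hB⟩ := (isCompact_closedBall (0 : ℂ) 1).exists_bound_of_continuousOn hc.continuousOn
    refine Integrable.of_bound hc.aestronglyMeasurable B ?_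
    filter_upwards [ae_restrict_mem measurableSet_disc] with y hy
    exact hB y (by simpa using (mem_disc.1 hy).le)
  have hpi' : Integrable (poisson u) ν := by
    obtain ⟨B, hB⟩ := (isCompact_sphere (0 : ℂ) 1).exists_bound_of_continuousOn hc.continuousOn
    refine Integrable.of_bound (aestronglyMeasurable_poisson hc.aestronglyMeasurable _) B ?_
    filter_upwards [ae_restrict_mem measurableSet_disc] with y hy
    refine abs_poisson_le (integrable_arcLength hc.continuousOn) ?_ (mem_disc.1 hy)
    filter_upwards [ae_arcLength_norm] with z hz
    exact hB z (by simpa using hz)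
  have mulα : ∀ {g : ℂ → ℝ}, Integrable g ν → Integrable (fun y => α y * g y) ν := fun hg =>
    hg.bdd_mul hαm.aestronglyMeasurable (ae_of_all _ hK)
  set I := ∫ x in disc, α x * (u x - poisson u x) with hI
  -- The Poisson integral is put into the potential k together with the Green function, so that only
  -- u - Pu remains in the linear functional.
  have key : ∀ᵐ x ∂ν, Real.log D ≤ 2 * I - κ * (∫ y in disc, α y * ell x y) + Real.log R := by
    filter_upwards [ae_restrict_mem measurableSet_disc] with x hx
    have hx1 := mem_disc.1 hx
    have he := (mulα (integrableOn_ell hx1)).const_mul κ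
    have hp := (mulα hpi').const_mul 2
    have hu2 := (mulα hui).const_mul 2
    have h1 := gibbs (ν := ν) (f := fun y => 2 * u y) (k := fun y => κ * ell x y + 2 * poisson u y)
      (W := W x) (l := Real.log D) hR hα0 hαi hα1 (ae_of_all _ fun y => by
        by_cases hy : y ∈ Ω
        · right; rw [hα, indicator_of_mem hy]
        · left; rw [hα, indicator_of_notMem hy]) (hu2.congr (ae_of_all _ fun y => by simp; ring))
      ((he.add hp).congr (ae_of_all _ fun y => by simp; ring)) (hW x hx) (hW0 x) (by
        filter_upwards [ae_restrict_of_ae ((countable_singleton x).ae_notMem volume)] with y hxy hy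
        have hyΩ : y ∈ Ω := by
          by_contra h
          exact hy (by rw [hα, indicator_of_notMem h])
        exact hkW x hx y hyΩ hxy) (hWR x hx)
    refine h1.trans (le_of_eq ?_)
    have e1 : ∫ y, α y * (2 * u y) ∂ν = 2 * ∫ y, α y * u y ∂ν := by
      rw [← integral_const_mul]; congr 1; ext y; ring
    have e2 : ∫ y, α y * (κ * ell x y + 2 * poisson u y) ∂ν =
        κ * (∫ y, α y * ell x y ∂ν) + 2 * ∫ y, α y * poisson u y ∂ν := by
      rw [← integral_const_mul, ← integral_const_mul, ← integral_add he hp]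
      congr 1; ext y; ring
    have e3 : I = ∫ y, α y * u y ∂ν - ∫ y, α y * poisson u y ∂ν := by
      rw [hI, ← integral_sub (mulα hui) (mulα hpi')]; congr 1; ext y; ring
    rw [e1, e2, e3]; ring
  have i1 : Integrable (fun x => ∫ y in disc, α x * α y * ell x y) ν := by
    have h2 : Integrable (fun p : ℂ × ℂ => α p.1 * α p.2 * ell p.1 p.2) (ν.prod ν) :=
      integrable_prod_ell.bdd_mul (c := K * K)
        ((hαm.comp measurable_fst).mul (hαm.comp measurable_snd)).aestronglyMeasurable
        (ae_of_all _ fun p => by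
          rw [norm_mul]
          exact mul_le_mul (hK _) (hK _) (norm_nonneg _) ((abs_nonneg _).trans (hK 0)))
    exact h2.integral_prod_left
  have h1 : ∫ x, α x * Real.log D ∂ν ≤ ∫ x, (2 * I * α x -
      κ * (∫ y in disc, α x * α y * ell x y) + Real.log R * α x) ∂ν := by
    refine integral_mono_ae (hαi.mul_const _)
      (((hαi.const_mul _).sub (i1.const_mul κ)).add (hαi.const_mul _)) ?_
    filter_upwards [key] with x hx
    refine (mul_le_mul_of_nonneg_left hx (hα0 x)).trans (le_of_eq ?_)
    have e : ∫ y in disc, α x * α y * ell x y = α x * ∫ y in disc, α y * ell x y := by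
      rw [← integral_const_mul]; congr 1; ext y; ring
    rw [e]; ring
  have i2 : Integrable (fun x => 2 * I * α x - κ * (∫ y in disc, α x * α y * ell x y)) ν :=
    (hαi.const_mul _).sub (i1.const_mul κ)
  rw [integral_mul_const, hα1, one_mul, integral_add i2 (hαi.const_mul _),
    integral_sub (hαi.const_mul _) (i1.const_mul κ), integral_const_mul,
    integral_const_mul, integral_const_mul, hα1, mul_one, mul_one] at h1
  -- This c makes twice the duality bound contain exactly κ times the Green energy of α, which
  -- cancels.
  have h2 := hL.integral_sub_poisson_le hαm hK (c := (4 * Real.pi * κ)⁻¹) (by positivity)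
  have e1 : (8 * Real.pi * (4 * Real.pi * κ)⁻¹)⁻¹ = κ / 2 := by field_simp; norm_num
  have e2 : (2 * Real.pi * κ)⁻¹ = 2 * (4 * Real.pi * κ)⁻¹ := by field_simp; norm_num
  rw [e1] at h2
  rw [← Real.exp_log hR, ← Real.exp_add, ← Real.log_le_iff_le_exp h0, e2]
  have h3 : I = ∫ x in disc, α x * (u x - poisson u x) := hI
  rw [← h3] at h2
  linarith

/-- A uniform bound of the Riesz potentials of order `β` of the disc. -/
def discRiesz (β : ℝ) : ℝ := ∫ x in Metric.ball (0 : ℂ) 2, ‖x‖ ^ (-β)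

lemma discRiesz_nonneg (β : ℝ) : 0 ≤ discRiesz β := integral_nonneg fun _ => by positivity

lemma setIntegral_norm_sub_rpow_le' {β : ℝ} (hβ : β < 2) {x : ℂ} (hx : ‖x‖ ≤ 1) :
    ∫ y in disc, ‖y - x‖ ^ (-β) ≤ discRiesz β := by
  have := setIntegral_norm_sub_rpow_le hβ hx
  simp only [norm_sub_rev x] at this
  exact this

lemma integrable_prod_circle_disc {β : ℝ} (hβ : β < 2) :
    Integrable (fun p : ℂ × ℂ => ‖p.2 - p.1‖ ^ (-β)) (arcLength.prod (volume.restrict disc)) := by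
  have hm : Measurable fun p : ℂ × ℂ => ‖p.2 - p.1‖ ^ (-β) := by fun_prop
  rw [integrable_prod_iff hm.aestronglyMeasurable]
  refine ⟨ae_of_all _ fun x => integrableOn_norm_sub_rpow hβ x,
    Integrable.of_bound (C := discRiesz β) hm.aestronglyMeasurable.norm.integral_prod_right' ?_⟩
  filter_upwards [ae_arcLength_norm] with x hx
  rw [Real.norm_of_nonneg (integral_nonneg fun _ => norm_nonneg _)]
  simp_rw [fun y : ℂ => Real.norm_of_nonneg (Real.rpow_nonneg (norm_nonneg (y - x)) (-β))]
  exact setIntegral_norm_sub_rpow_le' hβ hx.le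

/-- The Riesz potential of a density on the circle. -/
def circlePotential (β : ℝ) (φ : ℂ → ℝ) (y : ℂ) : ℝ := ∫ ζ, φ ζ * ‖y - ζ‖ ^ (-β) ∂arcLength

lemma circlePotential_integral {β : ℝ} (hβ : β < 2) {φ : ℂ → ℝ} (hφ : Measurable φ) {K : ℝ}
    (hK : ∀ᵐ z ∂arcLength, |φ z| ≤ K) (hφ0 : ∀ z, 0 ≤ φ z) :
    IntegrableOn (circlePotential β φ) disc ∧
      ∫ y in disc, circlePotential β φ y ≤ (∫ z, φ z ∂arcLength) * discRiesz β := by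
  have hi : Integrable (fun p : ℂ × ℂ => φ p.1 * ‖p.2 - p.1‖ ^ (-β))
      (arcLength.prod (volume.restrict disc)) :=
    (integrable_prod_circle_disc hβ).bdd_mul (c := K) (hφ.comp measurable_fst).aestronglyMeasurable
      (Measure.quasiMeasurePreserving_fst.ae hK)
  refine ⟨hi.integral_prod_right, ?_⟩
  unfold circlePotential
  rw [← integral_integral_swap hi, ← integral_mul_const]
  refine integral_mono_ae hi.integral_prod_left ((Integrable.of_bound hφ.aestronglyMeasurable K hK).mul_const _) ?_
  filter_upwards [ae_arcLength_norm] with z hz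
  rw [integral_const_mul]
  exact mul_le_mul_of_nonneg_left (setIntegral_norm_sub_rpow_le' hβ hz.le) (hφ0 z)

/-- This and the following lemmas are supporting lines of convex functions, written in the affine
form that Jensen's inequality consumes. -/
lemma tangent_exp (t₀ t : ℝ) : Real.exp t₀ * t + Real.exp t₀ * (1 - t₀) ≤ Real.exp t := by
  have h := mul_le_mul_of_nonneg_left (Real.add_one_le_exp (t - t₀)) (Real.exp_pos t₀).le
  rw [← Real.exp_add] at h
  have e : t₀ + (t - t₀) = t := by ring
  rw [e] at h
  linarith

lemma tangent_sq (a t : ℝ) : 2 * a * t - a ^ 2 ≤ t ^ 2 := by nlinarith [sq_nonneg (t - a)]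

lemma tangent_pow_eight (a t : ℝ) : 8 * a ^ 7 * t + -7 * a ^ 8 ≤ t ^ 8 := by
  have h1 := tangent_sq a t
  have h2 := tangent_sq (a ^ 2) (t ^ 2)
  have h3 := tangent_sq (a ^ 4) (t ^ 4)
  have h4 := mul_le_mul_of_nonneg_left h1 (by positivity : 0 ≤ 2 * a ^ 2)
  have h5 : 2 * a ^ 2 * (2 * a * t - a ^ 2) - a ^ 4 ≤ t ^ 4 := by nlinarith
  have h6 := mul_le_mul_of_nonneg_left h5 (by positivity : 0 ≤ 2 * a ^ 4)
  nlinarith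

lemma tangent_pow_sixteen (a t : ℝ) : 16 * a ^ 15 * t + -15 * a ^ 16 ≤ t ^ 16 := by
  have h1 := tangent_pow_eight a t
  have h3 := tangent_sq (a ^ 8) (t ^ 8)
  have h6 := mul_le_mul_of_nonneg_left h1 (by positivity : 0 ≤ 2 * a ^ 8)
  nlinarith

lemma tangent_rpow {p : ℝ} (hp : 1 < p) {a t : ℝ} (ha : 0 ≤ a) (ht : 0 ≤ t) :
    p * a ^ (p - 1) * t + (1 - p) * a ^ p ≤ t ^ p := by
  rcases ha.eq_or_lt with rfl | ha
  · rw [Real.zero_rpow (by linarith), Real.zero_rpow (by linarith)]; simp; positivity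
  · have h := one_add_mul_self_le_rpow_one_add (s := t / a - 1) (by
      have : 0 ≤ t / a := by positivity
      linarith) hp.le
    have h2 := mul_le_mul_of_nonneg_left h (Real.rpow_nonneg ha.le p)
    rw [add_sub_cancel, ← Real.mul_rpow ha.le (by positivity), mul_div_cancel₀ _ ha.ne'] at h2
    refine le_trans (le_of_eq ?_) h2
    rw [Real.rpow_sub_one ha.ne']
    field_simp
    ring

section Majorant

variable {u : ℂ → ℝ} (hu : Continuous u) {S : Set ℂ} (hS : MeasurableSet S)
include hu

lemma integrable_indicator_exp (hS : MeasurableSet S) (p : ℝ) :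
    Integrable (S.indicator fun z => Real.exp (p * u z)) arcLength :=
  (integrable_arcLength (by fun_prop)).indicator hS

/-- Jensen is applied to e^{u/8} first, the boundary is then split into S and its complement, and
the eighth power is restored by Jensen on S only. Off S the Poisson kernel is at most s⁻², so the
far boundary enters only through the mass of e^{u/8}, which costs very little energy. -/
lemma exp_poisson_le (hS : MeasurableSet S) {s : ℝ} (hs : 0 < s) {y : ℂ} (hy : y ∈ disc)
    (hsep : ∀ z, ‖z‖ = 1 → z ∉ S → s ≤ ‖z - y‖) :
    Real.exp (poisson u y) ≤ 2 ^ 7 * (poisson (S.indicator fun z => Real.exp (1 * u z)) y +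
      (s⁻¹ ^ 2) ^ 8 * (∫ z, Real.exp (1 / 8 * u z) ∂arcLength) ^ 8) := by
  have hy1 := mem_disc.1 hy
  have hpi := Real.pi_pos
  set F : ℂ → ℝ := fun z => Real.exp (1 / 8 * u z) with hF
  have iF : Integrable F arcLength := integrable_arcLength (by fun_prop)
  have h1 : Real.exp (poisson u y) = Real.exp (1 / 8 * poisson u y) ^ 8 := by
    rw [← Real.exp_nat_mul]; congr 1; push_cast; ring
  have h2 : Real.exp (1 / 8 * poisson u y) ≤ poisson F y := by
    set t := 1 / 8 * poisson u y
    have := affine_poisson_le (a := Real.exp t * (1 / 8)) (b := Real.exp t * (1 - t))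
      (integrable_arcLength hu.continuousOn) iF (ae_of_all _ fun z => by
        have := tangent_exp t (1 / 8 * u z); simp only [hF]; linarith) hy1
    have e : Real.exp t * (1 / 8) * poisson u y + Real.exp t * (1 - t) = Real.exp t := by
      simp only [t]; ring
    linarith
  have iS : Integrable (S.indicator F) arcLength := iF.indicator hS
  have iS' : Integrable (Sᶜ.indicator F) arcLength := iF.indicator hS.compl
  have h3 : poisson F y = poisson (S.indicator F) y + poisson (Sᶜ.indicator F) y := by
    unfold poisson
    rw [← mul_add, ← integral_add (integrable_mul_pker iS hy1) (integrable_mul_pker iS' hy1)]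
    congr 2; ext z
    rw [← add_mul, ← Pi.add_apply, indicator_self_add_compl]
  have h4 : poisson (Sᶜ.indicator F) y ≤ s⁻¹ ^ 2 * ∫ z, F z ∂arcLength := by
    have : ∫ z, Sᶜ.indicator F z * pker y z ∂arcLength ≤ ∫ z, s⁻¹ ^ 2 * F z ∂arcLength := by
      refine integral_mono_ae (integrable_mul_pker iS' hy1) (iF.const_mul _) ?_
      filter_upwards [ae_arcLength_norm] with z hz
      by_cases hzS : z ∈ S
      · rw [indicator_of_notMem (by simpa using hzS), zero_mul]; positivity
      · rw [indicator_of_mem (by simpa using hzS), mul_comm]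
        refine mul_le_mul_of_nonneg_right ?_ (Real.exp_pos _).le
        have h := hsep z hz hzS
        rw [pker, inv_pow, ← one_div]
        have : 1 - ‖y‖ ^ 2 ≤ 1 := by nlinarith [sq_nonneg ‖y‖]
        gcongr
    rw [integral_const_mul] at this
    rw [poisson, inv_mul_le_iff₀ (by positivity)]
    have h5 : 0 ≤ s⁻¹ ^ 2 * ∫ z, F z ∂arcLength :=
      mul_nonneg (by positivity) (integral_nonneg fun _ => (Real.exp_pos _).le)
    nlinarith [Real.pi_gt_three]
  have n0 : ∀ {f : ℂ → ℝ}, (∀ z, 0 ≤ f z) → 0 ≤ poisson f y := fun hf =>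
    mul_nonneg (by positivity) (integral_nonneg fun z => mul_nonneg (hf z) (pker_nonneg hy1 z))
  have h5 : poisson (S.indicator F) y ^ 8 ≤ poisson (S.indicator fun z => Real.exp (1 * u z)) y := by
    set t := poisson (S.indicator F) y
    have := affine_poisson_le (a := 8 * t ^ 7) (b := -7 * t ^ 8) iS
      (integrable_indicator_exp hu hS 1) (ae_of_all _ fun z => by
        have h := tangent_pow_eight t (S.indicator F z)
        refine h.trans (le_of_eq ?_)
        by_cases hzS : z ∈ S
        · rw [indicator_of_mem hzS, indicator_of_mem hzS, hF, ← Real.exp_nat_mul]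
          congr 1; push_cast; ring
        · rw [indicator_of_notMem hzS, indicator_of_notMem hzS]; norm_num) hy1
    have e : 8 * t ^ 7 * t + -7 * t ^ 8 = t ^ 8 := by ring
    linarith
  have m1 := n0 (f := S.indicator F) (fun z => indicator_nonneg (fun _ _ => (Real.exp_pos _).le) z)
  have m2 := n0 (f := Sᶜ.indicator F) (fun z => indicator_nonneg (fun _ _ => (Real.exp_pos _).le) z)
  calc Real.exp (poisson u y) ≤ (poisson (S.indicator F) y + poisson (Sᶜ.indicator F) y) ^ 8 := by
        rw [h1, ← h3]; gcongr
    _ ≤ 2 ^ 7 * (poisson (S.indicator F) y ^ 8 + poisson (Sᶜ.indicator F) y ^ 8) := add_pow_le m1 m2 8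
    _ ≤ 2 ^ 7 * (poisson (S.indicator fun z => Real.exp (1 * u z)) y +
          (s⁻¹ ^ 2 * ∫ z, F z ∂arcLength) ^ 8) := by gcongr
    _ = _ := by rw [mul_pow]

lemma poisson_rpow_le (hS : MeasurableSet S) {p : ℝ} (hp : 1 < p) {y : ℂ} (hy : y ∈ disc) :
    poisson (S.indicator fun z => Real.exp (1 * u z)) y ^ p ≤
      poisson (S.indicator fun z => Real.exp (p * u z)) y := by
  have hy1 := mem_disc.1 hy
  have hpi := Real.pi_pos
  set t := poisson (S.indicator fun z => Real.exp (1 * u z)) y with ht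
  have ht0 : 0 ≤ t := mul_nonneg (by positivity) (integral_nonneg fun z =>
    mul_nonneg (indicator_nonneg (fun _ _ => (Real.exp_pos _).le) z) (pker_nonneg hy1 z))
  have := affine_poisson_le (a := p * t ^ (p - 1)) (b := (1 - p) * t ^ p)
    (integrable_indicator_exp hu hS 1)
    (integrable_indicator_exp hu hS p) (ae_of_all _ fun z => by
      have h := tangent_rpow hp ht0 (t := S.indicator (fun z => Real.exp (1 * u z)) z)
        (indicator_nonneg (fun _ _ => (Real.exp_pos _).le) z)
      refine h.trans (le_of_eq ?_)
      by_cases hzS : z ∈ S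
      · rw [indicator_of_mem hzS, indicator_of_mem hzS, ← Real.exp_mul]
        congr 1; ring
      · rw [indicator_of_notMem hzS, indicator_of_notMem hzS, Real.zero_rpow (by linarith)]) hy1
  have e : p * t ^ (p - 1) * t + (1 - p) * t ^ p = t ^ p := by
    rcases ht0.eq_or_lt with h0 | h0
    · rw [← h0, Real.zero_rpow (by linarith : p ≠ 0)]; ring
    · rw [Real.rpow_sub_one h0.ne']; field_simp; ring
  rw [← ht] at this
  linarith

end Majorant

lemma poisson_le_div {φ : ℂ → ℝ} (hφ : Integrable φ arcLength) (hφ0 : ∀ z, 0 ≤ φ z) {y : ℂ}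
    (hy : y ∈ disc) : poisson φ y ≤ (∫ z, φ z ∂arcLength) * (1 - ‖y‖)⁻¹ := by
  have hy1 := mem_disc.1 hy
  have hd : 0 < 1 - ‖y‖ := by linarith
  have : ∫ z, φ z * pker y z ∂arcLength ≤ ∫ z, φ z * (2 * (1 - ‖y‖)⁻¹) ∂arcLength := by
    refine integral_mono_ae (integrable_mul_pker hφ hy1) (hφ.mul_const _) ?_
    filter_upwards [ae_arcLength_norm] with z hz
    refine mul_le_mul_of_nonneg_left ?_ (hφ0 z)
    have h1 : 1 - ‖y‖ ≤ ‖z - y‖ := by have := norm_sub_norm_le z y; rwa [hz] at this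
    have hz0 : 0 < ‖z - y‖ := by linarith
    rw [pker, div_le_iff₀ (by positivity)]
    calc 1 - ‖y‖ ^ 2 ≤ 2 * (1 - ‖y‖) := by nlinarith [norm_nonneg y]
      _ = 2 * (1 - ‖y‖)⁻¹ * (1 - ‖y‖) ^ 2 := by field_simp
      _ ≤ _ := by gcongr
  rw [integral_mul_const] at this
  have h0 : 0 ≤ (∫ z, φ z ∂arcLength) * (1 - ‖y‖)⁻¹ :=
    mul_nonneg (integral_nonneg hφ0) (by positivity)
  rw [poisson, inv_mul_le_iff₀ (by have := Real.pi_pos; positivity)]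
  nlinarith [Real.pi_gt_three]

/-- All but one power of the Poisson integral are bounded by the total mass over 1 - ‖y‖. The
resulting weight (1 - ‖y‖)^{1-β} times the Poisson kernel is at most twice the Riesz kernel of order
β, because ‖y - z‖ ≥ 1 - ‖y‖. For β < 2 this kernel is integrable over the disc. -/
lemma poisson_rpow_le_circlePotential {β : ℝ} (h1β : 1 ≤ β) (hβ : β < 2) {φ : ℂ → ℝ}
    (hφ : Integrable φ arcLength) (hφ0 : ∀ z, 0 ≤ φ z) {y : ℂ} (hy : y ∈ disc) :
    poisson φ y ^ β ≤ (∫ z, φ z ∂arcLength) ^ (β - 1) * circlePotential β φ y := by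
  have hy1 := mem_disc.1 hy
  have hpi := Real.pi_pos
  have hd : 0 < 1 - ‖y‖ := by linarith
  set G := ∫ z, φ z ∂arcLength with hG
  have hG0 : 0 ≤ G := integral_nonneg hφ0
  have hQ0 : 0 ≤ poisson φ y := mul_nonneg (by positivity) (integral_nonneg fun z =>
    mul_nonneg (hφ0 z) (pker_nonneg hy1 z))
  have h1 : poisson φ y ^ β = poisson φ y ^ (β - 1) * poisson φ y := by
    rw [← Real.rpow_add_one' hQ0 (by linarith)]; ring_nf
  have h2 : poisson φ y ^ (β - 1) ≤ G ^ (β - 1) * (1 - ‖y‖) ^ (1 - β) := by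
    have e : (1 - ‖y‖) ^ (1 - β) = (1 - ‖y‖)⁻¹ ^ (β - 1) := by
      rw [← Real.rpow_neg_eq_inv_rpow]; ring_nf
    rw [e, ← Real.mul_rpow hG0 (by positivity)]
    exact Real.rpow_le_rpow hQ0 (poisson_le_div hφ hφ0 hy) (by linarith)
  have hcont : ContinuousOn (fun z => ‖y - z‖ ^ (-β)) (Metric.sphere (0 : ℂ) 1) := by
    refine ContinuousOn.rpow_const (by fun_prop) fun z hz => Or.inl ?_
    have : ‖z‖ = 1 := by simpa using hz
    exact norm_ne_zero_iff.2 (sub_ne_zero.2 fun h => by rw [h] at hy1; linarith)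
  have iP : Integrable (fun z => φ z * ‖y - z‖ ^ (-β)) arcLength := by
    obtain ⟨K, hK⟩ := (isCompact_sphere (0 : ℂ) 1).exists_bound_of_continuousOn hcont
    refine hφ.mul_bdd (c := K) (aestronglyMeasurable_arcLength hcont) ?_
    filter_upwards [ae_arcLength_norm] with z hz
    exact hK z (by simpa using hz)
  have h3 : (1 - ‖y‖) ^ (1 - β) * poisson φ y ≤ circlePotential β φ y := by
    have h4 : ∫ z, φ z * pker y z ∂arcLength ≤
        ∫ z, 2 * (1 - ‖y‖) ^ (β - 1) * (φ z * ‖y - z‖ ^ (-β)) ∂arcLength := by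
      refine integral_mono_ae (integrable_mul_pker hφ hy1) (iP.const_mul _) ?_
      filter_upwards [ae_arcLength_norm] with z hz
      have h5 : 1 - ‖y‖ ≤ ‖y - z‖ := by
        have := norm_sub_norm_le z y
        rwa [hz, norm_sub_rev] at this
      have hz0 : 0 < ‖y - z‖ := by linarith
      have h6 : pker y z ≤ 2 * (1 - ‖y‖) ^ (β - 1) * ‖y - z‖ ^ (-β) := by
        rw [pker, div_le_iff₀ (by rw [norm_sub_rev]; positivity), norm_sub_rev z y]
        have e1 : ‖y - z‖ ^ (-β) * ‖y - z‖ ^ 2 = ‖y - z‖ ^ (2 - β) := by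
          rw [← Real.rpow_natCast, ← Real.rpow_add hz0]; push_cast; ring_nf
        have e2 : (1 - ‖y‖) ^ (β - 1) * (1 - ‖y‖) ^ (2 - β) = 1 - ‖y‖ := by
          rw [← Real.rpow_add hd]; ring_nf; simp
        have h7 : (1 - ‖y‖) ^ (2 - β) ≤ ‖y - z‖ ^ (2 - β) :=
          Real.rpow_le_rpow hd.le h5 (by linarith)
        calc 1 - ‖y‖ ^ 2 ≤ 2 * (1 - ‖y‖) := by nlinarith [norm_nonneg y]
          _ = 2 * ((1 - ‖y‖) ^ (β - 1) * (1 - ‖y‖) ^ (2 - β)) := by rw [e2]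
          _ ≤ 2 * ((1 - ‖y‖) ^ (β - 1) * ‖y - z‖ ^ (2 - β)) := by gcongr
          _ = _ := by rw [← e1]; ring
      calc φ z * pker y z ≤ φ z * (2 * (1 - ‖y‖) ^ (β - 1) * ‖y - z‖ ^ (-β)) :=
            mul_le_mul_of_nonneg_left h6 (hφ0 z)
        _ = _ := by ring
    rw [integral_const_mul] at h4
    have e3 : (1 - ‖y‖) ^ (1 - β) * (1 - ‖y‖) ^ (β - 1) = 1 := by
      rw [← Real.rpow_add hd]; ring_nf; simp
    have hN0 : 0 ≤ circlePotential β φ y := integral_nonneg fun z => mul_nonneg (hφ0 z) (by positivity)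
    calc (1 - ‖y‖) ^ (1 - β) * poisson φ y
        ≤ (1 - ‖y‖) ^ (1 - β) * ((2 * Real.pi)⁻¹ * (2 * (1 - ‖y‖) ^ (β - 1) * circlePotential β φ y)) := by
          unfold poisson
          gcongr
          exact h4
      _ = Real.pi⁻¹ * ((1 - ‖y‖) ^ (1 - β) * (1 - ‖y‖) ^ (β - 1)) * circlePotential β φ y := by
          field_simp
      _ ≤ 1 * 1 * circlePotential β φ y := by
          rw [e3]
          have : Real.pi⁻¹ ≤ 1 := inv_le_one_of_one_le₀ (by linarith [Real.pi_gt_three])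
          gcongr
      _ = _ := by ring
  calc poisson φ y ^ β ≤ G ^ (β - 1) * (1 - ‖y‖) ^ (1 - β) * poisson φ y := by
        rw [h1]; gcongr
    _ = G ^ (β - 1) * ((1 - ‖y‖) ^ (1 - β) * poisson φ y) := by ring
    _ ≤ _ := by gcongr

lemma exp_mul_ell {κ : ℝ} {x y : ℂ} (hx : x ∈ disc) (hy : y ∈ disc) (hxy : y ≠ x) :
    Real.exp (κ * ell x y) = ‖1 - (starRingEnd ℂ) x * y‖ ^ κ * ‖y - x‖ ^ (-κ) := by
  have h0 : 0 < ‖y - x‖ := norm_pos_iff.2 (sub_ne_zero.2 hxy)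
  have h1 : 0 < ‖1 - (starRingEnd ℂ) x * y‖ :=
    norm_pos_iff.2 (one_sub_conj_mul_ne (mem_disc.1 hx) (mem_disc.1 hy).le)
  rw [Real.rpow_def_of_pos h0, Real.rpow_def_of_pos h1, ← Real.exp_add, ell]
  congr 1; ring

lemma norm_one_sub_conj_mul_le_two {x y : ℂ} (hx : x ∈ disc) (hy : y ∈ disc) :
    ‖1 - (starRingEnd ℂ) x * y‖ ≤ 2 := by
  have hx := mem_disc.1 hx
  have hy := mem_disc.1 hy
  refine (norm_sub_le _ _).trans ?_
  rw [norm_mul, RCLike.norm_conj, norm_one]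
  nlinarith [norm_nonneg x, norm_nonneg y]

/-- The exponent is raised from 7/4 to 99/50 so that all error terms share one Riesz kernel; the
disc is bounded and 99/50 is still below 2. -/
lemma exp_ell_le {x y : ℂ} (hx : x ∈ disc) (hy : y ∈ disc) (hxy : y ≠ x) :
    Real.exp (7 / 4 * ell x y) ≤ 8 * ‖y - x‖ ^ (-(99 / 50) : ℝ) := by
  have h0 : 0 < ‖y - x‖ := norm_pos_iff.2 (sub_ne_zero.2 hxy)
  have h2 := norm_one_sub_conj_mul_le_two hx hy
  have h3 := norm_sub_le_norm_one_sub (mem_disc.1 hx).le (mem_disc.1 hy).le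
  rw [exp_mul_ell hx hy hxy]
  have e : ‖y - x‖ ^ (-(7 / 4) : ℝ) = ‖y - x‖ ^ (23 / 100 : ℝ) * ‖y - x‖ ^ (-(99 / 50) : ℝ) := by
    rw [← Real.rpow_add h0]; norm_num
  have p1 : ‖1 - (starRingEnd ℂ) x * y‖ ^ (7 / 4 : ℝ) ≤ 4 := by
    calc _ ≤ (2 : ℝ) ^ (7 / 4 : ℝ) := by gcongr
      _ ≤ (2 : ℝ) ^ (2 : ℝ) := Real.rpow_le_rpow_of_exponent_le (by norm_num) (by norm_num)
      _ = 4 := by norm_num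
  have p2 : ‖y - x‖ ^ (23 / 100 : ℝ) ≤ 2 := by
    calc _ ≤ (2 : ℝ) ^ (23 / 100 : ℝ) := Real.rpow_le_rpow h0.le (h3.trans h2) (by norm_num)
      _ ≤ (2 : ℝ) ^ (1 : ℝ) := Real.rpow_le_rpow_of_exponent_le (by norm_num) (by norm_num)
      _ = 2 := by norm_num
  rw [e]
  calc _ ≤ 4 * (2 * ‖y - x‖ ^ (-(99 / 50) : ℝ)) := by gcongr
    _ = _ := by ring

/-- The exponential of the Green function is (t/r)^{7/4} with t = ‖1 - conj(x) y‖ and r = ‖y - x‖.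
It is at most 4 if t ≤ 2r. Otherwise `norm_one_sub_sq` gives t ≤ 6 (1 - ‖y‖), hence Q ≤ 6G/t, and
the singularity at x falls on the constant G instead of on Q. -/
lemma exp_ell_mul_rpow_le {x y : ℂ} (hx : x ∈ disc) (hy : y ∈ disc) (hxy : y ≠ x) {Q G : ℝ}
    (hQ0 : 0 ≤ Q) (hG0 : 0 ≤ G) (hQ : Q ≤ G * (1 - ‖y‖)⁻¹) :
    Real.exp (7 / 4 * ell x y) * Q ^ (99 / 50 : ℝ) ≤
      4 * Q ^ (99 / 50 : ℝ) + 36 * G ^ (99 / 50 : ℝ) * ‖y - x‖ ^ (-(99 / 50) : ℝ) := by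
  have hx1 := mem_disc.1 hx
  have hy1 := mem_disc.1 hy
  have h0 : 0 < ‖y - x‖ := norm_pos_iff.2 (sub_ne_zero.2 hxy)
  have h3 := norm_sub_le_norm_one_sub hx1.le hy1.le
  have hsq := norm_one_sub_sq x y
  have h4 := one_sub_norm_le (x := x) hy1.le
  rw [exp_mul_ell hx hy hxy]
  set t := ‖1 - (starRingEnd ℂ) x * y‖ with ht
  have ht0 : 0 < t := by linarith
  set r := ‖y - x‖ with hr
  rcases le_or_gt t (2 * r) with h | h
  · have p1 : t ^ (7 / 4 : ℝ) * r ^ (-(7 / 4) : ℝ) ≤ 4 := by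
      rw [Real.rpow_neg h0.le, ← Real.inv_rpow h0.le, ← Real.mul_rpow ht0.le (by positivity),
        ← div_eq_mul_inv]
      calc _ ≤ (2 : ℝ) ^ (7 / 4 : ℝ) := by
            refine Real.rpow_le_rpow (by positivity) ?_ (by norm_num)
            rwa [div_le_iff₀ h0]
        _ ≤ (2 : ℝ) ^ (2 : ℝ) := Real.rpow_le_rpow_of_exponent_le (by norm_num) (by norm_num)
        _ = 4 := by norm_num
    have : t ^ (7 / 4 : ℝ) * r ^ (-(7 / 4) : ℝ) * Q ^ (99 / 50 : ℝ) ≤ 4 * Q ^ (99 / 50 : ℝ) := by gcongr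
    have : 0 ≤ 36 * G ^ (99 / 50 : ℝ) * r ^ (-(99 / 50) : ℝ) := by positivity
    linarith
  · have hd : 0 < 1 - ‖y‖ := by linarith
    have h5 : t ≤ 6 * (1 - ‖y‖) := by
      have h6 : r ^ 2 ≤ (t / 2) ^ 2 := by gcongr; linarith
      have h7 : (1 - ‖x‖ ^ 2) * (1 - ‖y‖ ^ 2) ≤ (2 * t) * (2 * (1 - ‖y‖)) := by
        refine mul_le_mul ?_ ?_ ?_ (by positivity)
        · nlinarith [norm_nonneg x]
        · nlinarith [norm_nonneg y]
        · nlinarith [norm_nonneg y]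
      nlinarith
    have h6 : Q ≤ G * (6 * t⁻¹) := by
      refine hQ.trans ?_
      have : (1 - ‖y‖)⁻¹ ≤ 6 * t⁻¹ := by
        rw [← div_eq_mul_inv, le_div_iff₀ ht0, inv_mul_le_iff₀ hd]; linarith
      gcongr
    have h7 : Q ^ (99 / 50 : ℝ) ≤ G ^ (99 / 50 : ℝ) * (36 * t ^ (-(99 / 50) : ℝ)) := by
      calc Q ^ (99 / 50 : ℝ) ≤ (G * (6 * t⁻¹)) ^ (99 / 50 : ℝ) := by gcongr
        _ = G ^ (99 / 50 : ℝ) * (6 ^ (99 / 50 : ℝ) * t ^ (-(99 / 50) : ℝ)) := by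
            rw [Real.mul_rpow hG0 (by positivity), Real.mul_rpow (by norm_num) (by positivity),
              Real.inv_rpow ht0.le, Real.rpow_neg ht0.le]
        _ ≤ _ := by
            have : (6 : ℝ) ^ (99 / 50 : ℝ) ≤ 36 := by
              calc _ ≤ (6 : ℝ) ^ (2 : ℝ) := Real.rpow_le_rpow_of_exponent_le (by norm_num) (by norm_num)
                _ = 36 := by norm_num
            gcongr
    have h8 : t ^ (7 / 4 : ℝ) * t ^ (-(99 / 50) : ℝ) ≤ r ^ (-(23 / 100) : ℝ) := by
      rw [← Real.rpow_add ht0]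
      have : (7 / 4 + -(99 / 50) : ℝ) = -(23 / 100) := by norm_num
      rw [this]
      exact Real.rpow_le_rpow_of_nonpos h0 h3 (by norm_num)
    have e : r ^ (-(99 / 50) : ℝ) = r ^ (-(23 / 100) : ℝ) * r ^ (-(7 / 4) : ℝ) := by
      rw [← Real.rpow_add h0]; norm_num
    calc t ^ (7 / 4 : ℝ) * r ^ (-(7 / 4) : ℝ) * Q ^ (99 / 50 : ℝ)
        ≤ t ^ (7 / 4 : ℝ) * r ^ (-(7 / 4) : ℝ) * (G ^ (99 / 50 : ℝ) * (36 * t ^ (-(99 / 50) : ℝ))) := by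
          gcongr
      _ = 36 * G ^ (99 / 50 : ℝ) * ((t ^ (7 / 4 : ℝ) * t ^ (-(99 / 50) : ℝ)) * r ^ (-(7 / 4) : ℝ)) := by ring
      _ ≤ 36 * G ^ (99 / 50 : ℝ) * (r ^ (-(23 / 100) : ℝ) * r ^ (-(7 / 4) : ℝ)) := by gcongr
      _ ≤ _ := by
          rw [← e]
          have : 0 ≤ 4 * Q ^ (99 / 50 : ℝ) := by positivity
          linarith

/-- The eighth power of the integral of `e^{u/8}` over the circle. -/
def lowMass (u : ℂ → ℝ) : ℝ := (∫ z, Real.exp (1 / 8 * u z) ∂arcLength) ^ 8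

lemma lowMass_pos {u : ℂ → ℝ} (hu : Continuous u) : 0 < lowMass u :=
  pow_pos (integral_exp_arcLength_pos (f := fun z => 1 / 8 * u z) (by fun_prop)) 8

/-- Jensen's inequality for the sixteenth power on a circle of length 2π. -/
lemma lowMass_sq_le {u : ℂ → ℝ} (hu : Continuous u) :
    lowMass u ^ 2 ≤ (2 * Real.pi) ^ 15 * ∫ z, Real.exp (2 * u z) ∂arcLength := by
  have hpi := Real.pi_pos
  set F : ℂ → ℝ := fun z => Real.exp (1 / 8 * u z) with hF
  have iF : Integrable F arcLength := integrable_arcLength (by fun_prop)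
  set a := (2 * Real.pi)⁻¹ * ∫ z, F z ∂arcLength with ha
  have e : ∫ z, F z ∂arcLength = 2 * Real.pi * a := by rw [ha]; field_simp
  have h : ∫ z, (16 * a ^ 15 * F z + -15 * a ^ 16) ∂arcLength ≤ ∫ z, Real.exp (2 * u z) ∂arcLength := by
    refine integral_mono ((iF.const_mul _).add (integrable_const _)) (integrable_arcLength (by fun_prop))
      fun z => ?_
    refine (tangent_pow_sixteen a (F z)).trans (le_of_eq ?_)
    rw [hF, ← Real.exp_nat_mul]; congr 1; push_cast; ring
  rw [integral_add (iF.const_mul _) (integrable_const _), integral_const_mul, integral_const,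
    integral_one_arcLength, e, smul_eq_mul] at h
  have e2 : lowMass u = (2 * Real.pi * a) ^ 8 := by rw [lowMass, ← e]
  rw [e2]
  calc _ = (2 * Real.pi) ^ 15 * (16 * a ^ 15 * (2 * Real.pi * a) + 2 * Real.pi * (-15 * a ^ 16)) := by ring
    _ ≤ _ := by gcongr

/-- Interpolation between the masses of `e^u` and `e^{2u}`. -/
lemma integral_indicator_exp_le {u : ℂ → ℝ} (hu : Continuous u) {S : Set ℂ} (hS : MeasurableSet S)
    {T : ℝ} (hT : 0 < T) (hST : ∫ z in S, Real.exp (u z) ∂arcLength ≤ T) :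
    ∫ z, S.indicator (fun z => Real.exp (100 / 99 * u z)) z ∂arcLength ≤
      T ^ (98 / 99 : ℝ) * (∫ z, Real.exp (2 * u z) ∂arcLength) ^ (1 / 99 : ℝ) := by
  set A := ∫ z, Real.exp (2 * u z) ∂arcLength with hA
  have hA0 : 0 < A := integral_exp_arcLength_pos (by fun_prop)
  have i1 : Integrable (fun z => Real.exp (u z)) arcLength := integrable_arcLength (by fun_prop)
  have i2 : Integrable (fun z => Real.exp (2 * u z)) arcLength := integrable_arcLength (by fun_prop)
  have hSA : ∫ z in S, Real.exp (2 * u z) ∂arcLength ≤ A :=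
    setIntegral_le_integral i2 (ae_of_all _ fun _ => (Real.exp_pos _).le)
  set c := T ^ (98 / 99 : ℝ) * A ^ (1 / 99 : ℝ) with hc
  have hc0 : 0 < c := by positivity
  -- Hölder with 100/99 = (98/99)·1 + (1/99)·2, in the pointwise form of Young's inequality with the
  -- masses T and A as normalizations.
  have hpt : ∀ t : ℝ, Real.exp (100 / 99 * t) ≤
      c * (98 / 99 * T⁻¹ * Real.exp t + 1 / 99 * A⁻¹ * Real.exp (2 * t)) := by
    intro t
    have h := Real.geom_mean_le_arith_mean2_weighted (w₁ := 98 / 99) (w₂ := 1 / 99)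
      (p₁ := T⁻¹ * Real.exp t) (p₂ := A⁻¹ * Real.exp (2 * t)) (by norm_num) (by norm_num)
      (by positivity) (by positivity) (by norm_num)
    have e : Real.exp (100 / 99 * t) = c * ((T⁻¹ * Real.exp t) ^ (98 / 99 : ℝ) *
        (A⁻¹ * Real.exp (2 * t)) ^ (1 / 99 : ℝ)) := by
      rw [Real.mul_rpow (by positivity) (by positivity), Real.mul_rpow (by positivity) (by positivity),
        Real.inv_rpow hT.le, Real.inv_rpow hA0.le, ← Real.exp_mul, ← Real.exp_mul, hc]
      have : Real.exp (100 / 99 * t) = Real.exp (t * (98 / 99)) * Real.exp (2 * t * (1 / 99)) := by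
        rw [← Real.exp_add]; congr 1; ring
      rw [this]
      field_simp
    rw [e]
    refine mul_le_mul_of_nonneg_left (h.trans (le_of_eq (by ring))) hc0.le
  rw [integral_indicator hS]
  calc ∫ z in S, Real.exp (100 / 99 * u z) ∂arcLength
      ≤ ∫ z in S, c * (98 / 99 * T⁻¹ * Real.exp (u z) + 1 / 99 * A⁻¹ * Real.exp (2 * u z)) ∂arcLength := by
        refine setIntegral_mono (integrable_arcLength (by fun_prop)).integrableOn
          (((i1.const_mul _).add (i2.const_mul _)).const_mul c).integrableOn fun z => hpt _
    _ = c * (98 / 99 * T⁻¹ * (∫ z in S, Real.exp (u z) ∂arcLength) +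
          1 / 99 * A⁻¹ * ∫ z in S, Real.exp (2 * u z) ∂arcLength) := by
        rw [integral_const_mul, integral_add (i1.const_mul _).integrableOn (i2.const_mul _).integrableOn,
          integral_const_mul, integral_const_mul]
    _ ≤ c * (98 / 99 * T⁻¹ * T + 1 / 99 * A⁻¹ * A) := by gcongr
    _ = c := by field_simp; norm_num

/-- The constant in `integral_exp_disc_le`. -/
def discConst (s : ℝ) : ℝ :=
  2 ^ 15 * (discRiesz (99 / 50) + 1) * (40 + 8 * ((s⁻¹ ^ 2) ^ 8) ^ 2 * (2 * Real.pi) ^ 15)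

lemma discConst_pos (s : ℝ) : 0 < discConst s := by
  have := discRiesz_nonneg (99 / 50)
  have := Real.pi_pos
  unfold discConst
  positivity

/-- The interior exponential inequality in terms of the boundary masses. -/
theorem integral_exp_disc_le {u : ℂ → ℝ} (hu : ContDiff ℝ ∞ u) {S Ω : Set ℂ} (hS : MeasurableSet S)
    (hΩ : MeasurableSet Ω) (hsub : Ω ⊆ disc) {s : ℝ} (hs : 0 < s)
    (hsep : ∀ y ∈ Ω, ∀ z, ‖z‖ = 1 → z ∉ S → s ≤ ‖z - y‖) :
    ∫ z in Ω, Real.exp (2 * u z) ≤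
      Real.exp (2 / (7 * Real.pi) * (energy u - harmonicEnergy u)) *
      (discConst s * (∫ z in S, Real.exp (u z) ∂arcLength + lowMass u) ^ (49 / 25 : ℝ) *
        (∫ z, Real.exp (2 * u z) ∂arcLength) ^ (1 / 50 : ℝ)) := by
  have hc := hu.continuous
  have hpi := Real.pi_pos
  set J := lowMass u with hJ
  have hJ0 : 0 < J := lowMass_pos hc
  set A := ∫ z, Real.exp (2 * u z) ∂arcLength with hA
  have hA0 : 0 < A := integral_exp_arcLength_pos (by fun_prop)
  have hAS0 : 0 ≤ ∫ z in S, Real.exp (u z) ∂arcLength := integral_nonneg fun _ => (Real.exp_pos _).le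
  set T := ∫ z in S, Real.exp (u z) ∂arcLength + J with hT
  have hT0 : 0 < T := by positivity
  -- The square of the Poisson integral of e^u would lead to the borderline Riesz order 2. As 2 =
  -- (100/99)(99/50), a slightly larger exponential lowers the order to 99/50.
  set φ : ℂ → ℝ := S.indicator fun z => Real.exp (100 / 99 * u z) with hφ
  have hφm : Measurable φ := (by fun_prop : Measurable fun z => Real.exp (100 / 99 * u z)).indicator hS
  have hφ0 : ∀ z, 0 ≤ φ z := fun z => indicator_nonneg (fun _ _ => (Real.exp_pos _).le) z
  have hφi : Integrable φ arcLength := integrable_indicator_exp hc hS _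
  obtain ⟨K, hK⟩ : ∃ K, ∀ᵐ z ∂arcLength, |φ z| ≤ K := by
    obtain ⟨K, hK⟩ := (isCompact_sphere (0 : ℂ) 1).exists_bound_of_continuousOn
      (by fun_prop : Continuous fun z => Real.exp (100 / 99 * u z)).continuousOn
    refine ⟨K, ae_arcLength_norm.mono fun z hz => ?_⟩
    exact (norm_indicator_le_norm_self (fun z => Real.exp (100 / 99 * u z)) z).trans (hK z (by simpa using hz))
  set G := ∫ z, φ z ∂arcLength with hG
  have hG0 : 0 ≤ G := integral_nonneg hφ0
  have hGT : G ≤ T ^ (98 / 99 : ℝ) * A ^ (1 / 99 : ℝ) :=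
    integral_indicator_exp_le hc hS hT0 (by linarith)
  set c := (s⁻¹ ^ 2) ^ 8 with hcs
  set N := circlePotential (99 / 50) φ with hN
  obtain ⟨iN, hNle⟩ := circlePotential_integral (β := 99 / 50) (by norm_num) hφm hK hφ0
  have hN0 : ∀ y, 0 ≤ N y := fun y => integral_nonneg fun z => mul_nonneg (hφ0 z) (by positivity)
  have hI := discRiesz_nonneg (99 / 50)
  set I := discRiesz (99 / 50) with hIdef
  set W : ℂ → ℂ → ℝ := fun x y => 2 ^ 15 * (4 * G ^ (49 / 50 : ℝ) * N y +
    (36 * G ^ (99 / 50 : ℝ) + 8 * c ^ 2 * J ^ 2) * ‖y - x‖ ^ (-(99 / 50) : ℝ)) with hW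
  have iW : ∀ x, IntegrableOn (fun y : ℂ => ‖y - x‖ ^ (-(99 / 50) : ℝ)) disc := fun x =>
    integrableOn_norm_sub_rpow (by norm_num) x
  have hR0 : 0 < 2 ^ 15 * (I + 1) * (40 * G ^ (99 / 50 : ℝ) + 8 * c ^ 2 * J ^ 2) := by positivity
  -- Integrability of the Green kernel requires κ < 2. The value 7/4 gives 2/(7π) in front of E - H,
  -- which is below twice 1/(6π).
  have key := integral_exp_disc_le_of_kernel hu hΩ hsub (κ := 7 / 4) (by norm_num) hR0 (W := W)
    (fun x _ => ((iN.const_mul _).add ((iW x).const_mul _)).const_mul _)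
    (fun x y => by
      have := hN0 y
      simp only [hW]; positivity) ?_ ?_
  · have e1 : (2 * Real.pi * (7 / 4))⁻¹ = 2 / (7 * Real.pi) := by field_simp; norm_num
    rw [e1] at key
    refine key.trans (mul_le_mul_of_nonneg_left ?_ (Real.exp_pos _).le)
    have g1 : G ^ (99 / 50 : ℝ) ≤ T ^ (49 / 25 : ℝ) * A ^ (1 / 50 : ℝ) := by
      calc _ ≤ (T ^ (98 / 99 : ℝ) * A ^ (1 / 99 : ℝ)) ^ (99 / 50 : ℝ) := by gcongr
        _ = _ := by
          rw [Real.mul_rpow (by positivity) (by positivity), ← Real.rpow_mul hT0.le,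
            ← Real.rpow_mul hA0.le]
          norm_num
    have g2 : J ^ 2 ≤ (2 * Real.pi) ^ 15 * (T ^ (49 / 25 : ℝ) * A ^ (1 / 50 : ℝ)) := by
      -- J² is brought to the shape T^{49/25} A^{1/50} of the near term, using J ≤ T and J² ≤
      -- (2π)^15 A.
      have e2 : J ^ 2 = J ^ (49 / 25 : ℝ) * (J ^ 2) ^ (1 / 50 : ℝ) := by
        rw [← Real.rpow_natCast, ← Real.rpow_mul hJ0.le, ← Real.rpow_add hJ0]; norm_num
      have p1 : (1 : ℝ) ≤ (2 * Real.pi) ^ 15 := one_le_pow₀ (by linarith [Real.pi_gt_three])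
      calc J ^ 2 = J ^ (49 / 25 : ℝ) * (J ^ 2) ^ (1 / 50 : ℝ) := e2
        _ ≤ T ^ (49 / 25 : ℝ) * ((2 * Real.pi) ^ 15 * A) ^ (1 / 50 : ℝ) := by
            gcongr
            · linarith
            · exact lowMass_sq_le hc
        _ = T ^ (49 / 25 : ℝ) * (((2 * Real.pi) ^ 15) ^ (1 / 50 : ℝ) * A ^ (1 / 50 : ℝ)) := by
            rw [Real.mul_rpow (by positivity) hA0.le]
        _ ≤ T ^ (49 / 25 : ℝ) * ((2 * Real.pi) ^ 15 * A ^ (1 / 50 : ℝ)) := by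
            gcongr
            calc ((2 * Real.pi) ^ 15) ^ (1 / 50 : ℝ) ≤ ((2 * Real.pi) ^ 15) ^ (1 : ℝ) :=
                  Real.rpow_le_rpow_of_exponent_le p1 (by norm_num)
              _ = _ := Real.rpow_one _
        _ = _ := by ring
    calc _ ≤ 2 ^ 15 * (I + 1) * (40 * (T ^ (49 / 25 : ℝ) * A ^ (1 / 50 : ℝ)) +
          8 * c ^ 2 * ((2 * Real.pi) ^ 15 * (T ^ (49 / 25 : ℝ) * A ^ (1 / 50 : ℝ)))) := by gcongr
      _ = discConst s * T ^ (49 / 25 : ℝ) * A ^ (1 / 50 : ℝ) := by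
          rw [discConst, ← hcs, ← hIdef]; ring
  · intro x hx y hy hxy
    have hyd := hsub hy
    have hy1 := mem_disc.1 hyd
    set q := poisson (S.indicator fun z => Real.exp (1 * u z)) y with hq
    set Q := poisson φ y with hQ
    have n0 : ∀ {f : ℂ → ℝ}, (∀ z, 0 ≤ f z) → 0 ≤ poisson f y := fun hf =>
      mul_nonneg (by positivity) (integral_nonneg fun z => mul_nonneg (hf z) (pker_nonneg hy1 z))
    have hq0 : 0 ≤ q := n0 fun z => indicator_nonneg (fun _ _ => (Real.exp_pos _).le) z
    have hQ0 : 0 ≤ Q := n0 hφ0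
    have h1 : Real.exp (poisson u y) ≤ 2 ^ 7 * (q + c * J) := exp_poisson_le hc hS hs hyd (hsep y hy)
    have h2 : q ^ 2 ≤ Q ^ (99 / 50 : ℝ) := by
      have h3 : q ^ (100 / 99 : ℝ) ≤ Q := poisson_rpow_le hc hS (by norm_num) hyd
      have e : q ^ 2 = (q ^ (100 / 99 : ℝ)) ^ (99 / 50 : ℝ) := by
        rw [← Real.rpow_natCast, ← Real.rpow_mul hq0]; norm_num
      rw [e]; gcongr
    have h3 : Real.exp (2 * poisson u y) ≤ 2 ^ 15 * (Q ^ (99 / 50 : ℝ) + c ^ 2 * J ^ 2) := by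
      have e : Real.exp (2 * poisson u y) = Real.exp (poisson u y) ^ 2 := by
        rw [← Real.exp_nat_mul]; push_cast; rfl
      have h4 : Real.exp (poisson u y) ^ 2 ≤ (2 ^ 7 * (q + c * J)) ^ 2 := by gcongr
      rw [e]
      nlinarith [sq_nonneg (q - c * J)]
    have h4 := exp_ell_mul_rpow_le hx hyd hxy hQ0 hG0 (poisson_le_div hφi hφ0 hyd)
    have h5 := exp_ell_le hx hyd hxy
    have h6 := poisson_rpow_le_circlePotential (β := 99 / 50) (by norm_num) (by norm_num) hφi hφ0 hyd
    have e7 : (99 / 50 - 1 : ℝ) = 49 / 50 := by norm_num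
    rw [e7] at h6
    rw [Real.exp_add]
    set w := Real.exp (7 / 4 * ell x y) with hw
    calc w * Real.exp (2 * poisson u y) ≤ w * (2 ^ 15 * (Q ^ (99 / 50 : ℝ) + c ^ 2 * J ^ 2)) := by gcongr
      _ = 2 ^ 15 * (w * Q ^ (99 / 50 : ℝ) + c ^ 2 * J ^ 2 * w) := by ring
      _ ≤ 2 ^ 15 * (4 * (G ^ (49 / 50 : ℝ) * N y) +
          36 * G ^ (99 / 50 : ℝ) * ‖y - x‖ ^ (-(99 / 50) : ℝ) +
          c ^ 2 * J ^ 2 * (8 * ‖y - x‖ ^ (-(99 / 50) : ℝ))) := by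
          gcongr
          exact h4.trans (by gcongr)
      _ = W x y := by simp only [hW]; ring
  · intro x hx
    have h1 := setIntegral_norm_sub_rpow_le' (β := 99 / 50) (by norm_num) (mem_disc.1 hx).le
    simp only [hW]
    rw [integral_const_mul, integral_add (iN.const_mul _) ((iW x).const_mul _), integral_const_mul,
      integral_const_mul]
    have e : G ^ (49 / 50 : ℝ) * G = G ^ (99 / 50 : ℝ) := by
      rw [← Real.rpow_add_one' hG0 (by norm_num)]; norm_num
    calc _ ≤ 2 ^ 15 * (4 * G ^ (49 / 50 : ℝ) * (G * I) +
          (36 * G ^ (99 / 50 : ℝ) + 8 * c ^ 2 * J ^ 2) * I) := by gcongr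
      _ = 2 ^ 15 * I * (4 * (G ^ (49 / 50 : ℝ) * G) + 36 * G ^ (99 / 50 : ℝ) + 8 * c ^ 2 * J ^ 2) := by ring
      _ = 2 ^ 15 * I * (40 * G ^ (99 / 50 : ℝ) + 8 * c ^ 2 * J ^ 2) := by rw [e]; ring
      _ ≤ _ := by gcongr; linarith

/-! ### Trace inequalities. -/

/-- The divergence theorem for the field `y ↦ F y • y`. -/
theorem LipDisc.integral_circle_eq {F : ℂ → ℝ} {L : ℝ} (h : LipDisc F L) :
    IntegrableOn (fun y => 2 * F y + fderiv ℝ F y y) disc ∧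
      ∫ y, F y ∂arcLength = ∫ y in disc, (2 * F y + fderiv ℝ F y y) := by
  have hd : ∀ y : ℂ, ‖y‖ ≤ 1 → HasFDerivAt (fun y => ‖y‖ ^ 2 * F y)
      (‖y‖ ^ 2 • fderiv ℝ F y + F y • ((2 : ℝ) • innerSL ℝ y)) y := fun y hy => by
    have h2 : HasFDerivAt (fun y : ℂ => ‖y‖ ^ 2) ((2 : ℝ) • innerSL ℝ y) y := by
      have := (hasStrictFDerivAt_norm_sq y).hasFDerivAt
      rwa [← Nat.cast_smul_eq_nsmul ℝ] at this
    exact h2.mul (h y hy).1.hasFDerivAt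
  have he : ∀ y ∈ disc, y ≠ 0 → fderiv ℝ (fun y => ‖y‖ ^ 2 * F y) y y / ‖y‖ ^ 2 =
      2 * F y + fderiv ℝ F y y := fun y hy hy0 => by
    have h0 : ‖y‖ ≠ 0 := norm_ne_zero_iff.2 hy0
    rw [(hd y (mem_disc.1 hy).le).fderiv]
    simp only [add_apply, smul_apply, smul_eq_mul,
      innerSL_apply_apply, real_inner_self_eq_norm_sq]
    field_simp
    ring
  have hae : ∀ᵐ y ∂(volume.restrict disc), fderiv ℝ (fun y => ‖y‖ ^ 2 * F y) y y / ‖y‖ ^ 2 =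
      2 * F y + fderiv ℝ F y y := by
    filter_upwards [ae_restrict_mem measurableSet_disc,
      ae_restrict_of_ae ((countable_singleton 0).ae_notMem volume)] with y hy hy0
    exact he y hy hy0
  obtain ⟨K, hK⟩ := (isCompact_closedBall (0 : ℂ) 1).exists_bound_of_continuousOn h.continuousOn
  have hi : IntegrableOn (fun y => 2 * F y + fderiv ℝ F y y) disc := by
    refine Integrable.of_bound (C := 2 * K + L) ?_ ?_
    · refine AEStronglyMeasurable.add ?_ (measurable_fderiv_apply F measurable_id).aestronglyMeasurable
      exact ((h.continuousOn.mono Metric.ball_subset_closedBall).aestronglyMeasurable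
        measurableSet_disc).const_mul 2
    · filter_upwards [ae_restrict_mem measurableSet_disc] with y hy
      have hy1 := (mem_disc.1 hy).le
      refine (norm_add_le _ _).trans (add_le_add ?_ ?_)
      · rw [norm_mul, Real.norm_ofNat]
        gcongr
        exact hK y (by simpa using hy1)
      · calc ‖fderiv ℝ F y y‖ ≤ ‖fderiv ℝ F y‖ * ‖y‖ := ContinuousLinearMap.le_opNorm _ _
          _ ≤ L * 1 := mul_le_mul (h y hy1).2 hy1 (norm_nonneg _) h.nonneg
          _ = L := mul_one L
  refine ⟨hi, ?_⟩
  -- The factor ‖y‖² makes the function vanish at the origin and equals 1 on the circle.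
  rw [← integral_congr_ae hae, integral_radial (a := fun y => ‖y‖ ^ 2 * F y) finite_empty
    (fun y hy _ _ => (hd y hy).differentiableAt) (hd 0 (by simp)).continuousAt (by simp)
    ((by fun_prop : ContinuousOn (fun y : ℂ => ‖y‖ ^ 2) _).mul h.continuousOn_sphere)
    (Integrable.congr hi (hae.mono fun y hy => hy.symm))]
  refine integral_congr_ae ?_
  filter_upwards [ae_arcLength_norm] with y hy
  rw [hy]; ring

lemma LipDisc.integral_circle_le {F G : ℂ → ℝ} {L : ℝ} (h : LipDisc F L) (hG : IntegrableOn G disc)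
    (hFG : ∀ y ∈ disc, 2 * F y + fderiv ℝ F y y ≤ G y) :
    ∫ y, F y ∂arcLength ≤ ∫ y in disc, G y := by
  rw [h.integral_circle_eq.2]
  exact setIntegral_mono_on h.integral_circle_eq.1 hG measurableSet_disc hFG

lemma abs_fderiv_apply_self_le (u : ℂ → ℝ) {y : ℂ} (hy : y ∈ disc) :
    |fderiv ℝ u y y| ≤ ‖gradient u y‖ := by
  rw [norm_gradient]
  calc ‖fderiv ℝ u y y‖ ≤ ‖fderiv ℝ u y‖ * ‖y‖ := ContinuousLinearMap.le_opNorm _ _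
    _ ≤ ‖fderiv ℝ u y‖ * 1 := by gcongr; exact (mem_disc.1 hy).le
    _ = _ := mul_one _

lemma sq_integral_mul_le {μ : Measure ℂ} {f g : ℂ → ℝ} (hf : MemLp f 2 μ) (hg : MemLp g 2 μ) :
    (∫ x, f x * g x ∂μ) ^ 2 ≤ (∫ x, f x ^ 2 ∂μ) * ∫ x, g x ^ 2 ∂μ := by
  have i1 := hf.integrable_sq
  have i2 := hg.integrable_sq
  have i3 : Integrable (fun x => f x * g x) μ := hf.integrable_mul hg
  have h : ∀ t : ℝ, 0 ≤ (∫ x, f x ^ 2 ∂μ) * (t * t) + (2 * ∫ x, f x * g x ∂μ) * t + ∫ x, g x ^ 2 ∂μ := by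
    intro t
    have : 0 ≤ ∫ x, (t * t * f x ^ 2 + 2 * t * (f x * g x) + g x ^ 2) ∂μ :=
      integral_nonneg fun x => by
        have : t * t * f x ^ 2 + 2 * t * (f x * g x) + g x ^ 2 = (t * f x + g x) ^ 2 := by ring
        simp only [this]; positivity
    have i4 : Integrable (fun x => t * t * f x ^ 2 + 2 * t * (f x * g x)) μ :=
      (i1.const_mul _).add (i3.const_mul _)
    rw [integral_add i4 i2, integral_add (i1.const_mul _) (i3.const_mul _), integral_const_mul,
      integral_const_mul] at this
    linarith
  have := discrim_le_zero h
  rw [discrim] at this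
  nlinarith

lemma memLp_of_continuousOn {F : ℂ → ℝ} (h : ContinuousOn F (Metric.closedBall 0 1)) (p : ENNReal) :
    MemLp F p (volume.restrict disc) := by
  obtain ⟨K, hK⟩ := (isCompact_closedBall (0 : ℂ) 1).exists_bound_of_continuousOn h
  refine MemLp.of_bound ((h.mono Metric.ball_subset_closedBall).aestronglyMeasurable
        measurableSet_disc) K ((ae_restrict_mem measurableSet_disc).mono fun y hy => ?_)
  exact hK y (by simpa using (mem_disc.1 hy).le)

lemma integral_one_disc : volume.real disc = Real.pi := by
  rw [disc, measureReal_def, Complex.volume_ball]; simp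

/-- The trace inequality for exponentials. -/
theorem sq_integral_exp_boundary_le {u : ℂ → ℝ} (hu : ContDiff ℝ ∞ u) :
    (∫ z, Real.exp (u z) ∂arcLength) ^ 2 ≤
      (∫ z in disc, Real.exp (2 * u z)) * (8 * Real.pi + 2 * energy u) := by
  obtain ⟨L, hL⟩ := hu.exists_lipDisc
  obtain ⟨L', hL'⟩ := (hu.exp).exists_lipDisc
  have hc := hu.continuous
  have hg := hL.memLp_gradient 2
  set f : ℂ → ℝ := fun z => Real.exp (u z) with hf
  set g : ℂ → ℝ := fun z => 2 + ‖gradient u z‖ with hgdef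
  have mf : MemLp f 2 (volume.restrict disc) :=
    memLp_of_continuousOn (by fun_prop : Continuous f).continuousOn 2
  have mc : MemLp (fun _ : ℂ => (2 : ℝ)) 2 (volume.restrict disc) := memLp_const 2
  have mg : MemLp g 2 (volume.restrict disc) := mc.add hg.norm
  -- The divergence theorem for F = e^u has integrand e^u (2 + ∂u·y), and Cauchy-Schwarz then
  -- separates e^u from the gradient.
  have h1 : ∫ z, f z ∂arcLength ≤ ∫ z in disc, f z * g z := by
    refine hL'.integral_circle_le (mf.integrable_mul mg) fun y hy => ?_
    have h := (hu.differentiable (by simp) y).hasFDerivAt.exp.fderiv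
    rw [h, smul_apply, smul_eq_mul]
    have := mul_le_mul_of_nonneg_left ((le_abs_self _).trans (abs_fderiv_apply_self_le u hy))
      (Real.exp_pos (u y)).le
    simp only [hf, hgdef]
    linarith
  have h0 : 0 ≤ ∫ z, f z ∂arcLength := integral_nonneg fun _ => (Real.exp_pos _).le
  have h2 : ∫ z in disc, f z ^ 2 = ∫ z in disc, Real.exp (2 * u z) := by
    congr 1; ext z; simp only [hf]; rw [← Real.exp_nat_mul]; norm_num
  have h3 : ∫ z in disc, g z ^ 2 ≤ 8 * Real.pi + 2 * energy u := by
    have i := integrable_norm_sq_of_memLp hg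
    have : ∫ z in disc, g z ^ 2 ≤ ∫ z in disc, (8 + 2 * ‖gradient u z‖ ^ 2) := by
      refine integral_mono mg.integrable_sq ((integrable_const _).add (i.const_mul 2)) fun z => ?_
      simp only [hgdef]
      nlinarith [sq_nonneg (2 - ‖gradient u z‖)]
    rw [integral_add (integrable_const _) (i.const_mul 2), integral_const_mul, integral_const,
      smul_eq_mul, measureReal_restrict_apply_univ, integral_one_disc] at this
    rw [energy]; linarith
  rw [← h2]
  calc _ ≤ (∫ z in disc, f z * g z) ^ 2 := by gcongr
    _ ≤ (∫ z in disc, f z ^ 2) * ∫ z in disc, g z ^ 2 := sq_integral_mul_le mf mg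
    _ ≤ _ := by
      rw [h2]
      exact mul_le_mul_of_nonneg_left h3 (integral_nonneg fun _ => (Real.exp_pos _).le)

/-- The trace inequality in `L²`. -/
theorem integral_sq_boundary_le {u : ℂ → ℝ} (hu : ContDiff ℝ ∞ u) :
    ∫ z, u z ^ 2 ∂arcLength ≤ 3 * (∫ z in disc, u z ^ 2) + energy u := by
  obtain ⟨L, hL⟩ := hu.exists_lipDisc
  obtain ⟨L', hL'⟩ := (hu.pow 2).exists_lipDisc
  have hc := hu.continuous
  have i := integrable_norm_sq_of_memLp (hL.memLp_gradient 2)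
  have mu : MemLp u 2 (volume.restrict disc) := memLp_of_continuousOn hc.continuousOn 2
  have j := (mu.integrable_sq.const_mul 3).add i
  have h1 : ∫ z, u z ^ 2 ∂arcLength ≤ ∫ z in disc, (3 * u z ^ 2 + ‖gradient u z‖ ^ 2) := by
    refine hL'.integral_circle_le j fun y hy => ?_
    have h := ((hu.differentiable (by simp) y).hasFDerivAt.pow 2).fderiv
    rw [h, smul_apply, smul_eq_mul]
    have h2 := abs_fderiv_apply_self_le u hy
    have h3 : u y * fderiv ℝ u y y ≤ |u y| * ‖gradient u y‖ := by
      refine (le_abs_self _).trans ?_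
      rw [abs_mul]; gcongr
    simp only [Nat.add_one_sub_one, pow_one, nsmul_eq_mul, Nat.cast_ofNat]
    nlinarith [sq_nonneg (|u y| - ‖gradient u y‖), sq_abs (u y)]
  rwa [integral_add (mu.integrable_sq.const_mul 3) i, integral_const_mul] at h1

/-! ### From light boundary pieces to mass bounds, with explicit constants. -/

/-- The logarithm of the boundary constant. -/
def logCircleConst : ℝ := Real.log (circleConst (9 / 10))

/-- With p = 1/8 and γ = 9/10, eight times p²/(4πγ) is 5/(144π): the exponent is quadratic in p, so
the eighth power of the integral of e^{u/8} has the scaling of e^u at an eighth of its energy cost.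
-/
lemma lowMass_le {u : ℂ → ℝ} (hu : ContDiff ℝ ∞ u) :
    lowMass u ≤ Real.exp (cmean u + 5 / 144 * (harmonicEnergy u / Real.pi) + 8 * logCircleConst) := by
  have h := integral_exp_boundary_le (γ := 9 / 10) (by norm_num) (by norm_num) hu
    (p := 1 / 8) (by norm_num)
  have h0 := (integral_exp_arcLength_pos (f := fun z => 1 / 8 * u z)
    (by have := hu.continuous; fun_prop)).le
  calc lowMass u ≤ _ := pow_le_pow_left₀ h0 h 8
    _ = _ := by
      rw [← Real.exp_nat_mul, logCircleConst]
      congr 1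
      push_cast
      ring

lemma integral_exp_two_boundary_le {u : ℂ → ℝ} (hu : ContDiff ℝ ∞ u) :
    ∫ z, Real.exp (2 * u z) ∂arcLength ≤
      Real.exp (2 * cmean u + 10 / 9 * (harmonicEnergy u / Real.pi) + logCircleConst) := by
  refine (integral_exp_boundary_le (γ := 9 / 10) (by norm_num) (by norm_num) hu
    (p := 2) (by norm_num)).trans (le_of_eq ?_)
  rw [logCircleConst]; congr 1; ring

lemma integral_exp_one_boundary_le {u : ℂ → ℝ} (hu : ContDiff ℝ ∞ u) :
    ∫ z, Real.exp (u z) ∂arcLength ≤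
      Real.exp (cmean u + 5 / 18 * (harmonicEnergy u / Real.pi) + logCircleConst) := by
  have := integral_exp_boundary_le (γ := 9 / 10) (by norm_num) (by norm_num) hu
    (p := 1) (by norm_num)
  simp only [one_mul] at this
  refine this.trans (le_of_eq ?_)
  rw [logCircleConst]; congr 1; ring

/-- The exponential masses of `u` are controlled by its energy and mean with the constant `C`. -/
def MassBound (C : ℝ) (u : ℂ → ℝ) : Prop :=
  ∫ z in disc, Real.exp (2 * u z) ≤ Real.exp (2 * (cmean u + 1 / 6 * (energy u / Real.pi) + C)) ∧
    ∫ z, Real.exp (u z) ∂arcLength ≤ Real.exp (cmean u + 1 / 6 * (energy u / Real.pi) + C)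

lemma MassBound.mono {C C' : ℝ} {u : ℂ → ℝ} (h : MassBound C u) (hC : C ≤ C') : MassBound C' u :=
  ⟨h.1.trans (by gcongr), h.2.trans (by gcongr)⟩

lemma energy_nonneg (u : ℂ → ℝ) : 0 ≤ energy u := integral_nonneg fun _ => by positivity

/-- Control of the mass of a part of the disc. -/
lemma exists_integral_exp_disc_le {s : ℝ} (hs : 0 < s) (b : ℝ) : ∃ C, ∀ u : ℂ → ℝ, ContDiff ℝ ∞ u →
    ∀ S Ω : Set ℂ, MeasurableSet S → MeasurableSet Ω → Ω ⊆ disc →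
    (∀ y ∈ Ω, ∀ z, ‖z‖ = 1 → z ∉ S → s ≤ ‖z - y‖) →
    ∫ z in S, Real.exp (u z) ∂arcLength + lowMass u ≤
      Real.exp (cmean u + 5 / 32 * (harmonicEnergy u / Real.pi) + b) →
    ∫ z in Ω, Real.exp (2 * u z) ≤
      Real.exp (2 * (cmean u + 33 / 200 * (energy u / Real.pi) + C)) := by
  refine ⟨1 / 2 * (Real.log (discConst s) + 49 / 25 * b + 1 / 50 * logCircleConst), ?_⟩
  intro u hu S Ω hS hΩ hsub hsep hT
  obtain ⟨L, hL⟩ := hu.exists_lipDisc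
  have hpi := Real.pi_pos
  have h1 := integral_exp_disc_le hu hS hΩ hsub hs hsep
  have h2 := integral_exp_two_boundary_le hu
  have hK := discConst_pos s
  have hT0 : 0 ≤ ∫ z in S, Real.exp (u z) ∂arcLength + lowMass u :=
    add_nonneg (integral_nonneg fun _ => (Real.exp_pos _).le) (lowMass_pos hu.continuous).le
  have hA0 : 0 ≤ ∫ z, Real.exp (2 * u z) ∂arcLength := integral_nonneg fun _ => (Real.exp_pos _).le
  have hH : harmonicEnergy u / Real.pi ≤ energy u / Real.pi := by gcongr; exact hL.harmonicEnergy_le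
  have hH0 : 0 ≤ harmonicEnergy u / Real.pi := div_nonneg hL.harmonicEnergy_nonneg hpi.le
  refine h1.trans ?_
  calc _ ≤ Real.exp (2 / (7 * Real.pi) * (energy u - harmonicEnergy u)) *
        (Real.exp (Real.log (discConst s)) *
          Real.exp (cmean u + 5 / 32 * (harmonicEnergy u / Real.pi) + b) ^ (49 / 25 : ℝ) *
          Real.exp (2 * cmean u + 10 / 9 * (harmonicEnergy u / Real.pi) + logCircleConst) ^ (1 / 50 : ℝ)) := by
        rw [Real.exp_log hK]
        gcongr
    _ ≤ _ := by
        rw [← Real.exp_mul, ← Real.exp_mul, ← Real.exp_add, ← Real.exp_add, ← Real.exp_add]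
        refine Real.exp_le_exp.2 ?_
        have e : 2 / (7 * Real.pi) * (energy u - harmonicEnergy u) =
          2 / 7 * (energy u / Real.pi) - 2 / 7 * (harmonicEnergy u / Real.pi) := by ring
        rw [e]
        -- The coefficient of H/π is 49/25 · 5/32 + 1/50 · 10/9 - 2/7 > 0, so H ≤ E gives at most
        -- 49/160 + 1/45 < 33/100 for E/π.
        linarith

/-- Control of the full mass of the disc gives control of the mass of the circle. -/
lemma exists_massBound_of_disc (b : ℝ) : ∃ C, ∀ u : ℂ → ℝ, ContDiff ℝ ∞ u →
    ∫ z in disc, Real.exp (2 * u z) ≤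
      Real.exp (2 * (cmean u + 33 / 200 * (energy u / Real.pi) + b)) → MassBound C u := by
  have hpi := Real.pi_pos
  refine ⟨max b (b + 1 / 2 * Real.log (600 * Real.pi)), fun u hu h => ⟨h.trans ?_, ?_⟩⟩
  · have : 0 ≤ energy u / Real.pi := div_nonneg (energy_nonneg u) hpi.le
    have := le_max_left b (b + 1 / 2 * Real.log (600 * Real.pi))
    refine Real.exp_le_exp.2 ?_
    linarith
  · have h0 : 0 ≤ ∫ z, Real.exp (u z) ∂arcLength := integral_nonneg fun _ => (Real.exp_pos _).le
    have hE : 0 ≤ energy u / Real.pi := div_nonneg (energy_nonneg u) hpi.le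
    refine le_of_sq_le_sq ?_ (Real.exp_pos _).le
    -- The gap 2 · (1/6 - 33/200) = 1/300 in the exponent absorbs the linear growth in the trace
    -- inequality.
    have h1 : 8 * Real.pi + 2 * energy u ≤ 600 * Real.pi * Real.exp (1 / 300 * (energy u / Real.pi)) := by
      have h2 := Real.add_one_le_exp (1 / 300 * (energy u / Real.pi))
      have h3 : energy u = Real.pi * (energy u / Real.pi) := by field_simp
      calc _ = Real.pi * (8 + 2 * (energy u / Real.pi)) := by rw [mul_add]; nlinarith
        _ ≤ Real.pi * (600 * Real.exp (1 / 300 * (energy u / Real.pi))) := by gcongr; linarith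
        _ = _ := by ring
    have h4 : 0 ≤ 8 * Real.pi + 2 * energy u := by have := energy_nonneg u; positivity
    calc _ ≤ _ := sq_integral_exp_boundary_le hu
      _ ≤ Real.exp (2 * (cmean u + 33 / 200 * (energy u / Real.pi) + b)) *
          (Real.exp (Real.log (600 * Real.pi)) * Real.exp (1 / 300 * (energy u / Real.pi))) := by
          rw [Real.exp_log (by positivity)]
          gcongr
      _ ≤ _ := by
          rw [← Real.exp_add, ← Real.exp_add, ← Real.exp_nat_mul]
          refine Real.exp_le_exp.2 ?_
          have := le_max_right b (b + 1 / 2 * Real.log (600 * Real.pi))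
          push_cast
          linarith

/-- Control of the mass of the circle gives control of the mass of the disc. -/
lemma exists_massBound_of_circle (b : ℝ) : ∃ C, ∀ u : ℂ → ℝ, ContDiff ℝ ∞ u →
    ∫ z, Real.exp (u z) ∂arcLength ≤
      Real.exp (cmean u + 5 / 32 * (harmonicEnergy u / Real.pi) + b) → MassBound C u := by
  set b' := Real.log 2 + max b (8 * logCircleConst) with hb'
  obtain ⟨C, hC⟩ := exists_integral_exp_disc_le (s := 1) one_pos b'
  refine ⟨max b C, fun u hu h => ?_⟩
  have hpi := Real.pi_pos
  obtain ⟨L, hL⟩ := hu.exists_lipDisc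
  have hH : harmonicEnergy u / Real.pi ≤ energy u / Real.pi := by gcongr; exact hL.harmonicEnergy_le
  have hH0 : 0 ≤ harmonicEnergy u / Real.pi := div_nonneg hL.harmonicEnergy_nonneg hpi.le
  constructor
  · refine (hC u hu univ disc MeasurableSet.univ measurableSet_disc subset_rfl
      (fun y _ z _ hz => absurd (mem_univ z) hz) ?_).trans (Real.exp_le_exp.2 ?_)
    · have h1 := lowMass_le hu
      have e1 : Real.exp (cmean u + 5 / 144 * (harmonicEnergy u / Real.pi) + 8 * logCircleConst) ≤
          Real.exp (cmean u + 5 / 32 * (harmonicEnergy u / Real.pi) + max b (8 * logCircleConst)) :=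
        Real.exp_le_exp.2 (by linarith [le_max_right b (8 * logCircleConst)])
      have e2 : Real.exp (cmean u + 5 / 32 * (harmonicEnergy u / Real.pi) + b) ≤
          Real.exp (cmean u + 5 / 32 * (harmonicEnergy u / Real.pi) + max b (8 * logCircleConst)) :=
        Real.exp_le_exp.2 (by linarith [le_max_left b (8 * logCircleConst)])
      rw [Measure.restrict_univ]
      have e3 : Real.exp (cmean u + 5 / 32 * (harmonicEnergy u / Real.pi) + b') = 2 *
          Real.exp (cmean u + 5 / 32 * (harmonicEnergy u / Real.pi) + max b (8 * logCircleConst)) := by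
        rw [hb', ← add_assoc, add_right_comm, Real.exp_add _ (Real.log 2), Real.exp_log two_pos, mul_comm,
          add_assoc]
      rw [e3]
      linarith
    · linarith [le_max_right b C]
  · refine h.trans (Real.exp_le_exp.2 ?_)
    linarith [le_max_left b C]

/-- Of two separated boundary pieces one has small mass. -/
lemma exists_mass_le_of_separated {s : ℝ} (hs : 0 < s) : ∃ b, ∀ u : ℂ → ℝ, ContDiff ℝ ∞ u →
    ∀ S₁ S₂ : Set ℂ, MeasurableSet S₁ → MeasurableSet S₂ → (∀ x ∈ S₁, ∀ y ∈ S₂, s ≤ ‖x - y‖) →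
    ∫ z in S₁, Real.exp (u z) ∂arcLength + lowMass u ≤
        Real.exp (cmean u + 5 / 32 * (harmonicEnergy u / Real.pi) + b) ∨
    ∫ z in S₂, Real.exp (u z) ∂arcLength + lowMass u ≤
        Real.exp (cmean u + 5 / 32 * (harmonicEnergy u / Real.pi) + b) := by
  set k := max (2 * (9 / 10 * Real.log (2 / s) + logCircleConst))
    (max (9 * logCircleConst) (16 * logCircleConst)) with hk
  refine ⟨1 / 2 * (k + Real.log 4), fun u hu S₁ S₂ hS₁ hS₂ hsep => ?_⟩
  have hpi := Real.pi_pos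
  obtain ⟨L, hL⟩ := hu.exists_lipDisc
  have hH0 : 0 ≤ harmonicEnergy u / Real.pi := div_nonneg hL.harmonicEnergy_nonneg hpi.le
  have h1 := integral_exp_mul_integral_exp_le (γ := 9 / 10) (by norm_num) (by norm_num) hs hu hS₁ hS₂ hsep
  have h2 := lowMass_le hu
  have h3 := integral_exp_one_boundary_le hu
  have hJ0 := lowMass_pos hu.continuous
  have i1 : Integrable (fun z => Real.exp (u z)) arcLength :=
    integrable_arcLength (by have := hu.continuous; fun_prop)
  have k1 : ∫ z in S₁, Real.exp (u z) ∂arcLength ≤ ∫ z, Real.exp (u z) ∂arcLength :=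
    setIntegral_le_integral i1 (ae_of_all _ fun _ => (Real.exp_pos _).le)
  have k2 : ∫ z in S₂, Real.exp (u z) ∂arcLength ≤ ∫ z, Real.exp (u z) ∂arcLength :=
    setIntegral_le_integral i1 (ae_of_all _ fun _ => (Real.exp_pos _).le)
  have n1 : 0 ≤ ∫ z in S₁, Real.exp (u z) ∂arcLength := integral_nonneg fun _ => (Real.exp_pos _).le
  have n2 : 0 ≤ ∫ z in S₂, Real.exp (u z) ∂arcLength := integral_nonneg fun _ => (Real.exp_pos _).le
  set A := ∫ z, Real.exp (u z) ∂arcLength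
  set A₁ := ∫ z in S₁, Real.exp (u z) ∂arcLength
  set A₂ := ∫ z in S₂, Real.exp (u z) ∂arcLength
  set J := lowMass u
  set h := harmonicEnergy u / Real.pi
  -- The products A₁ A₂, J A and J J carry H/π with coefficients 5/18, 5/144 + 5/18 = 5/16 and 5/72.
  -- The largest is 5/16, and one of the two factors of (A₁ + J)(A₂ + J) receives at most half of
  -- it.
  set X := Real.exp (2 * cmean u + 5 / 16 * h + k) with hX
  have l1 : A₁ * A₂ ≤ X := by
    refine h1.trans (Real.exp_le_exp.2 ?_)
    have : 1 / (4 * Real.pi * (9 / 10)) * harmonicEnergy u = 5 / 18 * h := by simp only [h]; ring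
    rw [this]
    have := le_max_left (2 * (9 / 10 * Real.log (2 / s) + logCircleConst))
      (max (9 * logCircleConst) (16 * logCircleConst))
    rw [logCircleConst] at this
    rw [hk, logCircleConst]
    linarith
  have l2 : J * A ≤ X := by
    have hA0 : 0 ≤ A := n1.trans k1
    refine (mul_le_mul h2 h3 hA0 (Real.exp_pos _).le).trans ?_
    rw [← Real.exp_add]
    refine Real.exp_le_exp.2 ?_
    have := (le_max_left (9 * logCircleConst) (16 * logCircleConst)).trans
      (le_max_right (2 * (9 / 10 * Real.log (2 / s) + logCircleConst)) _)
    linarith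
  have l3 : J * J ≤ X := by
    refine (mul_le_mul h2 h2 hJ0.le (Real.exp_pos _).le).trans ?_
    rw [← Real.exp_add]
    refine Real.exp_le_exp.2 ?_
    have := (le_max_right (9 * logCircleConst) (16 * logCircleConst)).trans
      (le_max_right (2 * (9 / 10 * Real.log (2 / s) + logCircleConst)) _)
    linarith
  have l4 : (A₁ + J) * (A₂ + J) ≤ 4 * X := by
    nlinarith [mul_le_mul_of_nonneg_left k1 hJ0.le, mul_le_mul_of_nonneg_left k2 hJ0.le]
  set Y := Real.exp (cmean u + 5 / 32 * h + 1 / 2 * (k + Real.log 4)) with hY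
  have l5 : 4 * X = Y * Y := by
    rw [hX, hY, ← Real.exp_add]
    have : (4 : ℝ) = Real.exp (Real.log 4) := (Real.exp_log (by norm_num)).symm
    nth_rewrite 1 [this]
    rw [← Real.exp_add]
    congr 1; ring
  by_contra! hcon
  have := mul_lt_mul'' hcon.1 hcon.2 (Real.exp_pos _).le (Real.exp_pos _).le
  linarith

/-! ### Balance of mass and opposite caps. -/

section Cap

variable {μ : Measure ℂ} [IsFiniteMeasure μ]

/-- A quantitative form of: a measure whose barycentre is near zero charges both sides. -/
lemma mass_cap_ge (hμ : ∀ᵐ z ∂μ, ‖z‖ ≤ 1) {R₀ : ℝ} (hR₀ : 0 < R₀) {c : ℂ → ℝ} (hc : Measurable c)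
    (hc1 : ∀ z, ‖z‖ ≤ 1 → R₀ ≤ c z ∧ c z ≤ 2) {g : ℂ →L[ℝ] ℝ} (hg : ∀ z, |g z| ≤ ‖z‖)
    (h1 : |∫ z, c z * g z ∂μ| ≤ R₀ / 16 * μ.real univ) (h2 : μ.real univ / 8 ≤ ∫ z, |g z| ∂μ) :
    R₀ / 128 * μ.real univ ≤ μ.real {z | R₀ / 128 ≤ g z} := by
  have hgm : Measurable g := g.continuous.measurable
  have hms : MeasurableSet {z | R₀ / 128 ≤ g z} := measurableSet_le measurable_const hgm
  have i0 : Integrable (fun z => |g z|) μ := by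
    refine Integrable.of_bound hgm.abs.aestronglyMeasurable 1 ?_
    filter_upwards [hμ] with z hz
    rw [Real.norm_eq_abs, abs_abs]; exact (hg z).trans hz
  have i1 : Integrable (fun z => c z * g z) μ := by
    refine Integrable.of_bound (hc.mul hgm).aestronglyMeasurable (2 * 1) ?_
    filter_upwards [hμ] with z hz
    obtain ⟨l1, l2⟩ := hc1 z hz
    rw [norm_mul, Real.norm_of_nonneg (by linarith)]
    gcongr
    exact (hg z).trans hz
  have i2 : Integrable ({z | R₀ / 128 ≤ g z}.indicator fun _ => (2 : ℝ)) μ :=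
    (integrable_const _).indicator hms
  -- Where g < 0 the integrand is nonpositive because c ≥ R₀. Where 0 ≤ g < R₀/128 it is at most 4 ·
  -- R₀/128, and on the cap at most 4. The left side is at least (R₀/8 - R₀/16) times the total
  -- mass.
  have key : ∫ z, (R₀ * |g z| + c z * g z) ∂μ ≤
      ∫ z, (R₀ / 32 + 2 * {z | R₀ / 128 ≤ g z}.indicator (fun _ => (2 : ℝ)) z) ∂μ := by
    refine integral_mono_ae ((i0.const_mul _).add i1) ((integrable_const _).add (i2.const_mul 2)) ?_
    filter_upwards [hμ] with z hz
    obtain ⟨l1, l2⟩ := hc1 z hz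
    have l3 := (hg z).trans hz
    by_cases h : R₀ / 128 ≤ g z
    · rw [indicator_of_mem (show z ∈ {z | R₀ / 128 ≤ g z} from h)]
      have h0 : 0 ≤ g z := by linarith
      rw [abs_of_nonneg h0] at l3 ⊢
      nlinarith
    · rw [indicator_of_notMem (show z ∉ {z | R₀ / 128 ≤ g z} from h)]
      rw [not_le] at h
      rcases le_total 0 (g z) with h0 | h0
      · rw [abs_of_nonneg h0]
        nlinarith
      · rw [abs_of_nonpos h0]
        nlinarith
  rw [integral_add (i0.const_mul _) i1, integral_const_mul, integral_add (integrable_const _)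
    (i2.const_mul 2), integral_const_mul, integral_const, integral_indicator hms, integral_const,
    measureReal_restrict_apply_univ, smul_eq_mul, smul_eq_mul] at key
  have := (abs_le.1 h1).1
  nlinarith [mul_le_mul_of_nonneg_left h2 hR₀.le]

end Cap

/-- The measure `½ e^{2u} dz + e^u ds₀`. -/
def massMeasure (u : ℂ → ℝ) : Measure ℂ :=
  (volume.restrict disc).withDensity (fun z => ENNReal.ofReal (1 / 2 * Real.exp (2 * u z))) +
    arcLength.withDensity fun z => ENNReal.ofReal (Real.exp (u z))

section MassMeasure

variable {u : ℂ → ℝ} (hu : Continuous u)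
include hu

lemma isFiniteMeasure_massMeasure : IsFiniteMeasure (massMeasure u) := by
  have i1 : Integrable (fun z => 1 / 2 * Real.exp (2 * u z)) (volume.restrict disc) :=
    (memLp_of_continuousOn (by fun_prop : Continuous _).continuousOn 1).integrable le_rfl
  have i2 : Integrable (fun z => Real.exp (u z)) arcLength := integrable_arcLength (by fun_prop)
  have := isFiniteMeasure_withDensity_ofReal i1.2
  have := isFiniteMeasure_withDensity_ofReal i2.2
  unfold massMeasure
  infer_instance

omit hu in
lemma ae_massMeasure {P : ℂ → Prop} (h1 : ∀ z ∈ disc, P z) (h2 : ∀ z, ‖z‖ = 1 → P z) :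
    ∀ᵐ z ∂(massMeasure u), P z := by
  rw [massMeasure, ae_add_measure_iff]
  exact ⟨withDensity_absolutelyContinuous _ _ |>.ae_le ((ae_restrict_mem measurableSet_disc).mono h1),
    withDensity_absolutelyContinuous _ _ |>.ae_le (ae_arcLength_norm.mono h2)⟩

lemma integral_massMeasure {f : ℂ → ℝ} (hf : Integrable f (massMeasure u)) :
    ∫ z, f z ∂(massMeasure u) = 1 / 2 * (∫ z in disc, Real.exp (2 * u z) * f z) +
      ∫ z, Real.exp (u z) * f z ∂arcLength := by
  have h := integrable_add_measure.1 hf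
  rw [massMeasure, integral_add_measure h.1 h.2,
    integral_withDensity_eq_integral_toReal_smul (by fun_prop)
      (ae_of_all _ fun _ => ENNReal.ofReal_lt_top),
    integral_withDensity_eq_integral_toReal_smul (by fun_prop)
      (ae_of_all _ fun _ => ENNReal.ofReal_lt_top), ← integral_const_mul]
  congr 2
  · ext z; rw [ENNReal.toReal_ofReal (by positivity), smul_eq_mul, mul_assoc]
  · ext z; rw [ENNReal.toReal_ofReal (by positivity), smul_eq_mul]

lemma massMeasure_real {s : Set ℂ} (hs : MeasurableSet s) : (massMeasure u).real s =
    1 / 2 * (∫ z in disc ∩ s, Real.exp (2 * u z)) + ∫ z in s, Real.exp (u z) ∂arcLength := by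
  have := isFiniteMeasure_massMeasure hu
  have h := integral_massMeasure hu ((integrable_const (1 : ℝ)).indicator hs)
  rw [integral_indicator hs, integral_const, measureReal_restrict_apply_univ, smul_eq_mul, mul_one] at h
  rw [h, ← integral_indicator hs, inter_comm, ← Measure.restrict_restrict hs, ← integral_indicator hs]
  congr 2
  · congr 1; ext z; by_cases hz : z ∈ s <;> simp [hz]
  · ext z; by_cases hz : z ∈ s <;> simp [hz]

end MassMeasure

/-- A cap whose boundary piece has small mass controls everything it has a fixed share of. -/
lemma exists_massBound_of_cap {a δ : ℝ} (ha : 0 < a) (hδ : 0 < δ) (b : ℝ) : ∃ C, ∀ u : ℂ → ℝ,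
    ContDiff ℝ ∞ u → ∀ g : ℂ →L[ℝ] ℝ, (∀ z, |g z| ≤ ‖z‖) →
    δ * (massMeasure u).real univ ≤ (massMeasure u).real {z | a ≤ g z} →
    ∫ z in {z | a / 2 ≤ g z}, Real.exp (u z) ∂arcLength + lowMass u ≤
        Real.exp (cmean u + 5 / 32 * (harmonicEnergy u / Real.pi) + b) → MassBound C u := by
  obtain ⟨C₁, hC₁⟩ := exists_integral_exp_disc_le (half_pos ha) b
  obtain ⟨C₂, hC₂⟩ := exists_massBound_of_disc (C₁ - 1 / 2 * Real.log δ)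
  obtain ⟨C₃, hC₃⟩ := exists_massBound_of_circle (b - Real.log δ)
  refine ⟨max C₂ C₃, fun u hu g hg hm hT => ?_⟩
  have hc := hu.continuous
  have hms : ∀ t : ℝ, MeasurableSet {z | t ≤ g z} := fun t =>
    measurableSet_le measurable_const g.continuous.measurable
  have hJ0 := lowMass_pos hc
  rw [massMeasure_real hc MeasurableSet.univ, massMeasure_real hc (hms a), inter_univ,
    Measure.restrict_univ] at hm
  -- A share δ of the total mass forces a share δ of the disc mass or of the circle mass. In the
  -- first case the points of the cap {a ≤ g} have distance at least a/2 from the circle outside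
  -- {a/2 ≤ g}, so the interior inequality applies.
  by_cases h : δ * ∫ z in disc, Real.exp (2 * u z) ≤ ∫ z in disc ∩ {z | a ≤ g z}, Real.exp (2 * u z)
  · refine (hC₂ u hu ?_).mono (le_max_left _ _)
    have h1 := hC₁ u hu {z | a / 2 ≤ g z} (disc ∩ {z | a ≤ g z}) (hms _)
      (measurableSet_disc.inter (hms _)) inter_subset_left (fun y hy z _ hz => by
        have h3 : a ≤ g y := hy.2
        have h4 : g z < a / 2 := not_le.1 hz
        have h5 := hg (z - y)
        rw [map_sub] at h5
        linarith [neg_le_abs (g z - g y)]) hT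
    rw [← le_div_iff₀' hδ] at h
    refine h.trans ?_
    rw [div_le_iff₀' hδ]
    nth_rewrite 1 [← Real.exp_log hδ]
    rw [← Real.exp_add]
    exact h1.trans (Real.exp_le_exp.2 (by linarith))
  · have h1 : δ * ∫ z, Real.exp (u z) ∂arcLength ≤ ∫ z in {z | a ≤ g z}, Real.exp (u z) ∂arcLength := by
      linarith
    refine (hC₃ u hu ?_).mono (le_max_right _ _)
    have h2 : ∫ z in {z | a ≤ g z}, Real.exp (u z) ∂arcLength ≤
        ∫ z in {z | a / 2 ≤ g z}, Real.exp (u z) ∂arcLength := by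
      refine setIntegral_mono_set (integrable_arcLength (by fun_prop)).integrableOn
        (ae_of_all _ fun _ => (Real.exp_pos _).le) (ae_of_all _ fun z hz => ?_)
      exact (by linarith : a / 2 ≤ a).trans hz
    have h3 : δ * ∫ z, Real.exp (u z) ∂arcLength ≤
        Real.exp (cmean u + 5 / 32 * (harmonicEnergy u / Real.pi) + b) := by linarith
    rw [← le_div_iff₀' hδ] at h3
    refine h3.trans (le_of_eq ?_)
    rw [← add_sub_assoc, Real.exp_sub, Real.exp_log hδ]

/-- The enlarged caps {a/2 ≤ g} and {a/2 ≤ -g} are still at distance at least a, so one of their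
boundary pieces is light; either one suffices because both caps carry a fixed share of the mass. -/
lemma exists_massBound_of_caps {a δ : ℝ} (ha : 0 < a) (hδ : 0 < δ) : ∃ C, ∀ u : ℂ → ℝ,
    ContDiff ℝ ∞ u → ∀ g : ℂ →L[ℝ] ℝ, (∀ z, |g z| ≤ ‖z‖) →
    δ * (massMeasure u).real univ ≤ (massMeasure u).real {z | a ≤ g z} →
    δ * (massMeasure u).real univ ≤ (massMeasure u).real {z | a ≤ (-g) z} → MassBound C u := by
  obtain ⟨b, hb⟩ := exists_mass_le_of_separated ha
  obtain ⟨C, hC⟩ := exists_massBound_of_cap ha hδ b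
  refine ⟨C, fun u hu g hg h1 h2 => ?_⟩
  have hms : ∀ g : ℂ →L[ℝ] ℝ, MeasurableSet {z | a / 2 ≤ g z} := fun g =>
    measurableSet_le measurable_const g.continuous.measurable
  rcases hb u hu {z | a / 2 ≤ g z} {z | a / 2 ≤ (-g) z} (hms g) (hms (-g)) (fun x hx y hy => by
    have h3 : a / 2 ≤ g x := hx
    have h4 : a / 2 ≤ -g y := hy
    have h5 := hg (x - y)
    rw [map_sub] at h5
    linarith [le_abs_self (g x - g y)]) with h | h
  · exact hC u hu g hg h1 h
  · exact hC u hu (-g) (fun z => by simpa using hg z) h2 h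

/-- The coefficient of `psi R`. -/
def psiCoeff (R : ℝ) (z : ℂ) : ℝ := 2 * R / (1 + ‖(R : ℂ) * z‖ ^ 2)

lemma psiCoeff_bounds {R₀ R : ℝ} (hR₀ : 0 < R₀) (h : R₀ ≤ R) (hR : R < 1) {z : ℂ} (hz : ‖z‖ ≤ 1) :
    R₀ ≤ psiCoeff R z ∧ psiCoeff R z ≤ 2 := by
  have h1 : ‖(R : ℂ) * z‖ ≤ 1 := by
    rw [norm_mul, Complex.norm_real, Real.norm_of_nonneg (by linarith)]
    nlinarith [norm_nonneg z]
  have h0 := norm_nonneg ((R : ℂ) * z)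
  unfold psiCoeff
  rw [le_div_iff₀ (by positivity), div_le_iff₀ (by positivity)]
  have h2 : ‖(R : ℂ) * z‖ ^ 2 ≤ 1 := pow_le_one₀ h0 h1
  have h3 := sq_nonneg ‖(R : ℂ) * z‖
  constructor <;> nlinarith

/-- The centre of mass vector. -/
def centreVector (R : ℝ) (u τ : ℂ → ℝ) : ℂ :=
  (1 / 2 : ℝ) • (∫ z in disc, Real.exp (2 * u z) • psi R z) +
    ∫ z, Real.exp (τ z) • psi R z ∂arcLength

lemma continuous_psi (R : ℝ) : Continuous (psi R) := by
  have : Continuous (psiCoeff R) := by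
    unfold psiCoeff
    exact continuous_const.div (by fun_prop) fun z => by positivity
  exact this.smul continuous_id

/-- The exponential inequality for smooth functions that are almost centred. -/
theorem exists_massBound_of_centred {R₀ : ℝ} (hR₀ : 0 < R₀) : ∃ C, ∀ u : ℂ → ℝ, ContDiff ℝ ∞ u →
    ∀ R, R₀ ≤ R → R < 1 → ‖centreVector R u u‖ ≤ R₀ / 16 * (massMeasure u).real univ →
    MassBound C u := by
  obtain ⟨C₁, hC₁⟩ := exists_massBound_of_caps (a := R₀ / 128) (δ := R₀ / 128) (by positivity) (by positivity)
  obtain ⟨C₂, hC₂⟩ := exists_integral_exp_disc_le (s := 1 / 2) (by norm_num) (8 * logCircleConst)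
  obtain ⟨C₃, hC₃⟩ := exists_massBound_of_disc (C₂ + 1 / 2 * Real.log 2)
  refine ⟨max C₁ C₃, fun u hu R hR hR1 h => ?_⟩
  have hc := hu.continuous
  have hpi := Real.pi_pos
  obtain ⟨L, hL⟩ := hu.exists_lipDisc
  have hfin := isFiniteMeasure_massMeasure hc
  have hb : MeasurableSet (Metric.ball (0 : ℂ) (1 / 2)) := Metric.isOpen_ball.measurableSet
  have hsub : Metric.ball (0 : ℂ) (1 / 2) ⊆ disc := Metric.ball_subset_ball (by norm_num)
  -- Balance is no information when the mass sits near the centre. There the whole circle is at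
  -- distance at least 1/2, so S = ∅ is allowed and only `lowMass` enters.
  by_cases hD : ∫ z in disc, Real.exp (2 * u z) ≤ 2 * ∫ z in Metric.ball (0 : ℂ) (1 / 2), Real.exp (2 * u z)
  · refine (hC₃ u hu (hD.trans ?_)).mono (le_max_right _ _)
    have hH0 : 0 ≤ harmonicEnergy u / Real.pi := div_nonneg hL.harmonicEnergy_nonneg hpi.le
    have h1 := hC₂ u hu ∅ (Metric.ball 0 (1 / 2)) MeasurableSet.empty hb hsub (fun y hy z hz _ => by
      have h2 := norm_sub_norm_le z y
      rw [mem_ball_zero_iff] at hy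
      linarith) (by
      have := lowMass_le hu
      rw [Measure.restrict_empty, integral_zero_measure, zero_add]
      exact this.trans (Real.exp_le_exp.2 (by linarith)))
    refine (mul_le_mul_of_nonneg_left h1 zero_le_two).trans (le_of_eq ?_)
    nth_rewrite 1 [← Real.exp_log two_pos]
    rw [← Real.exp_add]; congr 1; ring
  · refine MassBound.mono ?_ (le_max_left C₁ C₃)
    set μ := massMeasure u with hμ
    have hμ1 : ∀ᵐ z ∂μ, ‖z‖ ≤ 1 := ae_massMeasure (fun z hz => (mem_disc.1 hz).le) fun z hz => hz.le
    have hmc : Measurable (psiCoeff R) := by unfold psiCoeff; fun_prop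
    have habs : ∀ g : ℂ →L[ℝ] ℝ, (∀ z, |g z| ≤ ‖z‖) → Integrable (fun z => |g z|) μ := fun g hg => by
      refine Integrable.of_bound g.continuous.measurable.abs.aestronglyMeasurable 1 ?_
      filter_upwards [hμ1] with z hz
      rw [Real.norm_eq_abs, abs_abs]; exact (hg z).trans hz
    have hcv : ∀ g : ℂ →L[ℝ] ℝ, (∀ z, |g z| ≤ ‖z‖) →
        |∫ z, psiCoeff R z * g z ∂μ| ≤ R₀ / 16 * μ.real univ := fun g hg => by
      have i0 : Integrable (fun z => psiCoeff R z * g z) μ := by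
        refine Integrable.of_bound (hmc.mul g.continuous.measurable).aestronglyMeasurable (2 * 1) ?_
        filter_upwards [hμ1] with z hz
        obtain ⟨l1, l2⟩ := psiCoeff_bounds hR₀ hR hR1 hz
        rw [norm_mul, Real.norm_of_nonneg (by linarith)]
        gcongr
        exact (hg z).trans hz
      have e : g (centreVector R u u) = ∫ z, psiCoeff R z * g z ∂μ := by
        have hp := continuous_psi R
        have j1 : Integrable (fun z => Real.exp (2 * u z) • psi R z) (volume.restrict disc) := by
          have : Continuous fun z => Real.exp (2 * u z) • psi R z := by fun_prop
          exact (this.continuousOn.integrableOn_compact (isCompact_closedBall (0 : ℂ) 1)).mono_set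
            Metric.ball_subset_closedBall
        have j2 : Integrable (fun z => Real.exp (u z) • psi R z) arcLength := by
          obtain ⟨K, hK⟩ := (isCompact_sphere (0 : ℂ) 1).exists_bound_of_continuousOn
            (by fun_prop : Continuous fun z => Real.exp (u z) • psi R z).continuousOn
          refine Integrable.of_bound (by fun_prop : Continuous fun z =>
            Real.exp (u z) • psi R z).aestronglyMeasurable K ?_
          filter_upwards [ae_arcLength_norm] with z hz
          exact hK z (by simpa using hz)
        rw [integral_massMeasure hc i0, centreVector, map_add, map_smul, ← g.integral_comp_comm j1,
          ← g.integral_comp_comm j2, smul_eq_mul]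
        simp only [map_smul, psi, smul_eq_mul, psiCoeff]
      rw [← e]
      exact (hg _).trans h
    -- At least half of the total mass lies where ‖z‖ ≥ 1/2, so one of the two coordinates has first
    -- absolute moment at least an eighth of the mass.
    have hsum : μ.real univ / 4 ≤ ∫ z, |Complex.reCLM z| ∂μ + ∫ z, |Complex.imCLM z| ∂μ := by
      rw [← integral_add (habs _ Complex.abs_re_le_norm) (habs _ Complex.abs_im_le_norm)]
      have h1 : ∫ z, ((Metric.ball (0 : ℂ) (1 / 2))ᶜ.indicator (fun _ => (1 / 2 : ℝ)) z) ∂μ ≤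
          ∫ z, (|Complex.reCLM z| + |Complex.imCLM z|) ∂μ := by
        refine integral_mono ((integrable_const _).indicator hb.compl)
          ((habs _ Complex.abs_re_le_norm).add (habs _ Complex.abs_im_le_norm)) fun z => ?_
        by_cases hz : z ∈ Metric.ball (0 : ℂ) (1 / 2)
        · rw [indicator_of_notMem (by simpa using hz)]; positivity
        · rw [indicator_of_mem (by simpa using hz)]
          have := Complex.norm_le_abs_re_add_abs_im z
          rw [mem_ball_zero_iff, not_lt] at hz
          exact hz.trans this
      rw [integral_indicator hb.compl, integral_const, measureReal_restrict_apply_univ,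
        measureReal_compl hb, smul_eq_mul, massMeasure_real hc hb, inter_eq_right.2 hsub] at h1
      have h2 : ∫ z in Metric.ball (0 : ℂ) (1 / 2), Real.exp (u z) ∂arcLength = 0 := by
        rw [setIntegral_measure_zero]
        refine measure_mono_null (fun z hz => ?_) (ae_iff.1 ae_arcLength_norm)
        rw [mem_ball_zero_iff] at hz
        exact fun h => by linarith
      have h3 := massMeasure_real hc MeasurableSet.univ
      rw [inter_univ, Measure.restrict_univ, ← hμ] at h3
      have h4 : 0 ≤ ∫ z, Real.exp (u z) ∂arcLength := integral_nonneg fun _ => (Real.exp_pos _).le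
      rw [h2] at h1
      linarith
    have concl : ∀ g : ℂ →L[ℝ] ℝ, (∀ z, |g z| ≤ ‖z‖) → μ.real univ / 8 ≤ ∫ z, |g z| ∂μ →
        MassBound C₁ u := fun g hg h8 => by
      have hn : ∀ z, |(-g) z| ≤ ‖z‖ := fun z => by simpa using hg z
      exact hC₁ u hu g hg
        (mass_cap_ge hμ1 hR₀ hmc (fun z hz => psiCoeff_bounds hR₀ hR hR1 hz) hg (hcv g hg) h8)
        (mass_cap_ge hμ1 hR₀ hmc (fun z hz => psiCoeff_bounds hR₀ hR hR1 hz) hn (hcv (-g) hn)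
          (by simpa using h8))
    by_cases h8 : μ.real univ / 8 ≤ ∫ z, |Complex.reCLM z| ∂μ
    · exact concl Complex.reCLM Complex.abs_re_le_norm h8
    · exact concl Complex.imCLM Complex.abs_im_le_norm (by linarith)

/-! ### Approximation by functions smooth up to the boundary. -/

section DilateShift

variable {F : Type*} [NormedAddCommGroup F]

/-- The Jacobian factor in the plane is l⁻² ≤ 4, so composition with these maps is bounded on L²
uniformly in l. -/
lemma map_dilate_shift_le {l : ℝ} (hl : 1 / 2 ≤ l) (y : ℂ) :
    (volume : Measure ℂ).map (fun z => l • z - y) ≤ (4 : ENNReal) • volume := by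
  have h0 : 0 < l := by linarith
  have e : (fun z : ℂ => l • z - y) = (fun z => z - y) ∘ (fun z => l • z) := rfl
  rw [e, ← Measure.map_map (by fun_prop) (by fun_prop), Measure.map_addHaar_smul _ h0.ne',
    Measure.map_smul, map_sub_right_eq_self, Complex.finrank_real_complex]
  refine Measure.le_iff.2 fun s _ => ?_
  simp only [Measure.smul_apply, smul_eq_mul]
  gcongr
  rw [abs_of_pos (by positivity), ENNReal.ofReal_le_iff_le_toReal (by simp), ENNReal.toReal_ofNat,
    inv_le_comm₀ (by positivity) (by norm_num)]
  nlinarith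

lemma aestronglyMeasurable_dilate_shift {f : ℂ → F} (hf : AEStronglyMeasurable f volume) {l : ℝ}
    (hl : 1 / 2 ≤ l) (y : ℂ) : AEStronglyMeasurable (fun z => f (l • z - y)) volume := by
  have hq : Measure.QuasiMeasurePreserving (fun z : ℂ => l • z - y) volume volume :=
    ⟨by fun_prop, (Measure.absolutelyContinuous_of_le (map_dilate_shift_le hl y)).trans
      Measure.smul_absolutelyContinuous⟩
  exact hf.comp_quasiMeasurePreserving hq

lemma eLpNorm_dilate_shift_le {f : ℂ → F} (hf : AEStronglyMeasurable f volume) {l : ℝ}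
    (hl : 1 / 2 ≤ l) (y : ℂ) :
    eLpNorm (fun z => f (l • z - y)) 2 volume ≤ 2 * eLpNorm f 2 volume := by
  have hle := map_dilate_shift_le hl y
  have hm : AEMeasurable (fun z : ℂ => l • z - y) volume := by fun_prop
  have hac : (volume : Measure ℂ).map (fun z => l • z - y) ≪ volume :=
    (Measure.absolutelyContinuous_of_le hle).trans Measure.smul_absolutelyContinuous
  have e : eLpNorm (fun z => f (l • z - y)) 2 volume =
      eLpNorm f 2 ((volume : Measure ℂ).map (fun z => l • z - y)) :=
    (eLpNorm_map_measure (hf.mono_ac hac) hm).symm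
  rw [e]
  refine (eLpNorm_mono_measure f hle).trans ?_
  rw [eLpNorm_smul_measure_of_ne_top (by simp), smul_eq_mul]
  gcongr
  have : (4 : ENNReal) = 2 ^ (2 : ℝ) := by norm_num
  rw [this, ← ENNReal.rpow_mul]
  norm_num

/-- Dilations and translations act continuously on `L²`. -/
lemma exists_eLpNorm_dilate_shift_sub_le {f : ℂ → F} [NormedSpace ℝ F] (hf : MemLp f 2 volume) {η : ENNReal}
    (hη : η ≠ 0) : ∃ δ > 0, δ ≤ 1 / 2 ∧ ∀ l : ℝ, 1 - δ ≤ l → l ≤ 1 → ∀ y : ℂ, ‖y‖ ≤ δ →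
      eLpNorm (fun z => f (l • z - y) - f z) 2 volume ≤ η := by
  have hη4 : η / 4 ≠ 0 := by simp [hη]
  obtain ⟨g, hgc, hfg, hg, hgL⟩ := hf.exists_hasCompactSupport_eLpNorm_sub_le (by simp) hη4
  obtain ⟨r, hr0, hr⟩ : ∃ r : ℝ, 0 ≤ r ∧ ∀ z, r < ‖z‖ → g z = 0 := by
    obtain ⟨r, hr⟩ := hgc.isCompact.isBounded.subset_closedBall 0
    refine ⟨max r 0, le_max_right _ _, fun z hz => ?_⟩
    by_contra h
    have := hr (subset_tsupport g h)
    rw [mem_closedBall_zero_iff] at this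
    exact absurd (this.trans (le_max_left r 0)) (not_le.2 hz)
  set s := 2 * r + 2 with hs
  obtain ⟨t₀, ht₀, ht₁⟩ : ∃ t₀ : ℝ, 0 < t₀ ∧
      volume (Metric.closedBall (0 : ℂ) s) ^ (2⁻¹ : ℝ) * ENNReal.ofReal t₀ ≤ η / 4 := by
    have hfin : volume (Metric.closedBall (0 : ℂ) s) ^ (2⁻¹ : ℝ) ≠ ⊤ :=
      ENNReal.rpow_ne_top_of_nonneg (by norm_num) measure_closedBall_lt_top.ne
    have ht : Tendsto (fun t₀ : ℝ => volume (Metric.closedBall (0 : ℂ) s) ^ (2⁻¹ : ℝ) * ENNReal.ofReal t₀)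
        (𝓝[>] 0) (𝓝 0) := by
      have := ENNReal.Tendsto.const_mul (a := volume (Metric.closedBall (0 : ℂ) s) ^ (2⁻¹ : ℝ))
        (((ENNReal.continuous_ofReal.tendsto (0 : ℝ)).mono_left nhdsWithin_le_nhds :
          Tendsto ENNReal.ofReal (𝓝[>] 0) _)) (Or.inr hfin)
      simpa using this
    obtain ⟨t₀, h1, h2⟩ := ((ht.eventually (gt_mem_nhds (pos_iff_ne_zero.2 hη4))).and
      self_mem_nhdsWithin).exists
    exact ⟨t₀, h2, h1.le⟩
  obtain ⟨d, hd0, hd⟩ := Metric.uniformContinuous_iff.1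
    (hgc.uniformContinuous_of_continuous hg) t₀ ht₀
  refine ⟨min (1 / 2) (d / (2 * (s + 1))), by positivity, min_le_left _ _, fun l hl hl1 y hy => ?_⟩
  have hl2 : 1 / 2 ≤ l := by linarith [min_le_left (1 / 2) (d / (2 * (s + 1)))]
  have hy2 : ‖y‖ ≤ 1 / 2 := hy.trans (min_le_left _ _)
  have h1 : eLpNorm (fun z => g (l • z - y) - g z) 2 volume ≤ η / 4 := by
    have hsupp : Function.support (fun z => g (l • z - y) - g z) ⊆ Metric.closedBall 0 s := by
      intro z hz
      rw [mem_closedBall_zero_iff]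
      by_contra! hzs
      refine hz ?_
      have e1 : g z = 0 := hr z (by linarith)
      have e2 : g (l • z - y) = 0 := by
        refine hr _ ?_
        have := norm_sub_norm_le (l • z) y
        rw [norm_smul, Real.norm_of_nonneg (by linarith)] at this
        nlinarith
      simp only [e1, e2, sub_zero]
    rw [← eLpNorm_restrict_eq_of_support_subset hsupp]
    refine (eLpNorm_le_of_ae_bound (C := t₀) ?_).trans ?_
    · refine (ae_restrict_mem Metric.isClosed_closedBall.measurableSet).mono fun z hz => ?_
      rw [mem_closedBall_zero_iff] at hz
      rw [← dist_eq_norm]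
      refine (hd ?_).le
      rw [dist_eq_norm]
      have e : l • z - y - z = -((1 - l) • z + y) := by rw [sub_smul, one_smul]; abel
      rw [e, norm_neg]
      have h3 : min (1 / 2) (d / (2 * (s + 1))) * (2 * (s + 1)) ≤ d := by
        rw [← le_div_iff₀ (by positivity)]; exact min_le_right _ _
      have h4 : 0 < min (1 / 2) (d / (2 * (s + 1))) := by positivity
      calc _ ≤ (1 - l) * ‖z‖ + ‖y‖ := by
            refine (norm_add_le _ _).trans ?_
            rw [norm_smul, Real.norm_of_nonneg (by linarith)]
        _ ≤ min (1 / 2) (d / (2 * (s + 1))) * s + min (1 / 2) (d / (2 * (s + 1))) := by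
            gcongr
            linarith
        _ < d := by nlinarith
    · rw [Measure.restrict_apply_univ, ENNReal.toReal_ofNat]
      exact ht₁
  have m1 := (hf.1.sub hgL.1)
  have h2 : eLpNorm (fun z => (f - g) (l • z - y)) 2 volume ≤ 2 * (η / 4) :=
    (eLpNorm_dilate_shift_le m1 hl2 y).trans (by gcongr)
  have e : (fun z => f (l • z - y) - f z) = (fun z => (f - g) (l • z - y)) +
      (fun z => g (l • z - y) - g z) - (f - g) := by
    ext z; simp only [Pi.sub_apply, Pi.add_apply]; abel
  have m2 : AEStronglyMeasurable (fun z => g (l • z - y) - g z) volume :=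
    (aestronglyMeasurable_dilate_shift hgL.1 hl2 y).sub hgL.1
  have m3 := aestronglyMeasurable_dilate_shift m1 hl2 y
  rw [e]
  refine (eLpNorm_sub_le (m3.add m2) m1 (by norm_num)).trans ?_
  refine (add_le_add (eLpNorm_add_le m3 m2 (by norm_num)) hfg).trans ?_
  refine (add_le_add (add_le_add h2 h1) le_rfl).trans (le_of_eq ?_)
  have : 2 * (η / 4) + η / 4 + η / 4 = 4 * (η / 4) := by ring
  rw [this, ENNReal.mul_div_cancel (by norm_num) (by simp)]

/-- Averages of small dilations and translations are close in `L²`. -/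
lemma eLpNorm_average_le [NormedSpace ℝ F] {f : ℂ → F} (hf : StronglyMeasurable f)
    {P : Measure ℂ} [IsProbabilityMeasure P] {l : ℝ} {η : ENNReal}
    (h : ∀ᵐ y ∂P, eLpNorm (fun z => f (l • z - y) - f z) 2 volume ≤ η) :
    eLpNorm (fun z => ∫ y, (f (l • z - y) - f z) ∂P) 2 volume ≤ η := by
  have hm : StronglyMeasurable (fun p : ℂ × ℂ => f (l • p.1 - p.2) - f p.1) :=
    (hf.comp_measurable (by fun_prop)).sub (hf.comp_measurable measurable_fst)
  -- Jensen's inequality for the square; integrating in z and exchanging the integrals reduces to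
  -- the individual shifts.
  have key : ∀ z, ‖∫ y, (f (l • z - y) - f z) ∂P‖ₑ ^ (2 : ℝ) ≤
      ∫⁻ y, ‖f (l • z - y) - f z‖ₑ ^ (2 : ℝ) ∂P := fun z => by
    have hmz : AEStronglyMeasurable (fun y => f (l • z - y) - f z) P :=
      (hm.comp_measurable (by fun_prop : Measurable fun y : ℂ => (z, y))).aestronglyMeasurable
    have h1 := eLpNorm_le_eLpNorm_of_exponent_le (p := 1) (q := 2) (by norm_num) hmz
    rw [eLpNorm_one_eq_lintegral_enorm, eLpNorm_eq_lintegral_rpow_enorm_toReal (by simp) (by simp),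
      ENNReal.toReal_ofNat] at h1
    calc _ ≤ ((∫⁻ y, ‖f (l • z - y) - f z‖ₑ ^ (2 : ℝ) ∂P) ^ (1 / 2 : ℝ)) ^ (2 : ℝ) := by
          gcongr
          exact (enorm_integral_le_lintegral_enorm _).trans h1
      _ = _ := by rw [← ENNReal.rpow_mul]; norm_num
  rw [eLpNorm_eq_lintegral_rpow_enorm_toReal (by simp) (by simp), ENNReal.toReal_ofNat,
    one_div, ENNReal.rpow_inv_le_iff (by norm_num)]
  calc _ ≤ ∫⁻ z, ∫⁻ y, ‖f (l • z - y) - f z‖ₑ ^ (2 : ℝ) ∂P := lintegral_mono key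
    _ = ∫⁻ y, ∫⁻ z, ‖f (l • z - y) - f z‖ₑ ^ (2 : ℝ) ∂volume ∂P :=
        lintegral_lintegral_swap (hm.enorm.pow_const _).aemeasurable
    _ ≤ ∫⁻ _, η ^ (2 : ℝ) ∂P := by
        refine lintegral_mono_ae (h.mono fun y hy => ?_)
        rw [eLpNorm_eq_lintegral_rpow_enorm_toReal (by simp) (by simp), ENNReal.toReal_ofNat,
          one_div, ENNReal.rpow_inv_le_iff (by norm_num)] at hy
        exact hy
    _ = _ := by simp

end DilateShift

/-- The probability measure of a bump function. -/
def bumpMeasure (φ : ContDiffBump (0 : ℂ)) : Measure ℂ :=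
  volume.withDensity fun y => ENNReal.ofReal (φ.normed volume y)

section Bump

variable (φ : ContDiffBump (0 : ℂ))

lemma measurable_bump : Measurable (φ.normed volume) := φ.continuous_normed.measurable

instance : IsProbabilityMeasure (bumpMeasure φ) := ⟨by
  rw [bumpMeasure, withDensity_apply _ MeasurableSet.univ, Measure.restrict_univ,
    ← ofReal_integral_eq_lintegral_ofReal φ.integrable_normed (ae_of_all _ φ.nonneg_normed),
    φ.integral_normed, ENNReal.ofReal_one]⟩

lemma ae_bumpMeasure : ∀ᵐ y ∂(bumpMeasure φ), ‖y‖ ≤ φ.rOut := by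
  rw [bumpMeasure, ae_withDensity_iff (measurable_bump φ).ennreal_ofReal]
  refine ae_of_all _ fun y hy => ?_
  have : y ∈ Function.support (φ.normed volume) := fun h => hy (by rw [h, ENNReal.ofReal_zero])
  rw [φ.support_normed_eq, mem_ball_zero_iff] at this
  exact this.le

lemma integral_bumpMeasure {F : Type*} [NormedAddCommGroup F] [NormedSpace ℝ F] (f : ℂ → F) :
    ∫ y, f y ∂(bumpMeasure φ) = ∫ y, φ.normed volume y • f y := by
  rw [bumpMeasure, integral_withDensity_eq_integral_toReal_smul (measurable_bump φ).ennreal_ofReal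
    (ae_of_all _ fun _ => ENNReal.ofReal_lt_top)]
  congr 1; ext y; rw [ENNReal.toReal_ofReal (φ.nonneg_normed y)]

lemma integrable_bumpMeasure {F : Type*} [NormedAddCommGroup F] [NormedSpace ℝ F] {f : ℂ → F}
    (hf : Integrable f) : Integrable f (bumpMeasure φ) := by
  rw [bumpMeasure, integrable_withDensity_iff_integrable_smul' (measurable_bump φ).ennreal_ofReal
    (ae_of_all _ fun _ => ENNReal.ofReal_lt_top)]
  obtain ⟨K, hK⟩ := (φ.hasCompactSupport_normed (μ := volume)).exists_bound_of_continuous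
    φ.continuous_normed
  refine hf.bdd_smul K (measurable_bump φ).ennreal_ofReal.ennreal_toReal.aestronglyMeasurable
    (ae_of_all _ fun y => ?_)
  rw [ENNReal.toReal_ofReal (φ.nonneg_normed y)]
  exact hK y

end Bump

/-- Mollification of a function on the disc. -/
def mollify (φ : ContDiffBump (0 : ℂ)) (w : ℂ → ℝ) (x : ℂ) : ℝ := ∫ y, w (x - y) ∂(bumpMeasure φ)

lemma mollify_eq (φ : ContDiffBump (0 : ℂ)) (w : ℂ → ℝ) : mollify φ w =
    convolution (φ.normed volume) w (ContinuousLinearMap.lsmul ℝ ℝ) volume := by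
  ext x
  rw [mollify, integral_bumpMeasure, convolution_def]
  rfl

lemma contDiff_mollify (φ : ContDiffBump (0 : ℂ)) {w : ℂ → ℝ} (hw : Integrable w) :
    ContDiff ℝ ∞ (mollify φ w) := by
  rw [mollify_eq]
  exact φ.hasCompactSupport_normed.contDiff_convolution_left _ φ.contDiff_normed hw.locallyIntegrable

/-- The gradient of a mollification is the mollification of the weak gradient. -/
lemma gradient_mollify (φ : ContDiffBump (0 : ℂ)) {w : ℂ → ℝ} {G : ℂ → ℂ} (hw : Integrable w)
    (hG : Integrable G) (hw0 : ∀ z ∉ disc, w z = 0) (hG0 : ∀ z ∉ disc, G z = 0)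
    (h : IsWeakGrad w G) {x : ℂ} (hx : ‖x‖ + φ.rOut < 1) :
    gradient (mollify φ w) x = ∫ y, G (x - y) ∂(bumpMeasure φ) := by
  set ψ := φ.normed volume with hψ
  have hψc : HasCompactSupport ψ := φ.hasCompactSupport_normed
  have hψs : ContDiff ℝ ∞ ψ := φ.contDiff_normed
  refine ext_inner_right ℝ fun e => ?_
  rw [inner_gradient_left, mollify_eq]
  have hd := hψc.hasFDerivAt_convolution_left (𝕜 := ℝ) (ContinuousLinearMap.lsmul ℝ ℝ)
    (hψs.of_le (by simp)) hw.locallyIntegrable x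
  rw [hd.fderiv, convolution_def, ContinuousLinearMap.integral_apply]
  · have iG : Integrable (fun y => G (x - y)) (bumpMeasure φ) :=
      integrable_bumpMeasure φ (hG.comp_sub_left x)
    rw [real_inner_comm, ← integral_inner iG, integral_bumpMeasure]
    -- The reflected bump is an admissible test function exactly because its support, a closed ball
    -- of radius `rOut` about x, stays in the open disc.
    have h1 := h (fun s => ψ (x - s)) (hψs.comp (by fun_prop)) (hψc.comp_homeomorph (Homeomorph.subLeft x)) ?_ e
    · have e1 : ∀ s, fderiv ℝ (fun s => ψ (x - s)) s e = -fderiv ℝ ψ (x - s) e := fun s => by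
        have h2 := ((hψs.differentiable (by simp) (x - s)).hasFDerivAt).comp s
          ((hasFDerivAt_id s).const_sub x)
        have h3 : HasFDerivAt (fun s => ψ (x - s)) _ s := h2
        rw [h3.fderiv]; simp
      simp_rw [e1] at h1
      rw [setIntegral_eq_integral_of_forall_compl_eq_zero (fun z hz => by rw [hw0 z hz, zero_mul]),
        setIntegral_eq_integral_of_forall_compl_eq_zero (fun z hz => by rw [hG0 z hz]; simp)] at h1
      have e2 : ∫ t, fderiv ℝ ψ t e * w (x - t) = ∫ s, fderiv ℝ ψ (x - s) e * w s := by
        rw [← integral_sub_left_eq_self (fun t => fderiv ℝ ψ t e * w (x - t)) volume x]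
        simp
      have e3 : ∫ y, ψ y • inner ℝ e (G (x - y)) = ∫ s, ψ (x - s) * inner ℝ (G s) e := by
        rw [← integral_sub_left_eq_self (fun y => ψ y • inner ℝ e (G (x - y))) volume x]
        simp [real_inner_comm]
      rw [e3]
      refine Eq.trans e2 ?_
      simp_rw [mul_neg, integral_neg, neg_inj] at h1
      simp_rw [mul_comm _ (w _), h1, mul_comm (ψ _)]
    · intro z hz
      have hz2 : x - z ∈ tsupport ψ := by
        have := tsupport_comp_subset_preimage ψ (f := fun s => x - s) (by fun_prop)
        exact this hz
      rw [hψ, φ.tsupport_normed_eq, mem_closedBall_zero_iff] at hz2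
      rw [mem_disc]
      have := norm_sub_norm_le z x
      rw [norm_sub_rev] at this
      linarith
  · exact (hψc.fderiv ℝ).convolutionExists_left _ (hψs.continuous_fderiv (by simp)) hw.locallyIntegrable x

lemma IsWeakGrad.congr {v w : ℂ → ℝ} {g G : ℂ → ℂ} (h : IsWeakGrad v g)
    (hw : w =ᵐ[volume.restrict disc] v) (hG : G =ᵐ[volume.restrict disc] g) : IsWeakGrad w G := by
  intro η h1 h2 h3 e
  have e1 : ∫ z in disc, w z * fderiv ℝ η z e = ∫ z in disc, v z * fderiv ℝ η z e :=
    integral_congr_ae (hw.mono fun z hz => by simp only [hz])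
  have e2 : ∫ z in disc, inner ℝ (G z) e * η z = ∫ z in disc, inner ℝ (g z) e * η z :=
    integral_congr_ae (hG.mono fun z hz => by simp only [hz])
  rw [e1, e2]
  exact h η h1 h2 h3 e

/-- An `L²` function on the disc, extended by zero. -/
lemma exists_extension {F : Type*} [NormedAddCommGroup F] {f : ℂ → F}
    (hf : MemLp f 2 (volume.restrict disc)) : ∃ w : ℂ → F, StronglyMeasurable w ∧
      MemLp w 2 volume ∧ Integrable w ∧ (∀ z ∉ disc, w z = 0) ∧ w =ᵐ[volume.restrict disc] f := by
  have hae : disc.indicator (hf.1.mk f) =ᵐ[volume.restrict disc] f := by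
    refine ((ae_restrict_mem measurableSet_disc).and hf.1.ae_eq_mk).mono fun z hz => ?_
    rw [indicator_of_mem hz.1, hz.2]
  have hm : MemLp (hf.1.mk f) 2 (volume.restrict disc) := (memLp_congr_ae hf.1.ae_eq_mk).1 hf
  exact ⟨disc.indicator (hf.1.mk f), hf.1.stronglyMeasurable_mk.indicator measurableSet_disc,
    (memLp_indicator_iff_restrict measurableSet_disc).2 hm,
    (integrable_indicator_iff measurableSet_disc).2 (hm.integrable (by norm_num)),
    fun z hz => indicator_of_notMem hz _, hae⟩

lemma gradient_comp_smul {f : ℂ → ℝ} (hf : Differentiable ℝ f) (l : ℝ) (z : ℂ) :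
    gradient (fun z => f (l • z)) z = l • gradient f (l • z) := by
  refine ext_inner_right ℝ fun e => ?_
  have h : HasFDerivAt (fun z => f (l • z))
      ((fderiv ℝ f (l • z)).comp (l • ContinuousLinearMap.id ℝ ℂ)) z :=
    (hf (l • z)).hasFDerivAt.comp z ((hasFDerivAt_id z).const_smul l)
  rw [inner_smul_left, inner_gradient_left, inner_gradient_left, h.fderiv]
  simp

/-- Functions in the Sobolev space are approximated by functions that are smooth up to the
boundary. -/
lemma exists_contDiff_approx {v : ℂ → ℝ} {g : ℂ → ℂ} (hv : MemLp v 2 (volume.restrict disc))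
    (hg : MemLp g 2 (volume.restrict disc)) (h : IsWeakGrad v g) {ε : ENNReal} (hε : ε ≠ 0) :
    ∃ u : ℂ → ℝ, ContDiff ℝ ∞ u ∧ eLpNorm (u - v) 2 (volume.restrict disc) ≤ ε ∧
      eLpNorm (gradient u - g) 2 (volume.restrict disc) ≤ ε := by
  obtain ⟨w, hws, hw2, hwi, hw0, hwv⟩ := exists_extension hv
  obtain ⟨G, hGs, hG2, hGi, hG0, hGg⟩ := exists_extension hg
  have hwG : IsWeakGrad w G := h.congr hwv hGg
  have hε2 : ε / 2 ≠ 0 := by simp [hε]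
  obtain ⟨δ₁, hδ₁, hδ₁', h₁⟩ := exists_eLpNorm_dilate_shift_sub_le hw2 hε
  obtain ⟨δ₂, hδ₂, hδ₂', h₂⟩ := exists_eLpNorm_dilate_shift_sub_le hG2 hε2
  -- The chain rule for the dilation multiplies the gradient by l = 1 - δ; this third smallness
  -- condition pays for the resulting error δ G.
  obtain ⟨δ₃, hδ₃, h₃⟩ : ∃ δ₃ : ℝ, 0 < δ₃ ∧ ENNReal.ofReal δ₃ * eLpNorm G 2 volume ≤ ε / 2 := by
    have ht : Tendsto (fun t : ℝ => ENNReal.ofReal t * eLpNorm G 2 volume) (𝓝[>] 0) (𝓝 0) := by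
      have := ENNReal.Tendsto.mul_const (b := eLpNorm G 2 volume)
        (((ENNReal.continuous_ofReal.tendsto (0 : ℝ)).mono_left nhdsWithin_le_nhds :
          Tendsto ENNReal.ofReal (𝓝[>] 0) _)) (Or.inr hG2.2.ne)
      simpa using this
    obtain ⟨t, h1, h2⟩ := ((ht.eventually (gt_mem_nhds (pos_iff_ne_zero.2 hε2))).and
      self_mem_nhdsWithin).exists
    exact ⟨t, h2, h1.le⟩
  set δ := min (min δ₁ δ₂) δ₃ with hδ
  have hd0 : 0 < δ := by positivity
  have hd1 : δ ≤ δ₁ := (min_le_left _ _).trans (min_le_left _ _)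
  have hd2 : δ ≤ δ₂ := (min_le_left _ _).trans (min_le_right _ _)
  have hd3 : δ ≤ δ₃ := min_le_right _ _
  -- The mollification radius δ/2 is smaller than the margin δ gained by dilating with 1 - δ, so for
  -- z in the disc only values inside the disc are averaged.
  set φ : ContDiffBump (0 : ℂ) := ⟨δ / 4, δ / 2, by positivity, by linarith⟩ with hφ
  have hrφ : φ.rOut = δ / 2 := rfl
  set l := 1 - δ with hl
  have hl0 : 0 < l := by linarith
  set P := bumpMeasure φ with hP
  have hPy : ∀ᵐ y ∂P, ‖y‖ ≤ δ := (ae_bumpMeasure φ).mono fun y hy => by rw [hrφ] at hy; linarith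
  have a₁ := eLpNorm_average_le (P := P) (l := l) hws
    (hPy.mono fun y hy => h₁ l (by linarith) (by linarith) y (hy.trans hd1))
  have a₂ := eLpNorm_average_le (P := P) (l := l) hGs
    (hPy.mono fun y hy => h₂ l (by linarith) (by linarith) y (hy.trans hd2))
  have hsm := contDiff_mollify φ hwi
  refine ⟨fun z => mollify φ w (l • z), hsm.comp (by fun_prop), ?_, ?_⟩
  · have e : (fun z => mollify φ w (l • z)) - v =ᵐ[volume.restrict disc]
        fun z => ∫ y, (w (l • z - y) - w z) ∂P := by
      refine hwv.mono fun z hz => ?_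
      simp only [Pi.sub_apply]
      rw [integral_sub (integrable_bumpMeasure φ (hwi.comp_sub_left _)) (integrable_const _),
        integral_const, probReal_univ, one_smul, hz, mollify]
    rw [eLpNorm_congr_ae e]
    exact (eLpNorm_mono_measure _ Measure.restrict_le_self).trans a₁
  · have e : gradient (fun z => mollify φ w (l • z)) - g =ᵐ[volume.restrict disc]
        l • (fun z => ∫ y, (G (l • z - y) - G z) ∂P) - (δ • G) := by
      refine ((ae_restrict_mem measurableSet_disc).and hGg).mono fun z hz => ?_
      have hz1 := mem_disc.1 hz.1
      simp only [Pi.sub_apply, Pi.smul_apply]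
      rw [integral_sub (integrable_bumpMeasure φ (hGi.comp_sub_left _)) (integrable_const _),
        gradient_comp_smul (hsm.differentiable (by simp)), gradient_mollify φ hwi hGi hw0 hG0 hwG,
        ← hz.2, integral_const, probReal_univ, one_smul, smul_sub, hl, sub_smul, one_smul]
      · simp only [sub_smul, one_smul]
        abel
      · rw [norm_smul, Real.norm_of_nonneg hl0.le, hrφ]
        nlinarith
    have m₂ : AEStronglyMeasurable (fun z => ∫ y, (G (l • z - y) - G z) ∂P) volume := by
      have hm : StronglyMeasurable (fun p : ℂ × ℂ => G (l • p.1 - p.2) - G p.1) :=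
        (hGs.comp_measurable (by fun_prop)).sub (hGs.comp_measurable measurable_fst)
      exact hm.integral_prod_right.aestronglyMeasurable
    rw [eLpNorm_congr_ae e]
    refine (eLpNorm_mono_measure _ Measure.restrict_le_self).trans ?_
    refine (eLpNorm_sub_le (m₂.const_smul l) (hG2.1.const_smul δ) (by norm_num)).trans ?_
    rw [eLpNorm_const_smul, eLpNorm_const_smul, ← ENNReal.add_halves ε]
    refine add_le_add ?_ ?_
    · refine (mul_le_mul_left ?_ _).trans ((one_mul _).le.trans a₂)
      rw [Real.enorm_of_nonneg hl0.le, ENNReal.ofReal_le_one]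
      linarith
    · refine le_trans ?_ h₃
      rw [Real.enorm_of_nonneg hd0.le]
      gcongr

/-! ### Existence of the trace. -/

lemma eLpNorm_two_eq {F : Type*} [NormedAddCommGroup F] {μ : Measure ℂ} {f : ℂ → F}
    (hf : MemLp f 2 μ) : eLpNorm f 2 μ = ENNReal.ofReal (√(∫ z, ‖f z‖ ^ 2 ∂μ)) := by
  rw [hf.eLpNorm_eq_integral_rpow_norm (by simp) (by simp), Real.sqrt_eq_rpow]
  simp

lemma memLp_arcLength_of_continuous {u : ℂ → ℝ} (hu : Continuous u) (p : ENNReal) :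
    MemLp u p arcLength := by
  obtain ⟨K, hK⟩ := (isCompact_closedBall (0 : ℂ) 1).exists_bound_of_continuousOn hu.continuousOn
  exact MemLp.of_bound hu.aestronglyMeasurable K
    (ae_arcLength_norm.mono fun y hy => hK y (by rw [mem_closedBall_zero_iff, hy]))

/-- Continuity of the boundary values with respect to the norm of the Sobolev space. -/
lemma eLpNorm_boundary_le {u : ℂ → ℝ} (hu : ContDiff ℝ ∞ u) :
    eLpNorm u 2 arcLength ≤ 2 * eLpNorm u 2 (volume.restrict disc) +
      eLpNorm (gradient u) 2 (volume.restrict disc) := by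
  obtain ⟨L, hL⟩ := hu.exists_lipDisc
  have m1 : MemLp u 2 arcLength := memLp_arcLength_of_continuous hu.continuous 2
  have m2 : MemLp u 2 (volume.restrict disc) :=
    memLp_of_continuousOn hu.continuous.continuousOn 2
  have h := integral_sq_boundary_le hu
  rw [eLpNorm_two_eq m1, eLpNorm_two_eq m2, eLpNorm_two_eq (hL.memLp_gradient 2),
    ← ENNReal.ofReal_ofNat, ← ENNReal.ofReal_mul (by norm_num), ← ENNReal.ofReal_add (by positivity) (by positivity)]
  refine ENNReal.ofReal_le_ofReal (Real.sqrt_le_iff.2 ⟨by positivity, ?_⟩)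
  simp only [Real.norm_eq_abs, sq_abs]
  have e1 := Real.sq_sqrt (show 0 ≤ ∫ z in disc, u z ^ 2 from integral_nonneg fun _ => sq_nonneg _)
  have e2 := Real.sq_sqrt (show 0 ≤ ∫ z in disc, ‖gradient u z‖ ^ 2 from integral_nonneg fun _ => sq_nonneg _)
  rw [energy] at h
  nlinarith [Real.sqrt_nonneg (∫ z in disc, u z ^ 2), Real.sqrt_nonneg (∫ z in disc, ‖gradient u z‖ ^ 2),
    mul_nonneg (Real.sqrt_nonneg (∫ z in disc, u z ^ 2)) (Real.sqrt_nonneg (∫ z in disc, ‖gradient u z‖ ^ 2))]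

lemma weakGrad_spec {v : ℂ → ℝ} (h : MemH1 v) :
    MemLp (weakGrad v) 2 (volume.restrict disc) ∧ IsWeakGrad v (weakGrad v) := by
  rw [weakGrad, dif_pos h.2]
  exact h.2.choose_spec

/-- Approximations at the geometric rate 2⁻ⁿ have boundary values that are Cauchy in L² of the
circle with summable bounds, by `eLpNorm_boundary_le`; completeness gives the limit. -/
lemma exists_isTrace {v : ℂ → ℝ} (h : MemH1 v) : ∃ τ, IsTrace v τ := by
  obtain ⟨hg, hvg⟩ := weakGrad_spec h
  have hpos : ∀ n : ℕ, (2⁻¹ : ENNReal) ^ n ≠ 0 := fun n => by simp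
  choose u hu hu1 hu2 using fun n => exists_contDiff_approx h.1 hg hvg (hpos n)
  have ht : Tendsto (fun n : ℕ => (2⁻¹ : ENNReal) ^ n) atTop (𝓝 0) :=
    ENNReal.tendsto_pow_atTop_nhds_zero_of_lt_one (by norm_num)
  have hm : ∀ n, MemLp (u n) 2 arcLength := fun n =>
    memLp_arcLength_of_continuous (hu n).continuous 2
  have hm' : ∀ n, MemLp (u n) 2 (volume.restrict disc) := fun n =>
    memLp_of_continuousOn (hu n).continuous.continuousOn 2
  have hc : ∀ N n m : ℕ, N ≤ n → N ≤ m →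
      eLpNorm (u n - u m) 2 arcLength < 7 * (2⁻¹ : ENNReal) ^ N := by
    intro N n m hn hmN
    have p1 : ∀ k, N ≤ k → (2⁻¹ : ENNReal) ^ k ≤ 2⁻¹ ^ N := fun k hk =>
      pow_le_pow_right_of_le_one' (by norm_num) hk
    have hgr : gradient (u n - u m) = gradient (u n) - gradient (u m) := by
      ext1 z
      simp only [gradient, Pi.sub_apply]
      rw [fderiv_sub ((hu n).differentiable (by simp) z) ((hu m).differentiable (by simp) z), map_sub]
    have gm : ∀ k, MemLp (gradient (u k)) 2 (volume.restrict disc) := fun k => by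
      obtain ⟨L, hL⟩ := (hu k).exists_lipDisc
      exact hL.memLp_gradient 2
    have q1 : eLpNorm (u n - u m) 2 (volume.restrict disc) ≤ 2⁻¹ ^ N + 2⁻¹ ^ N := by
      have e : u n - u m = (u n - v) - (u m - v) := by abel
      rw [e]
      exact (eLpNorm_sub_le ((hm' n).1.sub h.1.1) ((hm' m).1.sub h.1.1) (by norm_num)).trans
        (add_le_add ((hu1 n).trans (p1 n hn)) ((hu1 m).trans (p1 m hmN)))
    have q2 : eLpNorm (gradient (u n - u m)) 2 (volume.restrict disc) ≤ 2⁻¹ ^ N + 2⁻¹ ^ N := by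
      have e : gradient (u n - u m) = (gradient (u n) - weakGrad v) - (gradient (u m) - weakGrad v) := by
        rw [hgr]; abel
      rw [e]
      exact (eLpNorm_sub_le ((gm n).1.sub hg.1) ((gm m).1.sub hg.1) (by norm_num)).trans
        (add_le_add ((hu2 n).trans (p1 n hn)) ((hu2 m).trans (p1 m hmN)))
    have hfin : (2⁻¹ : ENNReal) ^ N ≠ ⊤ := ENNReal.pow_ne_top (by simp)
    calc _ ≤ 2 * (2⁻¹ ^ N + 2⁻¹ ^ N) + (2⁻¹ ^ N + 2⁻¹ ^ N) :=
          (eLpNorm_boundary_le ((hu n).sub (hu m))).trans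
            (add_le_add (mul_le_mul_right q1 _) q2)
      _ = 6 * (2⁻¹ : ENNReal) ^ N := by ring
      _ < _ := by
          rw [ENNReal.mul_lt_mul_iff_left (hpos N) hfin]
          norm_num
  have hs : ∑' N : ℕ, 7 * (2⁻¹ : ENNReal) ^ N ≠ ⊤ := by
    rw [ENNReal.tsum_mul_left, ENNReal.tsum_geometric]
    refine ENNReal.mul_ne_top (by simp) ?_
    simp
  obtain ⟨τ, hτ, hlim⟩ := Lp.cauchy_complete_eLpNorm (by norm_num) hm hs hc
  exact ⟨τ, hτ, u, hu, tendsto_of_tendsto_of_tendsto_of_le_of_le tendsto_const_nhds ht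
    (fun _ => zero_le) hu1, tendsto_of_tendsto_of_tendsto_of_le_of_le tendsto_const_nhds ht
    (fun _ => zero_le) hu2, hlim⟩

lemma isTrace_trace {v : ℂ → ℝ} (h : MemH1 v) : IsTrace v (trace v) := by
  have := exists_isTrace h
  rw [trace, dif_pos this]
  exact this.choose_spec

/-! ### Passage to the limit in exponential integrals. -/

section Limits

variable {μ : Measure ℂ} {F : Type*} [NormedAddCommGroup F]

lemma tendsto_integral_norm_sq {f : ℕ → ℂ → F} {g : ℂ → F} (hf : ∀ n, MemLp (f n) 2 μ)
    (hg : MemLp g 2 μ) (h : Tendsto (fun n => eLpNorm (f n - g) 2 μ) atTop (𝓝 0)) :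
    Tendsto (fun n => ∫ z, ‖f n z‖ ^ 2 ∂μ) atTop (𝓝 (∫ z, ‖g z‖ ^ 2 ∂μ)) := by
  have key : ∀ {k : ℂ → F} (hk : MemLp k 2 μ), ‖hk.toLp k‖ ^ 2 = ∫ z, ‖k z‖ ^ 2 ∂μ := fun {k} hk => by
    rw [Lp.norm_toLp, eLpNorm_two_eq hk, ENNReal.toReal_ofReal (Real.sqrt_nonneg _),
      Real.sq_sqrt (integral_nonneg fun _ => by positivity)]
  have := (((Lp.tendsto_Lp_iff_tendsto_eLpNorm'' f hf g hg).2 h).norm).pow 2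
  simpa only [key] using this

lemma tendsto_integral_of_eLpNorm_two [NormedSpace ℝ F] [IsFiniteMeasure μ] {f : ℕ → ℂ → F} {g : ℂ → F}
    (hf : ∀ n, MemLp (f n) 2 μ) (hg : MemLp g 2 μ)
    (h : Tendsto (fun n => eLpNorm (f n - g) 2 μ) atTop (𝓝 0)) :
    Tendsto (fun n => ∫ z, f n z ∂μ) atTop (𝓝 (∫ z, g z ∂μ)) := by
  refine tendsto_integral_of_L1' g hg.1
    (Eventually.of_forall fun n => (hf n).integrable (by norm_num)) ?_
  have h2 := ENNReal.Tendsto.mul_const (b := μ univ ^ (1 / (1 : ENNReal).toReal - 1 / (2 : ENNReal).toReal)) h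
    (Or.inr (ENNReal.rpow_ne_top_of_nonneg (by norm_num) (measure_ne_top _ _)))
  rw [zero_mul] at h2
  exact tendsto_of_tendsto_of_tendsto_of_le_of_le tendsto_const_nhds h2 (fun _ => zero_le)
    fun n => eLpNorm_le_eLpNorm_mul_rpow_measure_univ (by norm_num) ((hf n).sub hg).1

/-- The exponential of an `L²` limit is square integrable if the squares of the exponentials are
bounded in mean. -/
lemma memLp_exp_of_tendsto {f : ℕ → ℂ → ℝ} {g : ℂ → ℝ}
    (hf : ∀ n, MemLp (f n) 2 μ) (hg : MemLp g 2 μ)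
    (h : Tendsto (fun n => eLpNorm (f n - g) 2 μ) atTop (𝓝 0))
    (he : ∀ n, MemLp (fun z => Real.exp (f n z)) 2 μ) {K : ℝ}
    (hK : ∀ n, ∫ z, Real.exp (f n z) ^ 2 ∂μ ≤ K) : MemLp (fun z => Real.exp (g z)) 2 μ := by
  obtain ⟨s, -, hs⟩ := (tendstoInMeasure_of_tendsto_eLpNorm (by simp) (fun n => (hf n).1) hg.1 h).exists_seq_tendsto_ae
  refine ⟨Real.continuous_exp.comp_aestronglyMeasurable hg.1, ?_⟩
  refine (Lp.eLpNorm_lim_le_liminf_eLpNorm (fun n => (he (s n)).1) _ (hs.mono fun z hz =>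
    (Real.continuous_exp.tendsto _).comp hz)).trans_lt ?_
  refine lt_of_le_of_lt (b := ENNReal.ofReal (√K)) ?_ ENNReal.ofReal_lt_top
  refine (liminf_le_liminf (v := fun _ : ℕ => ENNReal.ofReal (√K)) (Eventually.of_forall fun n => ?_)).trans (by simp)
  rw [eLpNorm_two_eq (he (s n))]
  refine ENNReal.ofReal_le_ofReal (Real.sqrt_le_sqrt ?_)
  simpa only [Real.norm_eq_abs, sq_abs] using hK (s n)

/-- The exponential is convex, so the difference is at most |a - b| times the larger exponential.
Together with Cauchy-Schwarz this turns L² convergence and bounded L² norms of the exponentials into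
L¹ convergence. -/
lemma abs_exp_sub_exp_le (a b : ℝ) :
    |Real.exp a - Real.exp b| ≤ |a - b| * (Real.exp a + Real.exp b) := by
  wlog hab : b ≤ a generalizing a b
  · rw [abs_sub_comm, abs_sub_comm a, add_comm]; exact this b a (le_of_not_ge hab)
  rw [abs_of_nonneg (sub_nonneg.2 (Real.exp_le_exp.2 hab)), abs_of_nonneg (sub_nonneg.2 hab)]
  have h := Real.add_one_le_exp (b - a)
  have h1 : Real.exp b = Real.exp a * Real.exp (b - a) := by rw [← Real.exp_add]; congr 1; ring
  have h2 := Real.exp_pos a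
  have h3 := Real.exp_pos b
  nlinarith [mul_nonneg (sub_nonneg.2 hab) h3.le]

/-- Convergence of weighted exponential integrals. -/
lemma tendsto_integral_exp_smul [IsFiniteMeasure μ] [NormedSpace ℝ F] {f : ℕ → ℂ → ℝ} {g : ℂ → ℝ}
    (hf : ∀ n, MemLp (f n) 2 μ) (hg : MemLp g 2 μ)
    (h : Tendsto (fun n => eLpNorm (f n - g) 2 μ) atTop (𝓝 0))
    (he : ∀ n, MemLp (fun z => Real.exp (f n z)) 2 μ) {K : ℝ}
    (hK : ∀ n, ∫ z, Real.exp (f n z) ^ 2 ∂μ ≤ K) {w : ℂ → F} (hw : AEStronglyMeasurable w μ) {c : ℝ}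
    (hc : ∀ᵐ z ∂μ, ‖w z‖ ≤ c) :
    Tendsto (fun n => ∫ z, Real.exp (f n z) • w z ∂μ) atTop (𝓝 (∫ z, Real.exp (g z) • w z ∂μ)) := by
  have hG := memLp_exp_of_tendsto hf hg h he hK
  have i1 : ∀ {k : ℂ → ℝ}, MemLp (fun z => Real.exp (k z)) 2 μ →
      Integrable (fun z => Real.exp (k z) • w z) μ := fun hk => by
    refine (hk.integrable (by norm_num)).smul_bdd c hw hc
  set A := ∫ z, Real.exp (g z) ^ 2 ∂μ with hA
  have hN := tendsto_integral_norm_sq (fun n => (hf n).sub hg) (MemLp.zero (p := 2) (μ := μ))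
    (by simpa using h)
  simp only [Pi.zero_apply, norm_zero, Real.norm_eq_abs, sq_abs, ne_eq, OfNat.ofNat_ne_zero, not_false_eq_true, zero_pow,
    integral_zero, Pi.sub_apply] at hN
  have hb : Tendsto (fun n => √((∫ z, (f n z - g z) ^ 2 ∂μ) * (2 * (K + A))) * |c|) atTop (𝓝 0) := by
    have := ((hN.mul_const (2 * (K + A))).sqrt).mul_const |c|
    simpa using this
  rw [tendsto_iff_norm_sub_tendsto_zero]
  refine tendsto_of_tendsto_of_tendsto_of_le_of_le tendsto_const_nhds hb (fun _ => norm_nonneg _) fun n => ?_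
  rw [← integral_sub (i1 (he n)) (i1 hG)]
  have m1 : MemLp (fun z => |f n z - g z|) 2 μ := ((hf n).sub hg).abs
  have m2 : MemLp (fun z => Real.exp (f n z) + Real.exp (g z)) 2 μ := (he n).add hG
  have s1 := sq_integral_mul_le m1 m2
  simp only [sq_abs] at s1
  have s2 : ∫ z, (Real.exp (f n z) + Real.exp (g z)) ^ 2 ∂μ ≤ 2 * (K + A) := by
    have j := (((he n).integrable_sq.add hG.integrable_sq).const_mul 2)
    calc _ ≤ ∫ z, 2 * (Real.exp (f n z) ^ 2 + Real.exp (g z) ^ 2) ∂μ :=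
          integral_mono m2.integrable_sq j fun z => by
            simp only
            nlinarith [sq_nonneg (Real.exp (f n z) - Real.exp (g z))]
      _ = 2 * (∫ z, Real.exp (f n z) ^ 2 ∂μ + A) := by
          rw [integral_const_mul, integral_add (he n).integrable_sq hG.integrable_sq]
      _ ≤ _ := by have := hK n; linarith
  calc _ ≤ ∫ z, (|f n z - g z| * (Real.exp (f n z) + Real.exp (g z))) * |c| ∂μ := by
        refine norm_integral_le_of_norm_le ((m1.integrable_mul m2).mul_const _) (hc.mono fun z hz => ?_)
        rw [← sub_smul, norm_smul]
        exact mul_le_mul (abs_exp_sub_exp_le _ _) (hz.trans (le_abs_self c)) (norm_nonneg _) (by positivity)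
    _ = (∫ z, |f n z - g z| * (Real.exp (f n z) + Real.exp (g z)) ∂μ) * |c| := integral_mul_const _ _
    _ ≤ _ := by
        gcongr
        refine Real.le_sqrt_of_sq_le (s1.trans ?_)
        exact mul_le_mul_of_nonneg_left s2 (integral_nonneg fun _ => sq_nonneg _)

end Limits

/-- An exponential inequality on the disc without any normalization. -/
lemma exists_integral_exp_disc_le_energy : ∃ C, ∀ u : ℂ → ℝ, ContDiff ℝ ∞ u →
    ∫ z in disc, Real.exp (2 * u z) ≤ Real.exp (2 * cmean u + energy u / Real.pi + C) := by
  set b := Real.log 2 + max logCircleConst (8 * logCircleConst) with hb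
  refine ⟨Real.log (discConst 1) + 49 / 25 * b + 1 / 50 * logCircleConst, fun u hu => ?_⟩
  obtain ⟨L, hL⟩ := hu.exists_lipDisc
  have hpi := Real.pi_pos
  have h1 := integral_exp_disc_le hu MeasurableSet.univ measurableSet_disc subset_rfl one_pos
    (fun y _ z _ hz => absurd (mem_univ z) hz)
  have h2 := integral_exp_two_boundary_le hu
  have h3 := integral_exp_one_boundary_le hu
  have h4 := lowMass_le hu
  have hK := discConst_pos 1
  have hH : harmonicEnergy u / Real.pi ≤ energy u / Real.pi := by gcongr; exact hL.harmonicEnergy_le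
  have hH0 : 0 ≤ harmonicEnergy u / Real.pi := div_nonneg hL.harmonicEnergy_nonneg hpi.le
  rw [Measure.restrict_univ] at h1
  have hA1 : 0 ≤ ∫ z, Real.exp (u z) ∂arcLength := integral_nonneg fun _ => (Real.exp_pos _).le
  have hT0 : 0 ≤ ∫ z, Real.exp (u z) ∂arcLength + lowMass u :=
    add_nonneg hA1 (lowMass_pos hu.continuous).le
  have hA0 : 0 ≤ ∫ z, Real.exp (2 * u z) ∂arcLength := integral_nonneg fun _ => (Real.exp_pos _).le
  have hT : ∫ z, Real.exp (u z) ∂arcLength + lowMass u ≤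
      Real.exp (cmean u + 5 / 18 * (harmonicEnergy u / Real.pi) + b) := by
    have e : Real.exp (cmean u + 5 / 18 * (harmonicEnergy u / Real.pi) + b) = 2 *
        Real.exp (cmean u + 5 / 18 * (harmonicEnergy u / Real.pi) + max logCircleConst (8 * logCircleConst)) := by
      rw [hb, ← add_assoc, add_right_comm, Real.exp_add _ (Real.log 2), Real.exp_log two_pos, mul_comm,
        add_assoc]
    rw [e, two_mul]
    refine add_le_add (h3.trans (Real.exp_le_exp.2 ?_)) (h4.trans (Real.exp_le_exp.2 ?_))
    · linarith [le_max_left logCircleConst (8 * logCircleConst)]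
    · linarith [le_max_right logCircleConst (8 * logCircleConst)]
  refine h1.trans ?_
  calc _ ≤ Real.exp (2 / (7 * Real.pi) * (energy u - harmonicEnergy u)) *
        (Real.exp (Real.log (discConst 1)) *
          Real.exp (cmean u + 5 / 18 * (harmonicEnergy u / Real.pi) + b) ^ (49 / 25 : ℝ) *
          Real.exp (2 * cmean u + 10 / 9 * (harmonicEnergy u / Real.pi) + logCircleConst) ^ (1 / 50 : ℝ)) := by
        rw [Real.exp_log hK]
        gcongr
    _ ≤ _ := by
        rw [← Real.exp_mul, ← Real.exp_mul, ← Real.exp_add, ← Real.exp_add, ← Real.exp_add]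
        refine Real.exp_le_exp.2 ?_
        have e : 2 / (7 * Real.pi) * (energy u - harmonicEnergy u) =
          2 / 7 * (energy u / Real.pi) - 2 / 7 * (harmonicEnergy u / Real.pi) := by ring
        rw [e]
        linarith

lemma norm_psi_le {R : ℝ} {z : ℂ} (hR : 0 ≤ R) : ‖psi R z‖ ≤ 1 := by
  rw [psi, norm_smul, norm_mul, Complex.norm_real, Real.norm_of_nonneg hR,
    Real.norm_of_nonneg (by positivity), div_mul_eq_mul_div, div_le_one (by positivity)]
  nlinarith [sq_nonneg (R * ‖z‖ - 1)]

lemma energy_two_mul {u : ℂ → ℝ} (hu : ContDiff ℝ ∞ u) : energy (fun z => 2 * u z) = 4 * energy u := by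
  rw [energy, energy, ← integral_const_mul]
  congr 1; ext z
  rw [norm_gradient, norm_gradient, fderiv_const_mul (hu.differentiable (by simp) z), norm_smul,
    Real.norm_of_nonneg zero_le_two]
  ring

lemma cmean_two_mul (u : ℂ → ℝ) : cmean (fun z => 2 * u z) = 2 * cmean u := by
  rw [cmean, cmean, integral_const_mul]; ring

/-- The exponential inequality for centred functions in the Sobolev space, in terms of a trace. -/
theorem exists_bound_of_isTrace {R₀ : ℝ} (hR₀ : 0 < R₀) : ∃ C, ∀ v τ : ℂ → ℝ, MemH1 v → IsTrace v τ →
    ∀ R, R₀ ≤ R → R < 1 → centreVector R v τ = 0 →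
    Integrable (fun z => Real.exp (τ z)) arcLength ∧
    Integrable (fun z => Real.exp (2 * v z)) (volume.restrict disc) ∧
    ∫ z in disc, Real.exp (2 * v z) ≤ Real.exp (2 * (cmean τ +
      1 / 6 * ((∫ z in disc, ‖weakGrad v z‖ ^ 2) / Real.pi) + C)) ∧
    ∫ z, Real.exp (τ z) ∂arcLength ≤ Real.exp (cmean τ +
      1 / 6 * ((∫ z in disc, ‖weakGrad v z‖ ^ 2) / Real.pi) + C) := by
  obtain ⟨C, hC⟩ := exists_massBound_of_centred hR₀
  obtain ⟨C', hC'⟩ := exists_integral_exp_disc_le_energy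
  refine ⟨C, fun v τ hv hτ R hR hR1 hcv => ?_⟩
  obtain ⟨hτ2, u, hu, hu1, hu2, hu3⟩ := hτ
  have hpi := Real.pi_pos
  have hg := (weakGrad_spec hv).1
  have mc : ∀ {k : ℂ → ℝ}, Continuous k → MemLp k 2 arcLength := fun hk =>
    memLp_arcLength_of_continuous hk 2
  have md : ∀ {k : ℂ → ℝ}, Continuous k → MemLp k 2 (volume.restrict disc) := fun hk =>
    memLp_of_continuousOn hk.continuousOn 2
  have hE : Tendsto (fun n => energy (u n)) atTop (𝓝 (∫ z in disc, ‖weakGrad v z‖ ^ 2)) :=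
    tendsto_integral_norm_sq (fun n => by
      obtain ⟨L, hL⟩ := (hu n).exists_lipDisc
      exact hL.memLp_gradient 2) hg hu2
  have hm : Tendsto (fun n => cmean (u n)) atTop (𝓝 (cmean τ)) :=
    (tendsto_integral_of_eLpNorm_two (fun n => mc (hu n).continuous) hτ2 hu3).const_mul _
  obtain ⟨E', hE'⟩ := hE.bddAbove_range
  obtain ⟨m', hm'⟩ := hm.bddAbove_range
  have hE1 : ∀ n, energy (u n) ≤ E' := fun n => hE' (mem_range_self n)
  have hm1 : ∀ n, cmean (u n) ≤ m' := fun n => hm' (mem_range_self n)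
  have k1 : ∀ n, ∫ z, Real.exp (u n z) ^ 2 ∂arcLength ≤
      Real.exp (2 * m' + 10 / 9 * (E' / Real.pi) + logCircleConst) := fun n => by
    obtain ⟨L, hL⟩ := (hu n).exists_lipDisc
    have hH : harmonicEnergy (u n) / Real.pi ≤ E' / Real.pi := by
      gcongr; exact hL.harmonicEnergy_le.trans (hE1 n)
    simp only [← Real.exp_nat_mul, Nat.cast_ofNat]
    refine (integral_exp_two_boundary_le (hu n)).trans (Real.exp_le_exp.2 ?_)
    linarith [hm1 n]
  -- The unnormalized inequality is applied to 2 u n: its energy coefficient is irrelevant here,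
  -- only uniformity in n counts.
  have k2 : ∀ n, ∫ z in disc, Real.exp (2 * u n z) ^ 2 ≤
      Real.exp (4 * m' + 4 * (E' / Real.pi) + C') := fun n => by
    have hH : energy (u n) / Real.pi ≤ E' / Real.pi := by gcongr; exact hE1 n
    have h := hC' (fun z => 2 * u n z) (contDiff_const.mul (hu n))
    rw [energy_two_mul (hu n), cmean_two_mul] at h
    simp only [← Real.exp_nat_mul, Nat.cast_ofNat]
    refine h.trans (Real.exp_le_exp.2 ?_)
    rw [mul_div_assoc]
    linarith [hm1 n]
  have c1 : ∀ n, Continuous fun z => Real.exp (u n z) := fun n =>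
    Real.continuous_exp.comp (hu n).continuous
  have c2' : ∀ n, Continuous fun z => 2 * u n z := fun n => continuous_const.mul (hu n).continuous
  have c2 : ∀ n, Continuous fun z => Real.exp (2 * u n z) := fun n => Real.continuous_exp.comp (c2' n)
  have hv2 : MemLp (fun z => 2 * v z) 2 (volume.restrict disc) := hv.1.const_mul 2
  have h2u : Tendsto (fun n => eLpNorm ((fun z => 2 * u n z) - fun z => 2 * v z) 2 (volume.restrict disc))
      atTop (𝓝 0) := by
    have e : ∀ n, ((fun z => 2 * u n z) - fun z => 2 * v z) = (2 : ℝ) • (u n - v) := fun n => by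
      ext z; simp; ring
    simp only [e, eLpNorm_const_smul]
    simpa using ENNReal.Tendsto.const_mul (a := ‖(2 : ℝ)‖ₑ) hu1 (Or.inr (by simp))
  have M1 := memLp_exp_of_tendsto (fun n => mc (hu n).continuous) hτ2 hu3 (fun n => mc (c1 n)) k1
  have M2 := memLp_exp_of_tendsto (fun n => md (c2' n)) hv2 h2u (fun n => md (c2 n)) k2
  have I1 : Integrable (fun z => Real.exp (τ z)) arcLength := M1.integrable (by norm_num)
  have I2 : Integrable (fun z => Real.exp (2 * v z)) (volume.restrict disc) :=
    M2.integrable (by norm_num)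
  have A := tendsto_integral_exp_smul (fun n => mc (hu n).continuous) hτ2 hu3 (fun n => mc (c1 n)) k1
    (w := fun _ => (1 : ℝ)) aestronglyMeasurable_const (c := 1) (ae_of_all _ fun _ => by simp)
  have D := tendsto_integral_exp_smul (fun n => md (c2' n)) hv2 h2u (fun n => md (c2 n)) k2
    (w := fun _ => (1 : ℝ)) aestronglyMeasurable_const (c := 1) (ae_of_all _ fun _ => by simp)
  have hR0 : 0 ≤ R := hR₀.le.trans hR
  have Ac := tendsto_integral_exp_smul (fun n => mc (hu n).continuous) hτ2 hu3 (fun n => mc (c1 n)) k1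
    (w := psi R) (continuous_psi R).aestronglyMeasurable (c := 1) (ae_of_all _ fun _ => norm_psi_le hR0)
  have Dc := tendsto_integral_exp_smul (fun n => md (c2' n)) hv2 h2u (fun n => md (c2 n)) k2
    (w := psi R) (continuous_psi R).aestronglyMeasurable (c := 1) (ae_of_all _ fun _ => norm_psi_le hR0)
  simp only [smul_eq_mul, mul_one] at A D
  have hcn : Tendsto (fun n => centreVector R (u n) (u n)) atTop (𝓝 (centreVector R v τ)) :=
    (Dc.const_smul (1 / 2 : ℝ)).add Ac
  rw [hcv] at hcn
  have hM : Tendsto (fun n => R₀ / 16 * (massMeasure (u n)).real univ) atTop (𝓝 (R₀ / 16 *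
      (1 / 2 * (∫ z in disc, Real.exp (2 * v z)) + ∫ z, Real.exp (τ z) ∂arcLength))) := by
    have e : ∀ n, (massMeasure (u n)).real univ =
        1 / 2 * (∫ z in disc, Real.exp (2 * u n z)) + ∫ z, Real.exp (u n z) ∂arcLength := fun n => by
      rw [massMeasure_real (hu n).continuous MeasurableSet.univ, inter_univ, Measure.restrict_univ]
    simp only [e]
    exact ((D.const_mul _).add A).const_mul _
  have hpos : 0 < R₀ / 16 *
      (1 / 2 * (∫ z in disc, Real.exp (2 * v z)) + ∫ z, Real.exp (τ z) ∂arcLength) := by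
    have p1 : 0 ≤ ∫ z in disc, Real.exp (2 * v z) := integral_nonneg fun _ => (Real.exp_pos _).le
    have : NeZero arcLength := ⟨fun h => by
      have := integral_one_arcLength
      rw [h] at this
      simp at this⟩
    have p2 := integral_exp_pos I1
    positivity
  -- The approximations are not centred, but their centre vectors tend to 0 while their masses tend
  -- to a positive limit, so the tolerance of the smooth theorem is met eventually.
  have hev : ∀ᶠ n in atTop, MassBound C (u n) := by
    filter_upwards [hcn.norm.eventually_lt hM (by simpa using hpos)] with n hn
    exact hC (u n) (hu n) R hR hR1 hn.le
  have hX : Tendsto (fun n => cmean (u n) + 1 / 6 * (energy (u n) / Real.pi) + C) atTop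
      (𝓝 (cmean τ + 1 / 6 * ((∫ z in disc, ‖weakGrad v z‖ ^ 2) / Real.pi) + C)) :=
    (hm.add ((hE.div_const _).const_mul _)).add_const _
  exact ⟨I1, I2,
    le_of_tendsto_of_tendsto D ((Real.continuous_exp.tendsto _).comp (hX.const_mul 2)) (hev.mono fun n hn => hn.1),
    le_of_tendsto_of_tendsto A ((Real.continuous_exp.tendsto _).comp hX) (hev.mono fun n hn => hn.2)⟩

end DiscSobolev

end

/-! ### Conclusion in terms of averages. -/

theorem lemma2p1 (R₀ R₁ : ℝ) (hR₀ : 0 < R₀) (hR₀₁ : R₀ ≤ R₁) (hR₁ : R₁ < 1) :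
    ∃ C : ℝ, 0 ≤ C ∧
      ∀ v : ℂ → ℝ, DiscSobolev.MemH1 v →
        ∀ R ∈ Set.Icc R₀ R₁, DiscSobolev.IsCentered R v →
          MeasureTheory.Integrable (fun z => Real.exp (DiscSobolev.trace v z))
            DiscSobolev.arcLength ∧
          MeasureTheory.IntegrableOn (fun z => Real.exp (2 * v z)) DiscSobolev.disc ∧
          1 / (6 * Real.pi) * (∫ z in DiscSobolev.disc, ‖DiscSobolev.weakGrad v z‖ ^ 2) +
              (⨍ z, DiscSobolev.trace v z ∂DiscSobolev.arcLength) ≥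
            max (Real.log (⨍ z, Real.exp (DiscSobolev.trace v z) ∂DiscSobolev.arcLength))
                (1 / 2 * Real.log (⨍ z in DiscSobolev.disc, Real.exp (2 * v z))) - C := by
  obtain ⟨C, hC⟩ := DiscSobolev.exists_bound_of_isTrace hR₀
  refine ⟨max C 0, le_max_right _ _, fun v hv R hR hc => ?_⟩
  obtain ⟨i1, i2, hD, hA⟩ := hC v (DiscSobolev.trace v) hv (DiscSobolev.isTrace_trace hv) R hR.1
    (hR.2.trans_lt hR₁) hc
  refine ⟨i1, i2, ?_⟩
  have hpi := Real.pi_gt_three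
  have hne : NeZero DiscSobolev.arcLength := ⟨fun h => by
    have := DiscSobolev.integral_one_arcLength
    rw [h] at this
    simp at this⟩
  have hnd : NeZero (MeasureTheory.volume.restrict DiscSobolev.disc) := ⟨fun h => by
    have := DiscSobolev.integral_one_disc
    rw [← MeasureTheory.measureReal_restrict_apply_univ, h] at this
    simp at this
    linarith⟩
  have pA := MeasureTheory.integral_exp_pos i1
  have pD := MeasureTheory.integral_exp_pos i2
  have lA := (Real.log_le_iff_le_exp pA).2 hA
  have lD := (Real.log_le_iff_le_exp pD).2 hD
  -- Passing from integrals to averages subtracts log(2π) and ½ log π. Both are nonnegative, so the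
  -- normalization only helps.
  have l2 : 0 ≤ Real.log (2 * Real.pi) := Real.log_nonneg (by linarith)
  have l1 : 0 ≤ Real.log Real.pi := Real.log_nonneg (by linarith)
  have hC0 := le_max_left C 0
  rw [MeasureTheory.average_eq, MeasureTheory.average_eq, MeasureTheory.average_eq,
    MeasureTheory.measureReal_restrict_apply_univ, DiscSobolev.integral_one_arcLength,
    DiscSobolev.integral_one_disc]
  simp only [smul_eq_mul]
  rw [Real.log_mul (by positivity) pA.ne', Real.log_mul (by positivity) pD.ne', Real.log_inv,
    Real.log_inv, ← DiscSobolev.cmean]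
  have e : 1 / (6 * Real.pi) * (∫ z in DiscSobolev.disc, ‖DiscSobolev.weakGrad v z‖ ^ 2) =
      1 / 6 * ((∫ z in DiscSobolev.disc, ‖DiscSobolev.weakGrad v z‖ ^ 2) / Real.pi) := by
    field_simp
  rw [e, ge_iff_le, sub_le_iff_le_add]
  refine max_le ?_ ?_ <;> linarith
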